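/- **Setting.** Let $V,W$ be finite-dimensional real normed spaces, $F$ a real Banach space and $S$ a finite-dimensional real Banach space. Let $p,q\in[1,\infty)$, $\kappa=\lfloor p\rfloor$, $\lambda=\lfloor q\rfloor$. Each $V^{\otimes k}$ carries the projective tensor norm and $T^{<n}(V)=\bigoplus_{k<n}V^{\otimes k}$ the $\ell^1$ norm; $\boxtimes$ is the external tensor product, $\mathbf 1$ is the unit, and $L_x\eta=x\otimes\eta$ is left multiplication in the truncated tensor algebra. Let $\omega_{\mathbf X},\omega_{\mathbf Y}$ be controls on $[a,b]$, $[c,d]$ (continuous, superadditive, nonnegative functions on $\{s\le t\}$, zero on the diagonal). Let $\mathbf X\in\Omega G_{p,\omega_{\mathbf X}}([a,b],V)$ and $\mathbf Y\in\Omega G_{q,\omega_{\mathbf Y}}([c,d],W)$ be geometric rough paths: $\mathbf X_{s,s}=\mathbf 1$, $\mathbf X_{s,u}=\mathbf X_{s,t}\otimes\mathbf X_{t,u}$ for $s\le t\le u$, and $\mathbf X$ lies in the closure of $C^1_{\omega_{\mathbf X}}$ in $C^p_{\omega_{\mathbf X}}$, for maps from $\{s\le t\}$ to the free step-$\kappa$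 nilpotent group $G^{\kappa}(V)$ with its Carnot–Carathéodory metric $d$, where $\mathbf X\in C^r_\omega$ means $\sup_{s\le t} d(\mathbf 1,\mathbf X_{s,t})/\omega(s,t)^{1/r}<\infty$; similarly for $\mathbf Y$. A map $Z:[a,b]\times[c,d]\to\mathrm{Hom}(T^{<\kappa}(V)\boxtimes T^{<\lambda}(W),F)$ is a *two-parameter $(\mathbf X,\mathbf Y)$-controlled path* if the remainders $$R^1_{s,t}(u)=Z_{t,u}-Z_{s,u}\circ[L_{\mathbf X^{<\kappa}_{s,t}}\boxtimes\mathrm{id}],\qquad R^2_{u,v}(s)=Z_{s,v}-Z_{s,u}\circ[\mathrm{id}\boxtimes L_{\mathbf Y^{<\lambda}_{u,v}}]$$ satisfy, for finite constants $C_1,C_2$, all $s\le t$, $u\le v$, all $j<\kappa$, $k<\lambda$, and all $\eta_j\in V^{\otimes j}$, $\xi\in T^{<\lambda}(W)$, $\eta\in T^{<\kappa}(V)$, $\xi_k\in W^{\otimes k}$, $$\|R^1_{s,t}(u)[\eta_j\boxtimes\xi]\|\le C_1\,\omega_{\mathbf X}(s,t)^{(\kappa-j)/p}\|\eta_j\|\|\xi\|,\qquad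 \|R^2_{u,v}(s)[\eta\boxtimes\xi_k]\|\le C_2\,\omega_{\mathbf Y}(u,v)^{(\lambda-k)/q}\|\eta\|\|\xi_k\|.$$ Its *second-level remainder* is $\mathbf R=R^1_{s,t}(v)-R^1_{s,t}(u)\circ[\mathrm{id}\boxtimes L_{\mathbf Y^{<\lambda}_{u,v}}]$; it *has finite joint variation* if for some finite $C$, $\|\mathbf R[\eta_j\boxtimes\xi_k]\|\le C\,\omega_{\mathbf X}(s,t)^{(\kappa-j)/p}\omega_{\mathbf Y}(u,v)^{(\lambda-k)/q}\|\eta_j\|\|\xi_k\|$ for all $s\le t$, $u\le v$, $j<\kappa$, $k<\lambda$, $\eta_j\in V^{\otimes j}$, $\xi_k\in W^{\otimes k}$. The trace is $Z^{(0,0)}_{t,v}=Z_{t,v}[\mathbf 1\boxtimes\mathbf 1]$. Let $\Delta$ be the shuffle coproduct, i.e. the algebra morphism with $\Delta v=v\otimes\mathbf 1+\mathbf 1\otimes v$ on vectors; $\Delta^m$ is its iterate with $m$ output factors; $\tilde\Delta^m$ is the part of $\Delta^m$ all of whose factors have level $\ge1$; and $\widetilde{(\Delta\boxtimes\Delta)}{}^{\ell}$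 is the part of $(\Delta\boxtimes\Delta)^\ell:T^{<\kappa}(V)\boxtimes T^{<\lambda}(W)\to(T^{<\kappa}(V)\boxtimes T^{<\lambda}(W))^{\otimes\ell}$ none of whose factors has bidegree $(0,0)$. **Proposition.** Let $g:F\to S$ be Fréchet smooth ($C^\infty$) and let $Z$ be a two-parameter $(\mathbf X,\mathbf Y)$-controlled path with values in $F$. There is exactly one map $g(Z):[a,b]\times[c,d]\to\mathrm{Hom}(T^{<\kappa}(V)\boxtimes T^{<\lambda}(W),S)$ such that, for all $(t,v)\in[a,b]\times[c,d]$, $g(Z)_{t,v}[\mathbf 1\boxtimes\mathbf 1]=g(Z^{(0,0)}_{t,v})$ and, for all $\xi_j\in V^{\otimes j}$ and $\eta_k\in W^{\otimes k}$ with $0<j<\kappa$, $0<k<\lambda$, $$g(Z)_{t,v}[\xi_j\boxtimes\mathbf 1]=\sum_{m=1}^{\kappa-1}\frac1{m!}D^mg(Z^{(0,0)}_{t,v})\circ (Z_{t,v}[\,\cdot\boxtimes\mathbf 1])^{\otimes m}\circ\tilde\Delta^m[\xi_j],$$ $$g(Z)_{t,v}[\mathbf 1\boxtimes\eta_k]=\sum_{n=1}^{\lambda-1}\frac1{n!}D^ng(Z^{(0,0)}_{t,v})\circ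 (Z_{t,v}[\mathbf 1\boxtimes\cdot\,])^{\otimes n}\circ\tilde\Delta^n[\eta_k],$$ $$g(Z)_{t,v}[\xi_j\boxtimes\eta_k]=\sum_{\ell=1}^{\kappa+\lambda-2}\frac1{\ell!}D^\ell g(Z^{(0,0)}_{t,v})\circ Z_{t,v}^{\otimes\ell}\circ\widetilde{(\Delta\boxtimes\Delta)}{}^{\ell}[\xi_j\boxtimes\eta_k].$$ This $g(Z)$ is a two-parameter $(\mathbf X,\mathbf Y)$-controlled path with values in $S$. If moreover the second-level remainder of $Z$ has finite joint variation, then so has that of $g(Z)$. -/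

import Mathlib

open scoped TensorProduct ENNReal

noncomputable section

namespace TwoParam

/-! ### The tensor algebra, its levels and its truncations -/

section Tensor

attribute [local instance] LieRing.ofAssociativeRing

variable (V : Type*) [NormedAddCommGroup V] [NormedSpace ℝ V]

/-- The coordinate `x ↦ x^{(k)} ∈ V^{⊗k}` of an element of the tensor algebra. -/
def coord (k : ℕ) : TensorAlgebra ℝ V →ₗ[ℝ] ⨂[ℝ]^k V :=
  DirectSum.component ℝ ℕ (fun n => ⨂[ℝ]^n V) k ∘ₗ
    (TensorAlgebra.toDirectSum (R := ℝ) (M := V)).toLinearMap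

/-- The canonical projection `π_k`, as an endomorphism of the tensor algebra. -/
def proj (k : ℕ) : TensorAlgebra ℝ V →ₗ[ℝ] TensorAlgebra ℝ V :=
  TensorPower.toTensorAlgebra ∘ₗ coord V k

/-- The projection `π_{<n}` of the tensor algebra onto the sum of the levels `0, …, n - 1`. -/
def truncate (n : ℕ) : TensorAlgebra ℝ V →ₗ[ℝ] TensorAlgebra ℝ V :=
  ∑ k ∈ Finset.range n, proj V k

/-- The projection `π_{≥1}`. -/
def positivePart : TensorAlgebra ℝ V →ₗ[ℝ] TensorAlgebra ℝ V :=
  LinearMap.id - proj V 0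

/-- The space `T^{<n}(V) = ⨁_{k<n} V^{⊗k}`, as a subspace of the tensor algebra. -/
def Trunc (n : ℕ) : Submodule ℝ (TensorAlgebra ℝ V) :=
  LinearMap.range (truncate V n)

/-- The projection `π_{<n}`, as a map onto `T^{<n}(V)`. -/
def toTrunc (n : ℕ) : TensorAlgebra ℝ V →ₗ[ℝ] Trunc V n :=
  (truncate V n).rangeRestrict

/-- For `j < n` this is the inclusion `V^{⊗j} ⊆ T^{<n}(V)`. -/
def incl (n j : ℕ) : (⨂[ℝ]^j V) →ₗ[ℝ] Trunc V n :=
  toTrunc V n ∘ₗ TensorPower.toTensorAlgebra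

/-- The unit `𝟏` of `T^{<n}(V)`. -/
def unit (n : ℕ) : Trunc V n := toTrunc V n 1

variable {V}

/-- The `ℓ¹` norm on `T^{<n}(V)`; each `V^{⊗k}` carries the projective tensor norm, which is
Mathlib's norm on tensor powers. -/
def truncNorm {n : ℕ} (x : Trunc V n) : ℝ :=
  ∑ k ∈ Finset.range n, ‖coord V k (x : TensorAlgebra ℝ V)‖

/-- Left tensor multiplication `L_x : η ↦ x ⊗ η` on `T^{<n}(V)` (product in the truncated
tensor algebra). -/
def leftMul {n : ℕ} (x : Trunc V n) : Trunc V n →ₗ[ℝ] Trunc V n :=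
  toTrunc V n ∘ₗ LinearMap.mulLeft ℝ (x : TensorAlgebra ℝ V) ∘ₗ (Trunc V n).subtype

/-- The truncated exponential `exp x` in `T^{≤N}(V)`, for `x` without component of level `0`. -/
def truncExp (N : ℕ) (x : TensorAlgebra ℝ V) : TensorAlgebra ℝ V :=
  truncate V (N + 1) (∑ k ∈ Finset.range (N + 1), ((k.factorial : ℝ)⁻¹) • x ^ k)

variable (V)

/-- The step-`N` free nilpotent group `G^N(V) = exp(L^N(V)) ⊆ T^{≤N}(V)`, where `L^N(V)` is the
truncation of the Lie algebra generated by `V` inside the tensor algebra. -/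
def stepGroup (N : ℕ) : Set (TensorAlgebra ℝ V) :=
  {x | ∃ l ∈ LieSubalgebra.lieSpan ℝ (TensorAlgebra ℝ V) (Set.range (TensorAlgebra.ι ℝ (M := V))),
    x = truncExp N l}

variable {V}

/-- The Carnot–Carathéodory distance on `G^N(V)`: the infimum of the lengths of the horizontal
curves from `x` to `y`. A horizontal curve is here one driven by a piecewise linear path in `V`
with successive increments `v₁, …, vₙ`; it leads from `x` to `x ⊗ exp v₁ ⊗ ⋯ ⊗ exp vₙ` and has
length `‖v₁‖ + ⋯ + ‖vₙ‖`. (All rectifiable drivers give the same infimum.) -/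
def ccDist (N : ℕ) (x y : TensorAlgebra ℝ V) : ℝ≥0∞ :=
  ⨅ (l : List V)
    (_ : truncate V (N + 1)
      (x * (l.map fun v => truncExp N (TensorAlgebra.ι ℝ v)).prod) = y),
    (l.map fun v => ‖v‖ₑ).sum

end Tensor

/-! ### The shuffle coproduct -/

section Coproduct

variable (V : Type*) [NormedAddCommGroup V] [NormedSpace ℝ V]

/-- The shuffle coproduct: the algebra morphism with `Δ v = v ⊗ 1 + 1 ⊗ v` for `v ∈ V`. -/
def coproduct : TensorAlgebra ℝ V →ₐ[ℝ] TensorAlgebra ℝ V ⊗[ℝ] TensorAlgebra ℝ V :=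
  TensorAlgebra.lift ℝ
    ((Algebra.TensorProduct.includeLeft (R := ℝ) (S := ℝ) (A := TensorAlgebra ℝ V)
        (B := TensorAlgebra ℝ V)).toLinearMap ∘ₗ TensorAlgebra.ι ℝ +
      (Algebra.TensorProduct.includeRight (R := ℝ) (A := TensorAlgebra ℝ V)
        (B := TensorAlgebra ℝ V)).toLinearMap ∘ₗ TensorAlgebra.ι ℝ)

/-- The iterated shuffle coproduct `Δ^m`, with `m` output factors: the algebra morphism with
`Δ^m v = ∑ i, 1 ⊗ ⋯ ⊗ v ⊗ ⋯ ⊗ 1` (`v` in the `i`-th place) for `v ∈ V`. That it is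
the iterate of `coproduct` is `cons_coproduct` below. -/
def iterCoproduct (m : ℕ) :
    TensorAlgebra ℝ V →ₐ[ℝ] ⨂[ℝ] _ : Fin m, TensorAlgebra ℝ V :=
  TensorAlgebra.lift ℝ (∑ i : Fin m,
    (PiTensorProduct.singleAlgHom (R := ℝ) (A := fun _ : Fin m => TensorAlgebra ℝ V)
      i).toLinearMap ∘ₗ TensorAlgebra.ι ℝ)

/-- The identification `x ⊗ (x₁ ⊗ ⋯ ⊗ x_m) ↦ x ⊗ x₁ ⊗ ⋯ ⊗ x_m`. -/
def consTensor (A : Type*) [AddCommGroup A] [Module ℝ A] (m : ℕ) :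
    A ⊗[ℝ] (⨂[ℝ] _ : Fin m, A) →ₗ[ℝ] ⨂[ℝ] _ : Fin (m + 1), A :=
  TensorProduct.lift
    ((PiTensorProduct.lift : MultilinearMap ℝ (fun _ : Fin m => A) _ ≃ₗ[ℝ] _).toLinearMap ∘ₗ
      (PiTensorProduct.tprod ℝ (s := fun _ : Fin (m + 1) => A)).curryLeft)

@[simp]
theorem consTensor_tmul_tprod (A : Type*) [AddCommGroup A] [Module ℝ A] (m : ℕ) (x : A)
    (y : Fin m → A) :
    consTensor A m (x ⊗ₜ[ℝ] PiTensorProduct.tprod ℝ y) =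
      PiTensorProduct.tprod ℝ (Fin.cons x y : Fin (m + 1) → A) := by
  simp [consTensor]

theorem consTensor_mul (A : Type*) [Ring A] [Algebra ℝ A] (m : ℕ)
    (x y : A ⊗[ℝ] (⨂[ℝ] _ : Fin m, A)) :
    consTensor A m (x * y) = consTensor A m x * consTensor A m y := by
  induction x using TensorProduct.induction_on with
  | zero => simp
  | add x₁ x₂ h₁ h₂ => simp [add_mul, h₁, h₂]
  | tmul x x' =>
    induction y using TensorProduct.induction_on with
    | zero => simp
    | add y₁ y₂ h₁ h₂ => simp only [mul_add, map_add, h₁, h₂]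
    | tmul y y' =>
      induction x' using PiTensorProduct.induction_on with
      | add x₁ x₂ h₁ h₂ =>
        simp only [TensorProduct.tmul_add, add_mul, map_add, h₁, h₂]
      | smul_tprod r x' =>
        induction y' using PiTensorProduct.induction_on with
        | add y₁ y₂ h₁ h₂ =>
          simp only [TensorProduct.tmul_add, mul_add, map_add, h₁, h₂]
        | smul_tprod r' y' =>
          simp only [TensorProduct.tmul_smul, smul_mul_assoc, mul_smul_comm, map_smul,
            Algebra.TensorProduct.tmul_mul_tmul, PiTensorProduct.tprod_mul_tprod,
            consTensor_tmul_tprod]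
          congr 3
          ext i
          refine Fin.cases ?_ (fun i => ?_) i <;> simp

/-- `Δ^{m+1} = (id ⊗ Δ^m) ∘ Δ`. -/
theorem cons_coproduct (m : ℕ) (x : TensorAlgebra ℝ V) :
    consTensor (TensorAlgebra ℝ V) m
      (TensorProduct.map LinearMap.id (iterCoproduct V m).toLinearMap (coproduct V x)) =
    iterCoproduct V (m + 1) x := by
  let c : TensorAlgebra ℝ V ⊗[ℝ] (⨂[ℝ] _ : Fin m, TensorAlgebra ℝ V) →ₐ[ℝ]
      ⨂[ℝ] _ : Fin (m + 1), TensorAlgebra ℝ V :=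
    AlgHom.ofLinearMap (consTensor (TensorAlgebra ℝ V) m)
      (by
        rw [Algebra.TensorProduct.one_def, PiTensorProduct.one_def, consTensor_tmul_tprod,
          PiTensorProduct.one_def]
        congr 1
        ext i
        refine Fin.cases ?_ (fun i => ?_) i <;> simp)
      (consTensor_mul _ m)
  have h : (c.comp (Algebra.TensorProduct.map (AlgHom.id ℝ _) (iterCoproduct V m))).comp
      (coproduct V) = iterCoproduct V (m + 1) := by
    ext v
    have h1 : ∀ y, c y = consTensor (TensorAlgebra ℝ V) m y := fun _ => rfl
    simp only [coproduct, iterCoproduct, AlgHom.coe_comp, Function.comp_apply,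
      AlgHom.toLinearMap_apply, LinearMap.comp_apply, TensorAlgebra.lift_ι_apply,
      LinearMap.add_apply, map_add, Algebra.TensorProduct.includeLeft_apply,
      Algebra.TensorProduct.includeRight_apply, Algebra.TensorProduct.map_tmul, AlgHom.coe_id,
      id_eq, map_one, LinearMap.sum_apply, Fin.sum_univ_succ]
    rw [TensorProduct.tmul_sum, map_sum]
    congr 1
    · rw [h1, PiTensorProduct.one_def, consTensor_tmul_tprod, PiTensorProduct.singleAlgHom_apply]
      congr 1
      ext i
      refine Fin.cases ?_ (fun i => ?_) i <;> simp
    · refine Finset.sum_congr rfl fun k _ => ?_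
      rw [h1, PiTensorProduct.singleAlgHom_apply, PiTensorProduct.singleAlgHom_apply,
        consTensor_tmul_tprod]
      congr 1
      ext i
      refine Fin.cases ?_ (fun i => ?_) i
      · simp
      · rcases eq_or_ne i k with rfl | hik
        · simp
        · simp [Pi.mulSingle_eq_of_ne hik, Pi.mulSingle_eq_of_ne (Fin.succ_injective _ |>.ne hik)]
  exact DFunLike.congr_fun h x

variable {V}

/-- The map `Δ̃^m : T^{<n}(V) → T^{<n}(V)^{⊗m}`: the part of `Δ^m` all of whose factors have
level at least `1`. -/
def reducedCoproduct (n m : ℕ) : Trunc V n →ₗ[ℝ] ⨂[ℝ] _ : Fin m, Trunc V n :=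
  PiTensorProduct.map (fun _ => toTrunc V n ∘ₗ positivePart V) ∘ₗ
    (iterCoproduct V m).toLinearMap ∘ₗ (Trunc V n).subtype

variable {W : Type*} [NormedAddCommGroup W] [NormedSpace ℝ W]

/-- The iterated coproduct `(Δ ⊠ Δ)^l` on `T(V) ⊠ T(W)`: the tensor product of `Δ^l` on `T(V)` and
`Δ^l` on `T(W)`, with the `i`-th factors paired up. -/
def iterCoproduct₂ (l : ℕ) : TensorAlgebra ℝ V ⊗[ℝ] TensorAlgebra ℝ W →ₗ[ℝ]
    ⨂[ℝ] _ : Fin l, (TensorAlgebra ℝ V ⊗[ℝ] TensorAlgebra ℝ W) :=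
  TensorProduct.lift (PiTensorProduct.map₂ fun _ =>
      TensorProduct.mk ℝ (TensorAlgebra ℝ V) (TensorAlgebra ℝ W)) ∘ₗ
    TensorProduct.map (iterCoproduct V l).toLinearMap (iterCoproduct W l).toLinearMap

/-- The reduced coproduct on `T^{<n}(V) ⊠ T^{<r}(W)`: the part of `(Δ ⊠ Δ)^l` none of
whose factors has a component of bidegree `(0, 0)`. -/
def reducedCoproduct₂ (n r l : ℕ) : Trunc V n ⊗[ℝ] Trunc W r →ₗ[ℝ]
    ⨂[ℝ] _ : Fin l, (Trunc V n ⊗[ℝ] Trunc W r) :=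
  PiTensorProduct.map (fun _ => TensorProduct.map (toTrunc V n) (toTrunc W r) ∘ₗ
      (LinearMap.id - TensorProduct.map (proj V 0) (proj W 0))) ∘ₗ
    iterCoproduct₂ l ∘ₗ TensorProduct.map (Trunc V n).subtype (Trunc W r).subtype

end Coproduct

/-! ### Controls and geometric rough paths -/

/-- `ω` is a control on `[a, b]` (only its values on `s ≤ t` matter). -/
structure IsControl {a b : ℝ} (ω : Set.Icc a b → Set.Icc a b → ℝ) : Prop where
  nonneg : ∀ s t, s ≤ t → 0 ≤ ω s t
  diag : ∀ s, ω s s = 0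
  superadditive : ∀ s t u, s ≤ t → t ≤ u → ω s t + ω t u ≤ ω s u
  continuousOn : ContinuousOn (fun x : Set.Icc a b × Set.Icc a b => ω x.1 x.2) {x | x.1 ≤ x.2}

section RoughPath

variable {V : Type*} [NormedAddCommGroup V] [NormedSpace ℝ V] {a b : ℝ}

/-- `X ∈ C^p_ω(Δ_{[a,b]}, G^N(V))`. -/
structure IsGroupVariation (N : ℕ) (p : ℝ) (ω : Set.Icc a b → Set.Icc a b → ℝ)
    (X : Set.Icc a b → Set.Icc a b → TensorAlgebra ℝ V) : Prop where
  mem : ∀ s t, s ≤ t → X s t ∈ stepGroup V N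
  bound : ∃ C : ℝ, ∀ s t, s ≤ t → ccDist N 1 (X s t) ≤ ENNReal.ofReal (C * ω s t ^ (1 / p))

/-- `X ∈ ΩG_{p,ω}([a,b], V)`: a multiplicative map `Δ_{[a,b]} → G^{⌊p⌋}(V)` in the closure
`C^{0,p}_ω` of `C^1_ω` in `C^p_ω`. -/
structure IsGeometricRoughPath (p : ℝ) (ω : Set.Icc a b → Set.Icc a b → ℝ)
    (X : Set.Icc a b → Set.Icc a b → TensorAlgebra ℝ V) : Prop where
  variation : IsGroupVariation ⌊p⌋₊ p ω X
  closure : ∀ ε : ℝ, 0 < ε → ∃ Y : Set.Icc a b → Set.Icc a b → TensorAlgebra ℝ V,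
    IsGroupVariation ⌊p⌋₊ 1 ω Y ∧
    ∀ s t, s ≤ t → ccDist ⌊p⌋₊ (Y s t) (X s t) ≤ ENNReal.ofReal (ε * ω s t ^ (1 / p))
  diag : ∀ s, X s s = 1
  mul : ∀ s t u, s ≤ t → t ≤ u → X s u = truncate V (⌊p⌋₊ + 1) (X s t * X t u)

end RoughPath

/-! ### Two-parameter controlled paths -/

section Controlled

variable {V W F : Type*} [NormedAddCommGroup V] [NormedSpace ℝ V]
  [NormedAddCommGroup W] [NormedSpace ℝ W] [NormedAddCommGroup F] [NormedSpace ℝ F]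
  {a b c d : ℝ} {n r : ℕ}

/-- The first-level remainder in the first parameter,
`R¹_{s,t}(u) = Z_{t,u} - Z_{s,u} ∘ [L_{X_{s,t}^{<n}} ⊠ id]`. -/
def remainder₁ (X : Set.Icc a b → Set.Icc a b → TensorAlgebra ℝ V)
    (Z : Set.Icc a b → Set.Icc c d → (Trunc V n ⊗[ℝ] Trunc W r →ₗ[ℝ] F))
    (s t : Set.Icc a b) (u : Set.Icc c d) : Trunc V n ⊗[ℝ] Trunc W r →ₗ[ℝ] F :=
  Z t u - Z s u ∘ₗ TensorProduct.map (leftMul (toTrunc V n (X s t))) LinearMap.id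

/-- The first-level remainder in the second parameter,
`R²_{u,v}(s) = Z_{s,v} - Z_{s,u} ∘ [id ⊠ L_{Y_{u,v}^{<r}}]`. -/
def remainder₂ (Y : Set.Icc c d → Set.Icc c d → TensorAlgebra ℝ W)
    (Z : Set.Icc a b → Set.Icc c d → (Trunc V n ⊗[ℝ] Trunc W r →ₗ[ℝ] F))
    (u v : Set.Icc c d) (s : Set.Icc a b) : Trunc V n ⊗[ℝ] Trunc W r →ₗ[ℝ] F :=
  Z s v - Z s u ∘ₗ TensorProduct.map LinearMap.id (leftMul (toTrunc W r (Y u v)))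

/-- The second-level remainder, `R¹_{s,t}(v) - R¹_{s,t}(u) ∘ [id ⊠ L_{Y_{u,v}^{<r}}]`. -/
def jointRemainder (X : Set.Icc a b → Set.Icc a b → TensorAlgebra ℝ V)
    (Y : Set.Icc c d → Set.Icc c d → TensorAlgebra ℝ W)
    (Z : Set.Icc a b → Set.Icc c d → (Trunc V n ⊗[ℝ] Trunc W r →ₗ[ℝ] F))
    (s t : Set.Icc a b) (u v : Set.Icc c d) : Trunc V n ⊗[ℝ] Trunc W r →ₗ[ℝ] F :=
  remainder₁ X Z s t v -
    remainder₁ X Z s t u ∘ₗ TensorProduct.map LinearMap.id (leftMul (toTrunc W r (Y u v)))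

/-- `Z` is a two-parameter `(X, Y)`-controlled path with values in `F`. -/
structure IsControlledPath (p q : ℝ) (ωX : Set.Icc a b → Set.Icc a b → ℝ)
    (ωY : Set.Icc c d → Set.Icc c d → ℝ)
    (X : Set.Icc a b → Set.Icc a b → TensorAlgebra ℝ V)
    (Y : Set.Icc c d → Set.Icc c d → TensorAlgebra ℝ W)
    (Z : Set.Icc a b → Set.Icc c d → (Trunc V ⌊p⌋₊ ⊗[ℝ] Trunc W ⌊q⌋₊ →ₗ[ℝ] F)) : Prop where
  bound₁ : ∃ C : ℝ, ∀ s t u, s ≤ t → ∀ j < ⌊p⌋₊, ∀ (η : ⨂[ℝ]^j V) (ξ : Trunc W ⌊q⌋₊),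
    ‖remainder₁ X Z s t u (incl V ⌊p⌋₊ j η ⊗ₜ[ℝ] ξ)‖ ≤
      C * ωX s t ^ (((⌊p⌋₊ : ℝ) - j) / p) * ‖η‖ * truncNorm ξ
  bound₂ : ∃ C : ℝ, ∀ u v s, u ≤ v → ∀ k < ⌊q⌋₊, ∀ (η : Trunc V ⌊p⌋₊) (ξ : ⨂[ℝ]^k W),
    ‖remainder₂ Y Z u v s (η ⊗ₜ[ℝ] incl W ⌊q⌋₊ k ξ)‖ ≤
      C * ωY u v ^ (((⌊q⌋₊ : ℝ) - k) / q) * truncNorm η * ‖ξ‖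

/-- The second-level remainder of `Z` has finite joint variation norm, in every bidegree. -/
def HasJointVariation (p q : ℝ) (ωX : Set.Icc a b → Set.Icc a b → ℝ)
    (ωY : Set.Icc c d → Set.Icc c d → ℝ)
    (X : Set.Icc a b → Set.Icc a b → TensorAlgebra ℝ V)
    (Y : Set.Icc c d → Set.Icc c d → TensorAlgebra ℝ W)
    (Z : Set.Icc a b → Set.Icc c d → (Trunc V ⌊p⌋₊ ⊗[ℝ] Trunc W ⌊q⌋₊ →ₗ[ℝ] F)) : Prop :=
  ∃ C : ℝ, ∀ s t u v, s ≤ t → u ≤ v → ∀ j < ⌊p⌋₊, ∀ k < ⌊q⌋₊,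
    ∀ (η : ⨂[ℝ]^j V) (ξ : ⨂[ℝ]^k W),
    ‖jointRemainder X Y Z s t u v (incl V ⌊p⌋₊ j η ⊗ₜ[ℝ] incl W ⌊q⌋₊ k ξ)‖ ≤
      C * ωX s t ^ (((⌊p⌋₊ : ℝ) - j) / p) * ωY u v ^ (((⌊q⌋₊ : ℝ) - k) / q) * ‖η‖ * ‖ξ‖

/-! ### Composition with a smooth map -/

variable {S : Type*} [NormedAddCommGroup S] [NormedSpace ℝ S]

/-- The trace `Z^{(0,0)}` of an element of `Hom(T^{<n}(V) ⊠ T^{<r}(W), F)`. -/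
def trace (z : Trunc V n ⊗[ℝ] Trunc W r →ₗ[ℝ] F) : F :=
  z (unit V n ⊗ₜ[ℝ] unit W r)

/-- `D^m g(x) ∘ A^{⊗m} : E^{⊗m} → S`, for a linear map `A : E → F`. -/
def derivTensor {E : Type*} [AddCommMonoid E] [Module ℝ E] (g : F → S) (m : ℕ) (x : F)
    (A : E →ₗ[ℝ] F) : (⨂[ℝ] _ : Fin m, E) →ₗ[ℝ] S :=
  PiTensorProduct.lift (iteratedFDeriv ℝ m g x).toMultilinearMap ∘ₗ
    PiTensorProduct.map fun _ => A

/-- `G` is the composition `g(Z)` of `Z` with `g`: its components at `ξ ∈ V^{⊗j}` and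
`η ∈ W^{⊗k}` are given by the trace formula (`j = k = 0`) and by the Taylor formulas in
the three other cases. Elements of `V^{⊗0}` and `W^{⊗0}` are written as scalar multiples
of the unit. -/
structure IsComposition (g : F → S)
    (Z : Set.Icc a b → Set.Icc c d → (Trunc V n ⊗[ℝ] Trunc W r →ₗ[ℝ] F))
    (G : Set.Icc a b → Set.Icc c d → (Trunc V n ⊗[ℝ] Trunc W r →ₗ[ℝ] S)) : Prop where
  trace_eq : ∀ t v (x y : ℝ),
    G t v ((x • unit V n) ⊗ₜ[ℝ] (y • unit W r)) = (x * y) • g (trace (Z t v))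
  left_eq : ∀ t v, ∀ j, 0 < j → j < n → ∀ (ξ : ⨂[ℝ]^j V) (y : ℝ),
    G t v (incl V n j ξ ⊗ₜ[ℝ] (y • unit W r)) =
      y • ∑ m ∈ Finset.Icc 1 (n - 1), ((m.factorial : ℝ)⁻¹) •
        derivTensor g m (trace (Z t v))
          (Z t v ∘ₗ (TensorProduct.mk ℝ (Trunc V n) (Trunc W r)).flip (unit W r))
          (reducedCoproduct n m (incl V n j ξ))
  right_eq : ∀ t v, ∀ k, 0 < k → k < r → ∀ (x : ℝ) (η : ⨂[ℝ]^k W),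
    G t v ((x • unit V n) ⊗ₜ[ℝ] incl W r k η) =
      x • ∑ m ∈ Finset.Icc 1 (r - 1), ((m.factorial : ℝ)⁻¹) •
        derivTensor g m (trace (Z t v))
          (Z t v ∘ₗ TensorProduct.mk ℝ (Trunc V n) (Trunc W r) (unit V n))
          (reducedCoproduct r m (incl W r k η))
  mixed_eq : ∀ t v, ∀ j, 0 < j → j < n → ∀ k, 0 < k → k < r →
    ∀ (ξ : ⨂[ℝ]^j V) (η : ⨂[ℝ]^k W),
    G t v (incl V n j ξ ⊗ₜ[ℝ] incl W r k η) =
      ∑ l ∈ Finset.Icc 1 (n + r - 2), ((l.factorial : ℝ)⁻¹) •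
        derivTensor g l (trace (Z t v)) (Z t v)
          (reducedCoproduct₂ n r l (incl V n j ξ ⊗ₜ[ℝ] incl W r k η))

end Controlled

end TwoParam

end

/-! Everything is tested on signatures of piecewise linear paths. Write n = ⌊p⌋ and r = ⌊q⌋. For
paths l, l' and z = Z_{t,v}, the function P(x, y) = z(sig(x l) ⊠ sig(y l')) is a polynomial of
degree < n in x and < r in y, and its coefficients are the values of z on the levels of the two
signatures. Signatures are group-like, so the coproducts in the formulas for g(Z) distribute levels
exactly as the multilinear expansion of D^ℓ g at P(0, 0), applied to P - P(0, 0), distributes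
monomials. Hence g(Z)_{t,v}(sig l ⊠ sig l') is the Taylor polynomial of g ∘ P at the origin,
truncated at the same two degrees and evaluated at (1, 1). This is `compMap_sigSum`.

By the definition of the Carnot–Carathéodory distance, X_{s,t} agrees below level n with the
signature of a path m of length O(α), for every α > 0 with α ≥ ω_X(s,t)^{1/p}. By Chen's identity
(`leftMul_sigSum`), left multiplication by X_{s,t} is then concatenation with m. On a path l of
length O(α), the remainder R¹ of g(Z) is thus a difference of two truncated Taylor polynomials: that
of Z_t along l and that of Z_s along m followed by l. In both cases the coefficients of P are O(α^i
β^k), where β is the scale of the second path.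

A truncated Taylor polynomial at (1, 1) is the value, minus the remainder in x, minus the remainder
in y, plus the double remainder (`taylorSum_taylorSum`). The terms with a remainder in x are O(α^n)
by themselves. The two others depend only on P(1, ·), which changes by R¹ of Z, again O(α^n). For
the second-level remainder the same decomposition is applied to a second difference over four
corners. Affine interpolation between polynomials turns differences into remainders of order one in
a new variable, so a single estimate carries all of them: `exists_norm_taylorRem_comp_polyEval_le`.

To return to tensors, the paths are scaled by integers and a Vandermonde system is inverted. This
isolates the bidegree (j, k), and division by α^j β^k leaves the required powers. The levels of
signatures span the tensor powers (`mem_of_sigLevel_mem`), and finite dimension makes the bounds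
uniform; at the end α decreases to ω_X(s,t)^{1/p}. The derivatives of g must be bounded on a convex
set that contains the values of Z. Since F may have infinite dimension, this set comes from
compactness: Z is continuous on the rectangle (`exists_convex_boundedDerivsOn`). -/

noncomputable section
namespace TwoParam

/-! ### Taylor polynomials and remainders of smooth curves -/

section Taylor

variable {F S : Type*} [NormedAddCommGroup F] [NormedSpace ℝ F]
  [NormedAddCommGroup S] [NormedSpace ℝ S]

/-- The value at `1` of the Taylor polynomial of `u` at `0`, of degree less than `m`. -/
def taylorSum (m : ℕ) (u : ℝ → S) : S :=
  ∑ i ∈ Finset.range m, ((i.factorial : ℝ)⁻¹) • iteratedDeriv i u 0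

/-- The remainder at `1` of the Taylor polynomial of `u` at `0`, of degree less than `m`. -/
def taylorRem (m : ℕ) (u : ℝ → S) : S := u 1 - taylorSum m u

theorem contDiffAt_nat {E : Type*} [NormedAddCommGroup E] [NormedSpace ℝ E] {u : E → S}
    (hu : ContDiff ℝ (⊤ : ℕ∞) u) (n : ℕ) (x : E) : ContDiffAt ℝ n u x :=
  (hu.of_le (by exact_mod_cast le_top)).contDiffAt

theorem taylorSum_sub (m : ℕ) {u v : ℝ → S} (hu : ContDiff ℝ (⊤ : ℕ∞) u)
    (hv : ContDiff ℝ (⊤ : ℕ∞) v) :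
    taylorSum m (fun x => u x - v x) = taylorSum m u - taylorSum m v := by
  simp only [taylorSum, ← Finset.sum_sub_distrib, ← smul_sub]
  refine Finset.sum_congr rfl fun i _ => ?_
  rw [← iteratedDeriv_sub (contDiffAt_nat hu i 0) (contDiffAt_nat hv i 0)]
  rfl

@[simp]
theorem taylorRem_zero (u : ℝ → S) : taylorRem 0 u = u 1 := by simp [taylorRem, taylorSum]

@[simp]
theorem taylorRem_one (u : ℝ → S) : taylorRem 1 u = u 1 - u 0 := by simp [taylorRem, taylorSum]

theorem norm_taylorRem_le (m : ℕ) {u : ℝ → S} (hu : ContDiff ℝ (⊤ : ℕ∞) u) {C : ℝ}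
    (hC : ∀ x ∈ Set.Icc (0 : ℝ) 1, ‖iteratedDeriv m u x‖ ≤ C) : ‖taylorRem m u‖ ≤ C := by
  have hC0 : 0 ≤ C := (norm_nonneg _).trans (hC 0 (by simp))
  rcases m with _ | m
  · simpa using hC 1 (by simp)
  have hI : UniqueDiffOn ℝ (Set.Icc (0 : ℝ) 1) := uniqueDiffOn_Icc zero_lt_one
  have key : ∀ (k : ℕ), ∀ x ∈ Set.Icc (0 : ℝ) 1,
      iteratedDerivWithin k u (Set.Icc 0 1) x = iteratedDeriv k u x := fun k x hx =>
    iteratedDerivWithin_eq_iteratedDeriv hI (contDiffAt_nat hu k x) hx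
  have h := taylor_mean_remainder_bound (f := u) (C := C) (x := 1) (n := m) zero_le_one
    (hu.of_le (by exact_mod_cast le_top)).contDiffOn (by simp)
    (fun y hy => by rw [key _ y hy]; exact hC y hy)
  have h2 : taylorWithinEval u m (Set.Icc 0 1) 0 1 = taylorSum (m + 1) u := by
    rw [taylor_within_apply, taylorSum]
    refine Finset.sum_congr rfl fun i _ => ?_
    rw [key _ 0 (by simp)]
    simp
  rw [h2] at h
  refine h.trans ?_
  simp only [sub_zero, one_pow, mul_one]
  exact div_le_self hC0 (by exact_mod_cast Nat.one_le_iff_ne_zero.2 (Nat.factorial_ne_zero m))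

/-- The derivative of `f` in the direction `v`. -/
def dirDeriv (v : ℝ × ℝ) (f : ℝ × ℝ → S) : ℝ × ℝ → S := fun p => fderiv ℝ f p v

theorem contDiff_dirDeriv (v : ℝ × ℝ) {f : ℝ × ℝ → S} (hf : ContDiff ℝ (⊤ : ℕ∞) f) :
    ContDiff ℝ (⊤ : ℕ∞) (dirDeriv v f) :=
  (hf.fderiv_right (by simp)).clm_apply contDiff_const

theorem contDiff_iterate_dirDeriv (v : ℝ × ℝ) {f : ℝ × ℝ → S} (hf : ContDiff ℝ (⊤ : ℕ∞) f)
    (i : ℕ) : ContDiff ℝ (⊤ : ℕ∞) ((dirDeriv v)^[i] f) := by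
  induction i with
  | zero => exact hf
  | succ i ih => rw [Function.iterate_succ_apply']; exact contDiff_dirDeriv v ih

/-- Contracting a derivative with a vector of norm at most one does not increase its norm. Mixed
partial derivatives are thereby controlled by full derivatives, to which the bound for compositions
applies. -/
theorem norm_iteratedFDeriv_iterate_dirDeriv_le {v : ℝ × ℝ} (hv : ‖v‖ ≤ 1) {f : ℝ × ℝ → S}
    (hf : ContDiff ℝ (⊤ : ℕ∞) f) (n i : ℕ) (p : ℝ × ℝ) :
    ‖iteratedFDeriv ℝ n ((dirDeriv v)^[i] f) p‖ ≤ ‖iteratedFDeriv ℝ (n + i) f p‖ := by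
  induction i generalizing n with
  | zero => rfl
  | succ i ih =>
    rw [Function.iterate_succ_apply']
    have h := contDiff_iterate_dirDeriv v hf i
    have h1 : ‖iteratedFDeriv ℝ n (dirDeriv v ((dirDeriv v)^[i] f)) p‖ ≤
        ‖v‖ * ‖iteratedFDeriv ℝ n (fderiv ℝ ((dirDeriv v)^[i] f)) p‖ :=
      norm_iteratedFDeriv_clm_apply_const (N := n)
        (contDiffAt_nat (hu := h.fderiv_right (m := (⊤ : ℕ∞)) (by simp)) n p) le_rfl
    rw [norm_iteratedFDeriv_fderiv] at h1
    refine h1.trans ((mul_le_of_le_one_left (norm_nonneg _) hv).trans ((ih (n + 1)).trans ?_))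
    rw [show n + 1 + i = n + (i + 1) by ring]

theorem dirDeriv_comm (v w : ℝ × ℝ) {f : ℝ × ℝ → S} (hf : ContDiff ℝ (⊤ : ℕ∞) f) :
    dirDeriv v (dirDeriv w f) = dirDeriv w (dirDeriv v f) := by
  have h1 : ContDiff ℝ (⊤ : ℕ∞) (fderiv ℝ f) := hf.fderiv_right (by simp)
  have key : ∀ v w p, dirDeriv v (dirDeriv w f) p = fderiv ℝ (fderiv ℝ f) p v w := by
    intro v w p
    have h2 : DifferentiableAt ℝ (fderiv ℝ f) p := (h1.differentiable (by simp)).differentiableAt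
    change fderiv ℝ (fun q => fderiv ℝ f q w) p v = _
    rw [fderiv_clm_apply h2 (differentiableAt_const w)]
    simp
  ext p
  rw [key, key]
  have hs : IsSymmSndFDerivAt ℝ f p :=
    (contDiffAt_nat hf 2 p).isSymmSndFDerivAt (by simp)
  exact hs.eq v w

theorem dirDeriv_iterate_comm (v w : ℝ × ℝ) {f : ℝ × ℝ → S} (hf : ContDiff ℝ (⊤ : ℕ∞) f)
    (i k : ℕ) : (dirDeriv v)^[i] ((dirDeriv w)^[k] f) = (dirDeriv w)^[k] ((dirDeriv v)^[i] f) := by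
  have h1 : ∀ (k : ℕ) {f : ℝ × ℝ → S}, ContDiff ℝ (⊤ : ℕ∞) f →
      dirDeriv v ((dirDeriv w)^[k] f) = (dirDeriv w)^[k] (dirDeriv v f) := by
    intro k
    induction k with
    | zero => intros; rfl
    | succ k ih =>
      intro f hf
      rw [Function.iterate_succ_apply, Function.iterate_succ_apply, ih (contDiff_dirDeriv w hf),
        dirDeriv_comm v w hf]
  induction i generalizing f with
  | zero => rfl
  | succ i ih =>
    rw [Function.iterate_succ_apply, Function.iterate_succ_apply, h1 k hf,
      ih (contDiff_dirDeriv v hf)]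

theorem iteratedDeriv_fst {f : ℝ × ℝ → S} (hf : ContDiff ℝ (⊤ : ℕ∞) f) (i : ℕ) (x y : ℝ) :
    iteratedDeriv i (fun x => f (x, y)) x = (dirDeriv (1, 0))^[i] f (x, y) := by
  induction i generalizing f with
  | zero => simp
  | succ i ih =>
    rw [iteratedDeriv_succ', Function.iterate_succ_apply, ← ih (contDiff_dirDeriv _ hf)]
    congr 1
    ext x
    have h : HasDerivAt (fun x : ℝ => (x, y)) ((1 : ℝ), (0 : ℝ)) x :=
      (hasDerivAt_id x).prodMk (hasDerivAt_const x y)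
    exact ((hf.differentiable (by simp)).differentiableAt.hasFDerivAt.comp_hasDerivAt x h).deriv

theorem iteratedDeriv_snd {f : ℝ × ℝ → S} (hf : ContDiff ℝ (⊤ : ℕ∞) f) (i : ℕ) (x y : ℝ) :
    iteratedDeriv i (fun y => f (x, y)) y = (dirDeriv (0, 1))^[i] f (x, y) := by
  induction i generalizing f with
  | zero => simp
  | succ i ih =>
    rw [iteratedDeriv_succ', Function.iterate_succ_apply, ← ih (contDiff_dirDeriv _ hf)]
    congr 1
    ext y
    have h : HasDerivAt (fun y : ℝ => (x, y)) ((0 : ℝ), (1 : ℝ)) y :=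
      (hasDerivAt_const y x).prodMk (hasDerivAt_id y)
    exact ((hf.differentiable (by simp)).differentiableAt.hasFDerivAt.comp_hasDerivAt y h).deriv

theorem contDiff_left {f : ℝ × ℝ → S} (hf : ContDiff ℝ (⊤ : ℕ∞) f) (y : ℝ) :
    ContDiff ℝ (⊤ : ℕ∞) (fun x => f (x, y)) :=
  hf.comp (contDiff_id.prodMk contDiff_const)

theorem contDiff_right {f : ℝ × ℝ → S} (hf : ContDiff ℝ (⊤ : ℕ∞) f) (x : ℝ) :
    ContDiff ℝ (⊤ : ℕ∞) (fun y => f (x, y)) :=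
  hf.comp (contDiff_const.prodMk contDiff_id)

theorem contDiff_taylorSum_left (m : ℕ) {f : ℝ × ℝ → S} (hf : ContDiff ℝ (⊤ : ℕ∞) f) :
    ContDiff ℝ (⊤ : ℕ∞) (fun y => taylorSum m (fun x => f (x, y))) := by
  simp only [taylorSum, iteratedDeriv_fst hf]
  exact ContDiff.sum fun i _ => contDiff_const.smul
    (contDiff_right (contDiff_iterate_dirDeriv _ hf i) 0)

theorem contDiff_taylorRem_left (m : ℕ) {f : ℝ × ℝ → S} (hf : ContDiff ℝ (⊤ : ℕ∞) f) :
    ContDiff ℝ (⊤ : ℕ∞) (fun y => taylorRem m (fun x => f (x, y))) :=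
  (contDiff_right hf 1).sub (contDiff_taylorSum_left m hf)

/-- Mixed partials commute, so differentiation in y passes through the Taylor remainder in x. This
is what reduces the two-parameter remainder to two applications of the one-parameter bound. -/
theorem iteratedDeriv_taylorRem (m k : ℕ) {f : ℝ × ℝ → S} (hf : ContDiff ℝ (⊤ : ℕ∞) f) (y : ℝ) :
    iteratedDeriv k (fun y => taylorRem m (fun x => f (x, y))) y =
      taylorRem m (fun x => (dirDeriv (0, 1))^[k] f (x, y)) := by
  have h1 := iteratedDeriv_sub (contDiffAt_nat (contDiff_right hf 1) k y)
    (contDiffAt_nat (contDiff_taylorSum_left m hf) k y)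
  change iteratedDeriv k ((fun y => f (1, y)) - fun y => taylorSum m (fun x => f (x, y))) y = _
  rw [h1, taylorRem, iteratedDeriv_snd hf]
  congr 1
  simp only [taylorSum, iteratedDeriv_fst hf, iteratedDeriv_fst (contDiff_iterate_dirDeriv _ hf k)]
  rw [iteratedDeriv_fun_sum]
  · refine Finset.sum_congr rfl fun i _ => ?_
    have h := contDiff_iterate_dirDeriv (1, 0) hf i
    rw [iteratedDeriv_fun_const_smul_field, iteratedDeriv_snd h, dirDeriv_iterate_comm _ _ hf]
  · intro i _
    exact contDiffAt_nat (contDiff_const.smul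
      (contDiff_right (contDiff_iterate_dirDeriv _ hf i) 0)) k y

/-- The two-parameter Taylor remainder is bounded by the mixed derivative. -/
theorem norm_taylorRem_taylorRem_le (m k : ℕ) {f : ℝ × ℝ → S} (hf : ContDiff ℝ (⊤ : ℕ∞) f) {C : ℝ}
    (hC : ∀ x ∈ Set.Icc (0 : ℝ) 1, ∀ y ∈ Set.Icc (0 : ℝ) 1,
      ‖(dirDeriv (1, 0))^[m] ((dirDeriv (0, 1))^[k] f) (x, y)‖ ≤ C) :
    ‖taylorRem k (fun y => taylorRem m (fun x => f (x, y)))‖ ≤ C := by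
  refine norm_taylorRem_le k (contDiff_taylorRem_left m hf) fun y hy => ?_
  rw [iteratedDeriv_taylorRem m k hf]
  refine norm_taylorRem_le m (contDiff_left (contDiff_iterate_dirDeriv _ hf k) y) fun x hx => ?_
  rw [iteratedDeriv_fst (contDiff_iterate_dirDeriv _ hf k)]
  exact hC x hx y hy

/-- Inclusion–exclusion: with R_x and R_y the remainder operators, the truncation is (1 - R_x)(1 -
R_y) applied to f. -/
theorem taylorSum_taylorSum (m k : ℕ) {f : ℝ × ℝ → S} (hf : ContDiff ℝ (⊤ : ℕ∞) f) :
    taylorSum k (fun y => taylorSum m (fun x => f (x, y))) =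
      f (1, 1) - taylorRem m (fun x => f (x, 1)) - taylorRem k (fun y => f (1, y)) +
        taylorRem k (fun y => taylorRem m (fun x => f (x, y))) := by
  have h : taylorSum k (fun y => taylorSum m (fun x => f (x, y))) =
      taylorSum k (fun y => f (1, y)) - taylorSum k (fun y => taylorRem m (fun x => f (x, y))) := by
    rw [← taylorSum_sub k (contDiff_right hf 1) (contDiff_taylorRem_left m hf)]
    simp [taylorRem]
  rw [h]
  simp only [taylorRem]
  abel

/-- Chain rule for a diagonal scaling with eigenvector v and eigenvalue t: each derivative along v
produces one factor t. This is the source of the powers of the scales in the remainder estimates. -/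
theorem iterate_dirDeriv_comp_scale {v : ℝ × ℝ} {a b t : ℝ} (hv : (a * v.1, b * v.2) = t • v)
    {f : ℝ × ℝ → S} (hf : ContDiff ℝ (⊤ : ℕ∞) f) (i : ℕ) :
    (dirDeriv v)^[i] (fun p => f (a * p.1, b * p.2)) =
      fun p => t ^ i • (dirDeriv v)^[i] f (a * p.1, b * p.2) := by
  induction i with
  | zero => simp
  | succ i ih =>
    rw [Function.iterate_succ_apply', ih, Function.iterate_succ_apply']
    set h := (dirDeriv v)^[i] f with hh
    have hs : ContDiff ℝ (⊤ : ℕ∞) h := contDiff_iterate_dirDeriv v hf i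
    ext p
    let A : ℝ × ℝ →L[ℝ] ℝ × ℝ := (a • ContinuousLinearMap.fst ℝ ℝ ℝ).prod
      (b • ContinuousLinearMap.snd ℝ ℝ ℝ)
    have h1 : HasFDerivAt (fun p : ℝ × ℝ => t ^ i • h (A p)) (t ^ i • (fderiv ℝ h (A p)).comp A) p :=
      ((hs.differentiable (by simp)).differentiableAt.hasFDerivAt.comp p A.hasFDerivAt).const_smul _
    change fderiv ℝ (fun p : ℝ × ℝ => t ^ i • h (A p)) p v = _
    rw [h1.fderiv]
    have hA : A v = t • v := by rw [← hv]; simp [A]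
    simp only [smul_apply, ContinuousLinearMap.comp_apply, hA, map_smul,
      smul_smul, pow_succ]
    rfl

end Taylor

/-! ### Composition of a smooth map with a polynomial -/

section PolyComp

variable {F S : Type*} [NormedAddCommGroup F] [NormedSpace ℝ F]
  [NormedAddCommGroup S] [NormedSpace ℝ S]

/-- The polynomial with coefficients `c i k`, `i < N`, `k < N'`. -/
def polyEval (N N' : ℕ) (c : ℕ → ℕ → F) (p : ℝ × ℝ) : F :=
  ∑ i ∈ Finset.range N, ∑ k ∈ Finset.range N', (p.1 ^ i * p.2 ^ k) • c i k

theorem contDiff_polyEval (N N' : ℕ) (c : ℕ → ℕ → F) :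
    ContDiff ℝ (⊤ : ℕ∞) (polyEval N N' c) :=
  ContDiff.sum fun i _ => ContDiff.sum fun k _ =>
    ((contDiff_fst.pow i).mul (contDiff_snd.pow k)).smul contDiff_const

/-- The derivatives of the finitely many monomials are bounded on a compact square, so the bound
depends on the coefficients only through B. The requirement `1 ≤ D` lets D serve as the bound D ^ i
asked for by `norm_iteratedFDeriv_comp_le`. -/
theorem exists_norm_iteratedFDeriv_polyEval_le (N N' n : ℕ) (A B : ℝ) :
    ∃ D : ℝ, 1 ≤ D ∧ ∀ c : ℕ → ℕ → F, (∀ i < N, ∀ k < N', ‖c i k‖ ≤ B) →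
      ∀ x ∈ Set.Icc 0 A, ∀ y ∈ Set.Icc 0 A, ∀ j ≤ n,
        ‖iteratedFDeriv ℝ j (polyEval N N' c) (x, y)‖ ≤ D := by
  have hmono : ∀ i k, ContDiff ℝ (⊤ : ℕ∞) (fun p : ℝ × ℝ => p.1 ^ i * p.2 ^ k) := fun i k =>
    (contDiff_fst.pow i).mul (contDiff_snd.pow k)
  have hM : ∀ i k j : ℕ, ∃ M : ℝ, ∀ p ∈ Set.Icc 0 A ×ˢ Set.Icc 0 A,
      ‖iteratedFDeriv ℝ j (fun p : ℝ × ℝ => p.1 ^ i * p.2 ^ k) p‖ ≤ M := fun i k j =>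
    (isCompact_Icc.prod isCompact_Icc).exists_bound_of_continuousOn
      ((hmono i k).continuous_iteratedFDeriv (by exact_mod_cast le_top)).continuousOn
  choose M hM using hM
  refine ⟨1 + ∑ j ∈ Finset.range (n + 1), ∑ i ∈ Finset.range N, ∑ k ∈ Finset.range N',
    |B| * |M i k j|, le_add_of_nonneg_right (by positivity), ?_⟩
  intro c hc x hx y hy j hj
  have h1 : iteratedFDeriv ℝ j (polyEval N N' c) (x, y) =
      ∑ i ∈ Finset.range N, ∑ k ∈ Finset.range N',
        iteratedFDeriv ℝ j (fun p : ℝ × ℝ => (p.1 ^ i * p.2 ^ k) • c i k) (x, y) := by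
    have hs : ∀ i k, ContDiff ℝ j (fun p : ℝ × ℝ => (p.1 ^ i * p.2 ^ k) • c i k) := fun i k =>
      ((hmono i k).of_le (by exact_mod_cast le_top)).smul contDiff_const
    unfold polyEval
    rw [iteratedFDeriv_sum fun i _ => ContDiff.sum fun k _ => hs i k, Finset.sum_apply]
    refine Finset.sum_congr rfl fun i _ => ?_
    rw [iteratedFDeriv_sum fun k _ => hs i k, Finset.sum_apply]
  have h2 : ∀ i ∈ Finset.range N, ∀ k ∈ Finset.range N',
      ‖iteratedFDeriv ℝ j (fun p : ℝ × ℝ => (p.1 ^ i * p.2 ^ k) • c i k) (x, y)‖ ≤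
        |B| * |M i k j| := by
    intro i hi k hk
    have h3 := (ContinuousLinearMap.toSpanSingleton ℝ (c i k)).norm_iteratedFDeriv_comp_left
      (contDiffAt_nat (hmono i k) j (x, y)) (n := j) le_rfl
    refine le_trans h3 ?_
    rw [ContinuousLinearMap.norm_toSpanSingleton]
    gcongr
    · exact (hc i (Finset.mem_range.1 hi) k (Finset.mem_range.1 hk)).trans (le_abs_self _)
    · exact (hM i k j (x, y) ⟨hx, hy⟩).trans (le_abs_self _)
  rw [h1]
  refine (norm_sum_le_of_le _ fun i hi => norm_sum_le_of_le _ (h2 i hi)).trans ?_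
  refine le_trans ?_ (le_add_of_nonneg_left zero_le_one)
  exact Finset.single_le_sum (f := fun j => ∑ i ∈ Finset.range N, ∑ k ∈ Finset.range N',
    |B| * |M i k j|) (fun _ _ => by positivity) (Finset.mem_range.2 (by omega))

theorem iterate_dirDeriv_const_smul (v : ℝ × ℝ) (t : ℝ) {f : ℝ × ℝ → S}
    (hf : ContDiff ℝ (⊤ : ℕ∞) f) (i : ℕ) :
    (dirDeriv v)^[i] (t • f) = t • (dirDeriv v)^[i] f := by
  induction i with
  | zero => rfl
  | succ i ih =>
    rw [Function.iterate_succ_apply', ih, Function.iterate_succ_apply']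
    ext p
    simp only [dirDeriv, Pi.smul_apply]
    rw [fderiv_const_smul
      (((contDiff_iterate_dirDeriv v hf i).differentiable (by simp)).differentiableAt)]
    rfl

/-- All derivatives of `g` are bounded on `K`. -/
def BoundedDerivsOn (g : F → S) (K : Set F) : Prop :=
  ∀ n : ℕ, ∃ M : ℝ, ∀ x ∈ K, ‖iteratedFDeriv ℝ n g x‖ ≤ M

/-- The Taylor remainder of `g ∘ P` for a polynomial `P` whose coefficients decay like
`a ^ i * b ^ k`. -/
theorem exists_norm_taylorRem_comp_polyEval_le {g : F → S} (hg : ContDiff ℝ (⊤ : ℕ∞) g)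
    {K : Set F} (hK : BoundedDerivsOn g K) (N N' m m' : ℕ) (A B : ℝ) :
    ∃ C : ℝ, 0 ≤ C ∧ ∀ a b : ℝ, 0 < a → a ≤ A → 0 < b → b ≤ A → ∀ c : ℕ → ℕ → F,
      (∀ i < N, ∀ k < N', ‖c i k‖ ≤ B * (a ^ i * b ^ k)) →
      (∀ x ∈ Set.Icc (0 : ℝ) 1, ∀ y ∈ Set.Icc (0 : ℝ) 1, polyEval N N' c (x, y) ∈ K) →
      ‖taylorRem m' (fun y => taylorRem m (fun x => g (polyEval N N' c (x, y))))‖ ≤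
        C * (a ^ m * b ^ m') := by
  obtain ⟨D, hD1, hD⟩ := exists_norm_iteratedFDeriv_polyEval_le (F := F) N N' (m + m') A B
  choose M hM using hK
  set M' := ∑ i ∈ Finset.range (m + m' + 1), |M i| with hM'
  refine ⟨(m + m').factorial * M' * D ^ (m + m'), by positivity, ?_⟩
  intro a b ha haA hb hbA c hc hcK
  -- Normalised coefficients, of size at most B. The polynomial becomes that of c' at (a x, b y), so
  -- that m derivatives in x and m' in y give the factor a ^ m * b ^ m', and what remains is bounded
  -- independently of a and b.
  set c' : ℕ → ℕ → F := fun i k => (a ^ i * b ^ k)⁻¹ • c i k with hc'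
  have hscale : ∀ p : ℝ × ℝ, polyEval N N' c p = polyEval N N' c' (a * p.1, b * p.2) := by
    intro p
    refine Finset.sum_congr rfl fun i _ => Finset.sum_congr rfl fun k _ => ?_
    rw [hc']
    simp only [smul_smul]
    congr 1
    field_simp
    ring
  have hc'B : ∀ i < N, ∀ k < N', ‖c' i k‖ ≤ B := by
    intro i hi k hk
    rw [hc']
    simp only [norm_smul, norm_inv, Real.norm_eq_abs]
    rw [abs_of_pos (by positivity), inv_mul_le_iff₀ (by positivity)]
    linarith [hc i hi k hk]
  set f : ℝ × ℝ → S := g ∘ polyEval N N' c' with hf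
  have hfs : ContDiff ℝ (⊤ : ℕ∞) f := hg.comp (contDiff_polyEval N N' c')
  have hfc : ContDiff ℝ (⊤ : ℕ∞) (fun p : ℝ × ℝ => f (a * p.1, b * p.2)) :=
    hfs.comp ((contDiff_const.mul contDiff_fst).prodMk (contDiff_const.mul contDiff_snd))
  have h1 : (fun y => taylorRem m (fun x => g (polyEval N N' c (x, y)))) =
      fun y => taylorRem m (fun x => (fun p : ℝ × ℝ => f (a * p.1, b * p.2)) (x, y)) := by
    simp only [hscale, hf, Function.comp]
  rw [h1]
  refine norm_taylorRem_taylorRem_le m m' hfc fun x hx y hy => ?_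
  rw [iterate_dirDeriv_comp_scale (t := b) (by simp) hfs]
  have h2 : ContDiff ℝ (⊤ : ℕ∞) ((dirDeriv (0, 1))^[m'] f) := contDiff_iterate_dirDeriv _ hfs m'
  have h3 : ContDiff ℝ (⊤ : ℕ∞) (b ^ m' • (dirDeriv (0, 1))^[m'] f) := contDiff_const.smul h2
  have h4 := congrFun (iterate_dirDeriv_comp_scale (v := (1, 0)) (a := a) (b := b) (t := a)
    (by simp) h3 m) (x, y)
  simp only [Pi.smul_apply] at h4
  rw [h4]
  have h5 : (dirDeriv (1, 0))^[m] (b ^ m' • (dirDeriv (0, 1))^[m'] f) =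
      b ^ m' • (dirDeriv (1, 0))^[m] ((dirDeriv (0, 1))^[m'] f) :=
    iterate_dirDeriv_const_smul _ _ h2 m
  rw [h5, Pi.smul_apply, norm_smul, norm_smul]
  have hmem : (a * x, b * y) ∈ Set.Icc 0 A ×ˢ Set.Icc 0 A :=
    ⟨⟨by have := hx.1; positivity, by nlinarith [hx.1, hx.2]⟩,
      ⟨by have := hy.1; positivity, by nlinarith [hy.1, hy.2]⟩⟩
  have h6 : ‖iteratedFDeriv ℝ (m + m') f (a * x, b * y)‖ ≤
      (m + m').factorial * M' * D ^ (m + m') := by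
    refine norm_iteratedFDeriv_comp_le hg (contDiff_polyEval N N' c')
      (by exact_mod_cast le_top) _ (fun i hi => ?_) fun i hi1 hi => ?_
    · have h7 : polyEval N N' c' (a * x, b * y) ∈ K := by
        rw [← hscale (x, y)]; exact hcK x hx y hy
      refine ((hM i _ h7).trans (le_abs_self _)).trans ?_
      exact Finset.single_le_sum (f := fun i => |M i|) (fun _ _ => abs_nonneg _)
        (Finset.mem_range.2 (by omega))
    · exact (hD c' hc'B _ hmem.1 _ hmem.2 i hi).trans
        (le_self_pow₀ hD1 (by omega))
  have h8 : ‖(dirDeriv (1, 0))^[m] ((dirDeriv (0, 1))^[m'] f) (a * x, b * y)‖ ≤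
      ‖iteratedFDeriv ℝ (m + m') f (a * x, b * y)‖ := by
    have e1 := norm_iteratedFDeriv_iterate_dirDeriv_le (v := (1, 0)) (by simp) h2 0 m
      (a * x, b * y)
    have e2 := norm_iteratedFDeriv_iterate_dirDeriv_le (v := (0, 1)) (by simp) hfs m m'
      (a * x, b * y)
    rw [norm_iteratedFDeriv_zero, zero_add] at e1
    exact e1.trans e2
  rw [Real.norm_of_nonneg (by positivity), Real.norm_of_nonneg (by positivity)]
  calc a ^ m * (b ^ m' * _) ≤ a ^ m * (b ^ m' * ((m + m').factorial * M' * D ^ (m + m'))) := by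
        gcongr; exact h8.trans h6
    _ = _ := by ring

/-- The polynomial in one variable with coefficients `u i`, `i < N`. -/
def polyEval₁ (N : ℕ) (u : ℕ → F) (x : ℝ) : F := ∑ i ∈ Finset.range N, x ^ i • u i

theorem exists_norm_taylorRem_comp_polyEval₁_le {g : F → S} (hg : ContDiff ℝ (⊤ : ℕ∞) g)
    {K : Set F} (hK : BoundedDerivsOn g K) (N m : ℕ) (A B : ℝ) :
    ∃ C : ℝ, 0 ≤ C ∧ ∀ a : ℝ, 0 < a → a ≤ A → ∀ u : ℕ → F,
      (∀ i < N, ‖u i‖ ≤ B * a ^ i) → (∀ x ∈ Set.Icc (0 : ℝ) 1, polyEval₁ N u x ∈ K) →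
      ‖taylorRem m (fun x => g (polyEval₁ N u x))‖ ≤ C * a ^ m := by
  -- The second variable is made trivial: only the power y ^ 0 occurs, and the remainder of order 0
  -- in y is the value at 1.
  obtain ⟨C, hC0, hC⟩ := exists_norm_taylorRem_comp_polyEval_le hg hK N 1 m 0 A B
  refine ⟨C, hC0, fun a ha haA u hu huK => ?_⟩
  have h := hC a a ha haA ha haA (fun i _ => u i) (by
    intro i hi k hk
    obtain rfl : k = 0 := by omega
    simpa using hu i hi) (by
    intro x hx y hy
    simpa [polyEval, polyEval₁] using huK x hx)
  simpa [polyEval, polyEval₁] using h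

/-- Difference of two Taylor remainders of the composition with a polynomial. -/
theorem exists_norm_taylorRem_sub_le {g : F → S} (hg : ContDiff ℝ (⊤ : ℕ∞) g)
    {K : Set F} (hK : BoundedDerivsOn g K) (hKc : Convex ℝ K) (N m : ℕ) (A B : ℝ) :
    ∃ C : ℝ, 0 ≤ C ∧ ∀ a e : ℝ, 0 < a → a ≤ A → 0 < e → e ≤ A → ∀ u v : ℕ → F,
      (∀ i < N, ‖v i‖ ≤ B * a ^ i) → (∀ i < N, ‖u i - v i‖ ≤ B * (a ^ i * e)) →
      (∀ x ∈ Set.Icc (0 : ℝ) 1, polyEval₁ N u x ∈ K) →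
      (∀ x ∈ Set.Icc (0 : ℝ) 1, polyEval₁ N v x ∈ K) →
      ‖taylorRem m (fun x => g (polyEval₁ N u x)) - taylorRem m (fun x => g (polyEval₁ N v x))‖ ≤
        C * (a ^ m * e) := by
  obtain ⟨C, hC0, hC⟩ := exists_norm_taylorRem_comp_polyEval_le hg hK N 2 m 1 A B
  refine ⟨C, hC0, fun a e ha haA he heA u v hv huv huK hvK => ?_⟩
  -- Affine interpolation in y from v (y = 0) to u (y = 1). The remainder of order 1 in y is the
  -- difference of the two ends, and convexity keeps the intermediate polynomials in K.
  have hpoly : ∀ x y : ℝ, polyEval N 2 (fun i k => if k = 0 then v i else u i - v i) (x, y) =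
      polyEval₁ N v x + y • (polyEval₁ N u x - polyEval₁ N v x) := by
    intro x y
    simp only [polyEval, polyEval₁, Finset.sum_range_succ, Finset.sum_range_zero, zero_add,
      pow_zero, pow_one, mul_one, if_true, one_ne_zero, if_false, Finset.sum_add_distrib,
      ← Finset.sum_sub_distrib, Finset.smul_sum, smul_sub, smul_smul]
    simp only [mul_comm y]
  have h := hC a e ha haA he heA (fun i k => if k = 0 then v i else u i - v i) (by
    intro i hi k hk
    obtain rfl | rfl : k = 0 ∨ k = 1 := by omega
    · simpa using hv i hi
    · simpa using huv i hi) (by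
    intro x hx y hy
    rw [hpoly]
    exact hKc.add_smul_sub_mem (hvK x hx) (huK x hx) hy)
  simpa [hpoly] using h

/-- Second difference of a smooth map. -/
theorem exists_norm_second_difference_le {g : F → S} (hg : ContDiff ℝ (⊤ : ℕ∞) g)
    {K : Set F} (hK : BoundedDerivsOn g K) (hKc : Convex ℝ K) (A B : ℝ) :
    ∃ C : ℝ, 0 ≤ C ∧ ∀ a b : ℝ, 0 < a → a ≤ A → 0 < b → b ≤ A → ∀ x₁₁ x₀₁ x₁₀ x₀₀ : F,
      x₁₁ ∈ K → x₀₁ ∈ K → x₁₀ ∈ K → x₀₀ ∈ K → ‖x₀₀‖ ≤ B →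
      ‖x₁₀ - x₀₀‖ ≤ B * a → ‖x₀₁ - x₀₀‖ ≤ B * b → ‖x₁₁ - x₀₁ - x₁₀ + x₀₀‖ ≤ B * (a * b) →
      ‖g x₁₁ - g x₀₁ - g x₁₀ + g x₀₀‖ ≤ C * (a * b) := by
  obtain ⟨C, hC0, hC⟩ := exists_norm_taylorRem_comp_polyEval_le hg hK 2 2 1 1 A B
  refine ⟨C, hC0, fun a b ha haA hb hbA x₁₁ x₀₁ x₁₀ x₀₀ h11 h01 h10 h00 hB ha' hb' hab => ?_⟩
  set c : ℕ → ℕ → F := fun i k => if i = 0 then (if k = 0 then x₀₀ else x₀₁ - x₀₀) else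
    (if k = 0 then x₁₀ - x₀₀ else x₁₁ - x₀₁ - x₁₀ + x₀₀) with hc
  -- Bilinear interpolation of the four corners; its remainder of order 1 in each variable is the
  -- second difference.
  have hpoly : ∀ x y : ℝ, polyEval 2 2 c (x, y) =
      (x₀₀ + x • (x₁₀ - x₀₀)) + y • ((x₀₁ + x • (x₁₁ - x₀₁)) - (x₀₀ + x • (x₁₀ - x₀₀))) := by
    intro x y
    simp [polyEval, hc, Finset.sum_range_succ]
    module
  have h := hC a b ha haA hb hbA c (by
    intro i hi k hk
    obtain rfl | rfl : i = 0 ∨ i = 1 := by omega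
    · obtain rfl | rfl : k = 0 ∨ k = 1 := by omega
      · simpa [hc] using hB
      · simpa [hc] using hb'
    · obtain rfl | rfl : k = 0 ∨ k = 1 := by omega
      · simpa [hc] using ha'
      · simpa [hc] using hab) (by
    intro x hx y hy
    rw [hpoly]
    exact hKc.add_smul_sub_mem (hKc.add_smul_sub_mem h00 h10 hx)
      (hKc.add_smul_sub_mem h01 h11 hx) hy)
  have e : g x₁₁ - g x₀₁ - (g x₁₀ - g x₀₀) = g x₁₁ - g x₀₁ - g x₁₀ + g x₀₀ := by abel
  simpa [hpoly, e] using h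

end PolyComp

/-! ### Differences of truncated Taylor polynomials -/

section TaylorDifference

variable {F S : Type*} [NormedAddCommGroup F] [NormedSpace ℝ F]
  [NormedAddCommGroup S] [NormedSpace ℝ S]

/-- The value at `(1, 1)` of the Taylor polynomial of `f` at the origin, of degree less than `n` in
the first and less than `r` in the second variable. -/
def taylorSum₂ (n r : ℕ) (f : ℝ × ℝ → S) : S :=
  taylorSum r fun y => taylorSum n fun x => f (x, y)

/-- Coefficients that decay like `a ^ i * b ^ k`, of a polynomial with values in `K`. -/
structure DecayingCoeffs (n r : ℕ) (K : Set F) (B a b : ℝ) (c : ℕ → ℕ → F) : Prop where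
  bound : ∀ i < n, ∀ k < r, ‖c i k‖ ≤ B * (a ^ i * b ^ k)
  mem : ∀ x ∈ Set.Icc (0 : ℝ) 1, ∀ y ∈ Set.Icc (0 : ℝ) 1, polyEval n r c (x, y) ∈ K

/-- The coefficients of `polyEval n r c (·, 1)`. -/
def rowSum (r : ℕ) (c : ℕ → ℕ → F) (i : ℕ) : F := ∑ k ∈ Finset.range r, c i k

/-- The coefficients of `polyEval n r c (1, ·)`. -/
def colSum (n : ℕ) (c : ℕ → ℕ → F) (k : ℕ) : F := ∑ i ∈ Finset.range n, c i k

theorem polyEval_right_one (n r : ℕ) (c : ℕ → ℕ → F) (x : ℝ) :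
    polyEval n r c (x, 1) = polyEval₁ n (rowSum r c) x := by
  simp [polyEval, polyEval₁, rowSum, Finset.smul_sum]

theorem polyEval_left_one (n r : ℕ) (c : ℕ → ℕ → F) (y : ℝ) :
    polyEval n r c (1, y) = polyEval₁ r (colSum n c) y := by
  simp only [polyEval, polyEval₁, colSum, Finset.smul_sum, one_pow, one_mul]
  exact Finset.sum_comm

theorem polyEval_one_one (n r : ℕ) (c : ℕ → ℕ → F) :
    polyEval n r c (1, 1) = ∑ k ∈ Finset.range r, colSum n c k := by
  simp [polyEval_left_one, polyEval₁]

theorem polyEval_one_one' (n r : ℕ) (c : ℕ → ℕ → F) :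
    polyEval n r c (1, 1) = ∑ i ∈ Finset.range n, rowSum r c i := by
  simp [polyEval_right_one, polyEval₁]

theorem sum_mul_pow_le {A a B : ℝ} (ha : 0 < a) (haA : a ≤ A) (n : ℕ) {t : ℝ} (ht : 0 ≤ t) :
    ∑ i ∈ Finset.range n, B * (a ^ i * t) ≤ |B| * (∑ i ∈ Finset.range n, A ^ i) * t := by
  rw [mul_assoc, Finset.sum_mul, Finset.mul_sum]
  refine Finset.sum_le_sum fun i _ => ?_
  gcongr
  exact le_abs_self B

theorem norm_colSum_le {n r : ℕ} {K : Set F} {A B a b : ℝ} (ha : 0 < a) (haA : a ≤ A) (hb : 0 < b)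
    {c : ℕ → ℕ → F} (hc : DecayingCoeffs n r K B a b c) (k : ℕ) (hk : k < r) :
    ‖colSum n c k‖ ≤ |B| * (∑ i ∈ Finset.range n, A ^ i) * b ^ k :=
  (norm_sum_le_of_le _ fun i hi => hc.bound i (Finset.mem_range.1 hi) k hk).trans
    (sum_mul_pow_le ha haA n (by positivity))

theorem norm_rowSum_le {n r : ℕ} {K : Set F} {A B a b : ℝ} (ha : 0 < a) (hb : 0 < b) (hbA : b ≤ A)
    {c : ℕ → ℕ → F} (hc : DecayingCoeffs n r K B a b c) (i : ℕ) (hi : i < n) :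
    ‖rowSum r c i‖ ≤ |B| * (∑ k ∈ Finset.range r, A ^ k) * a ^ i :=
  (norm_sum_le_of_le _ fun k hk => by
    simpa only [mul_comm (a ^ i)] using hc.bound i hi k (Finset.mem_range.1 hk)).trans
    (sum_mul_pow_le hb hbA r (by positivity))

/-- The value at (1, 1) is written as a remainder of order 0, so that the lemmas on differences of
remainders cover it with m = 0. -/
theorem taylorSum₂_comp_polyEval {g : F → S} (hg : ContDiff ℝ (⊤ : ℕ∞) g) (n r : ℕ)
    (c : ℕ → ℕ → F) : taylorSum₂ n r (fun p => g (polyEval n r c p)) =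
      taylorRem 0 (fun x => g (polyEval₁ n (rowSum r c) x)) -
        taylorRem n (fun x => g (polyEval₁ n (rowSum r c) x)) -
        taylorRem r (fun y => g (polyEval₁ r (colSum n c) y)) +
        taylorRem r (fun y => taylorRem n (fun x => g (polyEval n r c (x, y)))) := by
  have h := taylorSum_taylorSum n r (hg.comp (contDiff_polyEval n r c))
  simp only [Function.comp] at h
  rw [taylorSum₂, h]
  simp only [polyEval_right_one, polyEval_left_one, taylorRem_zero]

theorem taylorRem_zero_rowSum_eq_colSum (g : F → S) (n r : ℕ) (c : ℕ → ℕ → F) :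
    taylorRem 0 (fun x => g (polyEval₁ n (rowSum r c) x)) =
      taylorRem 0 (fun y => g (polyEval₁ r (colSum n c) y)) := by
  simp only [taylorRem_zero, ← polyEval_right_one, ← polyEval_left_one]

variable {g : F → S} (hg : ContDiff ℝ (⊤ : ℕ∞) g) {K : Set F} (hK : BoundedDerivsOn g K)

include hg hK in
theorem exists_norm_taylorRem_taylorRem_le (n r : ℕ) (A B : ℝ) :
    ∃ C : ℝ, 0 ≤ C ∧ ∀ a b : ℝ, 0 < a → a ≤ A → 0 < b → b ≤ A → ∀ c : ℕ → ℕ → F,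
      DecayingCoeffs n r K B a b c →
      ‖taylorRem r (fun y => taylorRem n (fun x => g (polyEval n r c (x, y))))‖ ≤
        C * (a ^ n * b ^ r) := by
  obtain ⟨C, hC0, hC⟩ := exists_norm_taylorRem_comp_polyEval_le hg hK n r n r A B
  exact ⟨C, hC0, fun a b ha haA hb hbA c hc => hC a b ha haA hb hbA c hc.bound hc.mem⟩

include hg hK in
theorem exists_norm_taylorRem_rowSum_le (n r : ℕ) (A B : ℝ) :
    ∃ C : ℝ, 0 ≤ C ∧ ∀ a b : ℝ, 0 < a → a ≤ A → 0 < b → b ≤ A → ∀ c : ℕ → ℕ → F,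
      DecayingCoeffs n r K B a b c →
      ‖taylorRem n (fun x => g (polyEval₁ n (rowSum r c) x))‖ ≤ C * a ^ n := by
  obtain ⟨C, hC0, hC⟩ := exists_norm_taylorRem_comp_polyEval₁_le hg hK n n A
    (|B| * (∑ k ∈ Finset.range r, A ^ k))
  refine ⟨C, hC0, fun a b ha haA hb hbA c hc => hC a ha haA _ (norm_rowSum_le ha hb hbA hc) ?_⟩
  intro x hx
  rw [← polyEval_right_one]
  exact hc.mem x hx 1 (by simp)

include hg hK in
theorem exists_norm_taylorRem_colSum_le (n r : ℕ) (A B : ℝ) :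
    ∃ C : ℝ, 0 ≤ C ∧ ∀ a b : ℝ, 0 < a → a ≤ A → 0 < b → b ≤ A → ∀ c : ℕ → ℕ → F,
      DecayingCoeffs n r K B a b c →
      ‖taylorRem r (fun y => g (polyEval₁ r (colSum n c) y))‖ ≤ C * b ^ r := by
  obtain ⟨C, hC0, hC⟩ := exists_norm_taylorRem_comp_polyEval₁_le hg hK r r A
    (|B| * (∑ i ∈ Finset.range n, A ^ i))
  refine ⟨C, hC0, fun a b ha haA hb hbA c hc => hC b hb hbA _ (norm_colSum_le ha haA hb hc) ?_⟩
  intro x hx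
  rw [← polyEval_left_one]
  exact hc.mem 1 (by simp) x hx

variable (hKc : Convex ℝ K)

-- On the line y = 1 the composition depends only on the row sums, and here these differ by the
-- small parameter e = b ^ r. The order m stays free: m = 0 compares values and m = n compares
-- remainders.
include hg hK hKc in
theorem exists_norm_taylorRem_rowSum_sub_le (n r m : ℕ) (A B : ℝ) :
    ∃ C : ℝ, 0 ≤ C ∧ ∀ a b : ℝ, 0 < a → a ≤ A → 0 < b → b ≤ A → ∀ c₁ c₀ : ℕ → ℕ → F,
      DecayingCoeffs n r K B a b c₁ → DecayingCoeffs n r K B a b c₀ →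
      (∀ i < n, ‖rowSum r c₁ i - rowSum r c₀ i‖ ≤ B * (a ^ i * b ^ r)) →
      ‖taylorRem m (fun x => g (polyEval₁ n (rowSum r c₁) x)) -
        taylorRem m (fun x => g (polyEval₁ n (rowSum r c₀) x))‖ ≤ C * (a ^ m * b ^ r) := by
  set B' := |B| * (∑ k ∈ Finset.range r, A ^ k) with hB'
  obtain ⟨C, hC0, hC⟩ := exists_norm_taylorRem_sub_le hg hK hKc n m (max A (A ^ r)) (max B B')
  refine ⟨C, hC0, fun a b ha haA hb hbA c₁ c₀ h₁ h₀ h => hC a (b ^ r) ha (haA.trans (le_max_left _ _))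
    (by positivity) ((pow_le_pow_left₀ hb.le hbA r).trans (le_max_right _ _)) _ _ ?_ ?_ ?_ ?_⟩
  · intro i hi
    refine (norm_rowSum_le ha hb hbA h₀ i hi).trans ?_
    gcongr
    exact le_max_right _ _
  · intro i hi
    refine (h i hi).trans ?_
    gcongr
    exact le_max_left _ _
  · intro x hx
    rw [← polyEval_right_one]
    exact h₁.mem x hx 1 (by simp)
  · intro x hx
    rw [← polyEval_right_one]
    exact h₀.mem x hx 1 (by simp)

include hg hK hKc in
theorem exists_norm_taylorRem_colSum_sub_le (n r m : ℕ) (A B : ℝ) :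
    ∃ C : ℝ, 0 ≤ C ∧ ∀ a b : ℝ, 0 < a → a ≤ A → 0 < b → b ≤ A → ∀ c₁ c₀ : ℕ → ℕ → F,
      DecayingCoeffs n r K B a b c₁ → DecayingCoeffs n r K B a b c₀ →
      (∀ k < r, ‖colSum n c₁ k - colSum n c₀ k‖ ≤ B * (a ^ n * b ^ k)) →
      ‖taylorRem m (fun y => g (polyEval₁ r (colSum n c₁) y)) -
        taylorRem m (fun y => g (polyEval₁ r (colSum n c₀) y))‖ ≤ C * (a ^ n * b ^ m) := by
  set B' := |B| * (∑ k ∈ Finset.range n, A ^ k) with hB'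
  obtain ⟨C, hC0, hC⟩ := exists_norm_taylorRem_sub_le hg hK hKc r m (max A (A ^ n)) (max B B')
  refine ⟨C, hC0, fun a b ha haA hb hbA c₁ c₀ h₁ h₀ h => ?_⟩
  rw [mul_comm (a ^ n)]
  refine hC b (a ^ n) hb (hbA.trans (le_max_left _ _))
    (by positivity) ((pow_le_pow_left₀ ha.le haA n).trans (le_max_right _ _)) _ _ ?_ ?_ ?_ ?_
  · intro i hi
    refine (norm_colSum_le ha haA hb h₀ i hi).trans ?_
    gcongr
    exact le_max_right _ _
  · intro i hi
    rw [mul_comm (b ^ i)]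
    refine (h i hi).trans ?_
    gcongr
    exact le_max_left _ _
  · intro x hx
    rw [← polyEval_left_one]
    exact h₁.mem 1 (by simp) x hx
  · intro x hx
    rw [← polyEval_left_one]
    exact h₀.mem 1 (by simp) x hx

include hg hK hKc in
/-- Difference of Taylor polynomials in the first direction. -/
theorem exists_norm_taylorSum₂_sub_le_left (n r : ℕ) (A B : ℝ) :
    ∃ C : ℝ, 0 ≤ C ∧ ∀ a b : ℝ, 0 < a → a ≤ A → 0 < b → b ≤ A → ∀ c₁ c₀ : ℕ → ℕ → F,
      DecayingCoeffs n r K B a b c₁ → DecayingCoeffs n r K B a b c₀ →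
      (∀ k < r, ‖colSum n c₁ k - colSum n c₀ k‖ ≤ B * (a ^ n * b ^ k)) →
      ‖taylorSum₂ n r (fun p => g (polyEval n r c₁ p)) -
        taylorSum₂ n r (fun p => g (polyEval n r c₀ p))‖ ≤ C * a ^ n := by
  obtain ⟨C₁, hC₁0, hC₁⟩ := exists_norm_taylorRem_colSum_sub_le hg hK hKc n r 0 A B
  obtain ⟨C₂, hC₂0, hC₂⟩ := exists_norm_taylorRem_colSum_sub_le hg hK hKc n r r A B
  obtain ⟨C₃, hC₃0, hC₃⟩ := exists_norm_taylorRem_rowSum_le hg hK n r A B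
  obtain ⟨C₄, hC₄0, hC₄⟩ := exists_norm_taylorRem_taylorRem_le hg hK n r A B
  refine ⟨C₁ + C₂ * |A| ^ r + 2 * C₃ + 2 * C₄ * |A| ^ r, by positivity, ?_⟩
  intro a b ha haA hb hbA c₁ c₀ h₁ h₀ h
  have hbr : b ^ r ≤ |A| ^ r := pow_le_pow_left₀ hb.le (hbA.trans (le_abs_self A)) r
  have han : 0 < a ^ n := by positivity
  have e₁ := hC₁ a b ha haA hb hbA c₁ c₀ h₁ h₀ h
  have e₂ := hC₂ a b ha haA hb hbA c₁ c₀ h₁ h₀ h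
  have e₃ := hC₃ a b ha haA hb hbA c₁ h₁
  have e₃' := hC₃ a b ha haA hb hbA c₀ h₀
  have e₄ := hC₄ a b ha haA hb hbA c₁ h₁
  have e₄' := hC₄ a b ha haA hb hbA c₀ h₀
  have hmul : a ^ n * b ^ r ≤ a ^ n * |A| ^ r := by gcongr
  -- The value at (1, 1) is read along the line x = 1, where the hypothesis on column sums applies.
  -- The value and the remainder in y are compared; the terms with a remainder of order n in x are
  -- small separately.
  rw [taylorSum₂_comp_polyEval hg, taylorSum₂_comp_polyEval hg, taylorRem_zero_rowSum_eq_colSum,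
    taylorRem_zero_rowSum_eq_colSum]
  have f₂ := e₂.trans (mul_le_mul_of_nonneg_left hmul hC₂0)
  have f₄ := e₄.trans (mul_le_mul_of_nonneg_left hmul hC₄0)
  have f₄' := e₄'.trans (mul_le_mul_of_nonneg_left hmul hC₄0)
  rw [pow_zero, mul_one] at e₁
  generalize (taylorRem 0 fun y => g (polyEval₁ r (colSum n c₁) y)) = t₁ at *
  generalize (taylorRem 0 fun y => g (polyEval₁ r (colSum n c₀) y)) = t₀ at *
  generalize (taylorRem r fun y => taylorRem n fun x => g (polyEval n r c₁ (x, y))) = s₁ at *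
  generalize (taylorRem r fun y => taylorRem n fun x => g (polyEval n r c₀ (x, y))) = s₀ at *
  generalize (taylorRem r fun y => g (polyEval₁ r (colSum n c₁) y)) = u₁ at *
  generalize (taylorRem r fun y => g (polyEval₁ r (colSum n c₀) y)) = u₀ at *
  generalize (taylorRem n fun x => g (polyEval₁ n (rowSum r c₁) x)) = v₁ at *
  generalize (taylorRem n fun x => g (polyEval₁ n (rowSum r c₀) x)) = v₀ at *
  calc ‖t₁ - v₁ - u₁ + s₁ - (t₀ - v₀ - u₀ + s₀)‖
      = ‖(t₁ - t₀) - (u₁ - u₀) - v₁ + v₀ + s₁ - s₀‖ := by congr 1; abel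
    _ ≤ ‖t₁ - t₀‖ + ‖u₁ - u₀‖ + ‖v₁‖ + ‖v₀‖ + ‖s₁‖ + ‖s₀‖ := by
        refine (norm_sub_le _ _).trans ?_
        gcongr
        refine (norm_add_le _ _).trans ?_
        gcongr
        refine (norm_add_le _ _).trans ?_
        gcongr
        refine (norm_sub_le _ _).trans ?_
        gcongr
        exact norm_sub_le _ _
    _ ≤ _ := by linarith

include hg hK hKc in
/-- Difference of Taylor polynomials in the second direction. -/
theorem exists_norm_taylorSum₂_sub_le_right (n r : ℕ) (A B : ℝ) :
    ∃ C : ℝ, 0 ≤ C ∧ ∀ a b : ℝ, 0 < a → a ≤ A → 0 < b → b ≤ A → ∀ c₁ c₀ : ℕ → ℕ → F,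
      DecayingCoeffs n r K B a b c₁ → DecayingCoeffs n r K B a b c₀ →
      (∀ i < n, ‖rowSum r c₁ i - rowSum r c₀ i‖ ≤ B * (a ^ i * b ^ r)) →
      ‖taylorSum₂ n r (fun p => g (polyEval n r c₁ p)) -
        taylorSum₂ n r (fun p => g (polyEval n r c₀ p))‖ ≤ C * b ^ r := by
  obtain ⟨C₁, hC₁0, hC₁⟩ := exists_norm_taylorRem_rowSum_sub_le hg hK hKc n r 0 A B
  obtain ⟨C₂, hC₂0, hC₂⟩ := exists_norm_taylorRem_rowSum_sub_le hg hK hKc n r n A B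
  obtain ⟨C₃, hC₃0, hC₃⟩ := exists_norm_taylorRem_colSum_le hg hK n r A B
  obtain ⟨C₄, hC₄0, hC₄⟩ := exists_norm_taylorRem_taylorRem_le hg hK n r A B
  refine ⟨C₁ + C₂ * |A| ^ n + 2 * C₃ + 2 * C₄ * |A| ^ n, by positivity, ?_⟩
  intro a b ha haA hb hbA c₁ c₀ h₁ h₀ h
  have hbr : a ^ n ≤ |A| ^ n := pow_le_pow_left₀ ha.le (haA.trans (le_abs_self A)) n
  have han : 0 < b ^ r := by positivity
  have e₁ := hC₁ a b ha haA hb hbA c₁ c₀ h₁ h₀ h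
  have e₂ := hC₂ a b ha haA hb hbA c₁ c₀ h₁ h₀ h
  have e₃ := hC₃ a b ha haA hb hbA c₁ h₁
  have e₃' := hC₃ a b ha haA hb hbA c₀ h₀
  have e₄ := hC₄ a b ha haA hb hbA c₁ h₁
  have e₄' := hC₄ a b ha haA hb hbA c₀ h₀
  have hmul : a ^ n * b ^ r ≤ |A| ^ n * b ^ r := by gcongr
  rw [taylorSum₂_comp_polyEval hg, taylorSum₂_comp_polyEval hg]
  have f₂ := e₂.trans (mul_le_mul_of_nonneg_left hmul hC₂0)
  have f₄ := e₄.trans (mul_le_mul_of_nonneg_left hmul hC₄0)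
  have f₄' := e₄'.trans (mul_le_mul_of_nonneg_left hmul hC₄0)
  rw [pow_zero, one_mul] at e₁
  generalize (taylorRem 0 fun x => g (polyEval₁ n (rowSum r c₁) x)) = t₁ at *
  generalize (taylorRem 0 fun x => g (polyEval₁ n (rowSum r c₀) x)) = t₀ at *
  generalize (taylorRem r fun y => taylorRem n fun x => g (polyEval n r c₁ (x, y))) = s₁ at *
  generalize (taylorRem r fun y => taylorRem n fun x => g (polyEval n r c₀ (x, y))) = s₀ at *
  generalize (taylorRem r fun y => g (polyEval₁ r (colSum n c₁) y)) = u₁ at *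
  generalize (taylorRem r fun y => g (polyEval₁ r (colSum n c₀) y)) = u₀ at *
  generalize (taylorRem n fun x => g (polyEval₁ n (rowSum r c₁) x)) = v₁ at *
  generalize (taylorRem n fun x => g (polyEval₁ n (rowSum r c₀) x)) = v₀ at *
  calc ‖t₁ - v₁ - u₁ + s₁ - (t₀ - v₀ - u₀ + s₀)‖
      = ‖(t₁ - t₀) - (v₁ - v₀) - u₁ + u₀ + s₁ - s₀‖ := by congr 1; abel
    _ ≤ ‖t₁ - t₀‖ + ‖v₁ - v₀‖ + ‖u₁‖ + ‖u₀‖ + ‖s₁‖ + ‖s₀‖ := by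
        refine (norm_sub_le _ _).trans ?_
        gcongr
        refine (norm_add_le _ _).trans ?_
        gcongr
        refine (norm_add_le _ _).trans ?_
        gcongr
        refine (norm_sub_le _ _).trans ?_
        gcongr
        exact norm_sub_le _ _
    _ ≤ _ := by linarith

include hg hK hKc in
/-- Second difference of Taylor polynomials. -/
theorem exists_norm_taylorSum₂_second_difference_le (n r : ℕ) (A B : ℝ) :
    ∃ C : ℝ, 0 ≤ C ∧ ∀ a b : ℝ, 0 < a → a ≤ A → 0 < b → b ≤ A → ∀ c₁₁ c₀₁ c₁₀ c₀₀ : ℕ → ℕ → F,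
      DecayingCoeffs n r K B a b c₁₁ → DecayingCoeffs n r K B a b c₀₁ →
      DecayingCoeffs n r K B a b c₁₀ → DecayingCoeffs n r K B a b c₀₀ →
      (∀ k < r, ‖colSum n c₁₁ k - colSum n c₀₁ k‖ ≤ B * (a ^ n * b ^ k)) →
      (∀ k < r, ‖colSum n c₁₀ k - colSum n c₀₀ k‖ ≤ B * (a ^ n * b ^ k)) →
      (∀ i < n, ‖rowSum r c₁₁ i - rowSum r c₁₀ i‖ ≤ B * (a ^ i * b ^ r)) →
      (∀ i < n, ‖rowSum r c₀₁ i - rowSum r c₀₀ i‖ ≤ B * (a ^ i * b ^ r)) →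
      ‖polyEval n r c₁₁ (1, 1) - polyEval n r c₀₁ (1, 1) - polyEval n r c₁₀ (1, 1) +
        polyEval n r c₀₀ (1, 1)‖ ≤ B * (a ^ n * b ^ r) →
      ‖taylorSum₂ n r (fun p => g (polyEval n r c₁₁ p)) -
        taylorSum₂ n r (fun p => g (polyEval n r c₀₁ p)) -
        taylorSum₂ n r (fun p => g (polyEval n r c₁₀ p)) +
        taylorSum₂ n r (fun p => g (polyEval n r c₀₀ p))‖ ≤ C * (a ^ n * b ^ r) := by
  set SA := ∑ i ∈ Finset.range n, |A| ^ i
  set SA' := ∑ i ∈ Finset.range r, |A| ^ i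
  -- One constant above |B|, |B| SA, |B| SA' and |B| SA SA', which bound the second difference, the
  -- two first differences and the base value.
  set B' := |B| * (1 + SA) * (1 + SA') with hB'
  have hSA : 0 ≤ SA := by positivity
  have hSA' : 0 ≤ SA' := by positivity
  have hB'0 : 0 ≤ |B| := abs_nonneg B
  have hB1 : |B| ≤ B' := by
    rw [hB', mul_assoc]; exact le_mul_of_one_le_right hB'0 (by nlinarith)
  have hB2 : |B| * SA ≤ B' := by
    rw [hB', mul_assoc]; exact mul_le_mul_of_nonneg_left (by nlinarith) hB'0
  have hB3 : |B| * SA' ≤ B' := by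
    rw [hB', mul_assoc]; exact mul_le_mul_of_nonneg_left (by nlinarith) hB'0
  have hB4 : |B| * SA * SA' ≤ B' := by
    rw [hB', mul_assoc, mul_assoc]; exact mul_le_mul_of_nonneg_left (by nlinarith) hB'0
  obtain ⟨C₀, hC₀0, hC₀⟩ := exists_norm_second_difference_le hg hK hKc
    (max (|A| ^ n) (|A| ^ r)) B'
  obtain ⟨C₁, hC₁0, hC₁⟩ := exists_norm_taylorRem_rowSum_sub_le hg hK hKc n r n A B
  obtain ⟨C₂, hC₂0, hC₂⟩ := exists_norm_taylorRem_colSum_sub_le hg hK hKc n r r A B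
  obtain ⟨C₄, hC₄0, hC₄⟩ := exists_norm_taylorRem_taylorRem_le hg hK n r A B
  refine ⟨C₀ + 2 * C₁ + 2 * C₂ + 4 * C₄, by positivity, ?_⟩
  intro a b ha haA hb hbA c₁₁ c₀₁ c₁₀ c₀₀ h₁₁ h₀₁ h₁₀ h₀₀ hx₁ hx₀ hy₁ hy₀ hxy
  have haA' : a ≤ |A| := haA.trans (le_abs_self A)
  have hbA' : b ≤ |A| := hbA.trans (le_abs_self A)
  have hab : 0 < a ^ n * b ^ r := by positivity
  have h1 : (1 : ℝ) ∈ Set.Icc (0 : ℝ) 1 := by simp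
  have e₀ : ‖g (polyEval n r c₁₁ (1, 1)) - g (polyEval n r c₀₁ (1, 1)) -
      g (polyEval n r c₁₀ (1, 1)) + g (polyEval n r c₀₀ (1, 1))‖ ≤ C₀ * (a ^ n * b ^ r) := by
    refine hC₀ (a ^ n) (b ^ r) (by positivity)
      ((pow_le_pow_left₀ ha.le haA' n).trans (le_max_left _ _)) (by positivity)
      ((pow_le_pow_left₀ hb.le hbA' r).trans (le_max_right _ _)) _ _ _ _ (h₁₁.mem 1 h1 1 h1)
      (h₀₁.mem 1 h1 1 h1) (h₁₀.mem 1 h1 1 h1) (h₀₀.mem 1 h1 1 h1) ?_ ?_ ?_ ?_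
    · rw [polyEval_one_one]
      refine (norm_sum_le_of_le _ fun k hk =>
        norm_colSum_le ha haA' hb h₀₀ k (Finset.mem_range.1 hk)).trans ?_
      refine le_trans ?_ hB4
      rw [← Finset.mul_sum]
      refine mul_le_mul_of_nonneg_left (Finset.sum_le_sum fun k _ => ?_) (by positivity)
      exact pow_le_pow_left₀ hb.le hbA' k
    · rw [polyEval_one_one, polyEval_one_one, ← Finset.sum_sub_distrib]
      refine (norm_sum_le_of_le _ fun k hk => hx₀ k (Finset.mem_range.1 hk)).trans ?_
      simp_rw [mul_comm (a ^ n)]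
      refine (sum_mul_pow_le hb hbA' r (by positivity)).trans ?_
      gcongr
    · rw [polyEval_one_one', polyEval_one_one', ← Finset.sum_sub_distrib]
      refine (norm_sum_le_of_le _ fun k hk => hy₀ k (Finset.mem_range.1 hk)).trans ?_
      refine (sum_mul_pow_le ha haA' n (by positivity)).trans ?_
      gcongr
    · refine hxy.trans ?_
      gcongr
      exact (le_abs_self B).trans hB1
  -- Remainders of order n in x are paired across the second parameter, where row sums differ by b ^
  -- r; remainders of order r in y are paired across the first. The double remainders need no
  -- cancellation.
  have e₁ := hC₁ a b ha haA hb hbA _ _ h₁₁ h₁₀ hy₁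
  have e₁' := hC₁ a b ha haA hb hbA _ _ h₀₁ h₀₀ hy₀
  have e₂ := hC₂ a b ha haA hb hbA _ _ h₁₁ h₀₁ hx₁
  have e₂' := hC₂ a b ha haA hb hbA _ _ h₁₀ h₀₀ hx₀
  have d₁₁ := hC₄ a b ha haA hb hbA _ h₁₁
  have d₀₁ := hC₄ a b ha haA hb hbA _ h₀₁
  have d₁₀ := hC₄ a b ha haA hb hbA _ h₁₀
  have d₀₀ := hC₄ a b ha haA hb hbA _ h₀₀
  simp only [taylorSum₂_comp_polyEval hg, taylorRem_zero, ← polyEval_right_one] at *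
  generalize g (polyEval n r c₁₁ (1, 1)) = t₁₁ at *
  generalize g (polyEval n r c₀₁ (1, 1)) = t₀₁ at *
  generalize g (polyEval n r c₁₀ (1, 1)) = t₁₀ at *
  generalize g (polyEval n r c₀₀ (1, 1)) = t₀₀ at *
  generalize (taylorRem r fun y => taylorRem n fun x => g (polyEval n r c₁₁ (x, y))) = s₁₁ at *
  generalize (taylorRem r fun y => taylorRem n fun x => g (polyEval n r c₀₁ (x, y))) = s₀₁ at *
  generalize (taylorRem r fun y => taylorRem n fun x => g (polyEval n r c₁₀ (x, y))) = s₁₀ at *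
  generalize (taylorRem r fun y => taylorRem n fun x => g (polyEval n r c₀₀ (x, y))) = s₀₀ at *
  generalize (taylorRem r fun y => g (polyEval₁ r (colSum n c₁₁) y)) = u₁₁ at *
  generalize (taylorRem r fun y => g (polyEval₁ r (colSum n c₀₁) y)) = u₀₁ at *
  generalize (taylorRem r fun y => g (polyEval₁ r (colSum n c₁₀) y)) = u₁₀ at *
  generalize (taylorRem r fun y => g (polyEval₁ r (colSum n c₀₀) y)) = u₀₀ at *
  generalize (taylorRem n fun x => g (polyEval n r c₁₁ (x, 1))) = v₁₁ at *
  generalize (taylorRem n fun x => g (polyEval n r c₀₁ (x, 1))) = v₀₁ at *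
  generalize (taylorRem n fun x => g (polyEval n r c₁₀ (x, 1))) = v₁₀ at *
  generalize (taylorRem n fun x => g (polyEval n r c₀₀ (x, 1))) = v₀₀ at *
  calc _ = ‖(t₁₁ - t₀₁ - t₁₀ + t₀₀) - (v₁₁ - v₁₀) + (v₀₁ - v₀₀) - (u₁₁ - u₀₁) + (u₁₀ - u₀₀) +
        s₁₁ - s₀₁ - s₁₀ + s₀₀‖ := by congr 1; abel
    _ ≤ ‖t₁₁ - t₀₁ - t₁₀ + t₀₀‖ + ‖v₁₁ - v₁₀‖ + ‖v₀₁ - v₀₀‖ + ‖u₁₁ - u₀₁‖ + ‖u₁₀ - u₀₀‖ +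
        ‖s₁₁‖ + ‖s₀₁‖ + ‖s₁₀‖ + ‖s₀₀‖ := by
        refine (norm_add_le _ _).trans (add_le_add_left ?_ _)
        refine (norm_sub_le _ _).trans (add_le_add_left ?_ _)
        refine (norm_sub_le _ _).trans (add_le_add_left ?_ _)
        refine (norm_add_le _ _).trans (add_le_add_left ?_ _)
        refine (norm_add_le _ _).trans (add_le_add_left ?_ _)
        refine (norm_sub_le _ _).trans (add_le_add_left ?_ _)
        refine (norm_add_le _ _).trans (add_le_add_left ?_ _)
        exact norm_sub_le _ _
    _ ≤ _ := by linarith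

end TaylorDifference

/-! ### Taylor coefficients: vanishing criterion and explicit formula -/

section TaylorCoefficients

/-- Inverse Vandermonde weights for the nodes `0, …, M - 1`. -/
theorem exists_vandermonde_weights (M : ℕ) :
    ∃ w : ℕ → ℕ → ℝ, ∀ (E : Type*) [AddCommGroup E] [Module ℝ E] (b : ℕ → E), ∀ k < M,
      ∑ j ∈ Finset.range M, w k j • ∑ i ∈ Finset.range M, ((j : ℝ) ^ i) • b i = b k := by
  let V : Matrix (Fin M) (Fin M) ℝ := Matrix.vandermonde fun j => (j : ℝ)
  have hdet : IsUnit V.det := by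
    rw [isUnit_iff_ne_zero]
    exact Matrix.det_vandermonde_ne_zero_iff.2
      (fun i j h => Fin.ext (by exact_mod_cast h))
  have hinv := Matrix.nonsing_inv_mul V hdet
  refine ⟨fun k j => if h : k < M ∧ j < M then V⁻¹ ⟨k, h.1⟩ ⟨j, h.2⟩ else 0, ?_⟩
  intro E _ _ b k hk
  simp only [Finset.smul_sum, smul_smul]
  rw [Finset.sum_comm]
  simp only [← Finset.sum_smul]
  rw [Finset.sum_eq_single_of_mem k (Finset.mem_range.2 hk)]
  · have h := congrFun (congrFun hinv ⟨k, hk⟩) ⟨k, hk⟩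
    rw [Matrix.mul_apply, Matrix.one_apply_eq] at h
    rw [Finset.sum_range]
    simp only [hk, Fin.is_lt, and_self, dif_pos, Fin.eta]
    rw [show ∑ i : Fin M, V⁻¹ ⟨k, hk⟩ i * ((i : ℕ) : ℝ) ^ k = 1 from h, one_smul]
  · intro i hi hik
    have hi' := Finset.mem_range.1 hi
    have h := congrFun (congrFun hinv ⟨k, hk⟩) ⟨i, hi'⟩
    rw [Matrix.mul_apply, Matrix.one_apply_ne (by simpa [Fin.ext_iff] using hik.symm)] at h
    rw [Finset.sum_range]
    simp only [hk, Fin.is_lt, and_self, dif_pos, Fin.eta]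
    rw [show ∑ j : Fin M, V⁻¹ ⟨k, hk⟩ j * ((j : ℕ) : ℝ) ^ i = 0 from h, zero_smul]

variable {F S : Type*} [NormedAddCommGroup F] [NormedSpace ℝ F]
  [NormedAddCommGroup S] [NormedSpace ℝ S]

/-- A polynomial of degree less than M is a linear function of its values at M nodes. The constant
is a bound on the inverse Vandermonde matrix and does not depend on the polynomial. -/
theorem exists_norm_le_of_vandermonde (M : ℕ) :
    ∃ C : ℝ, 0 ≤ C ∧ ∀ (b : ℕ → S) (ε : ℝ),
      (∀ j < M, ‖∑ i ∈ Finset.range M, ((j : ℝ) ^ i) • b i‖ ≤ ε) → ∀ k < M, ‖b k‖ ≤ C * ε := by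
  obtain ⟨w, hw⟩ := exists_vandermonde_weights M
  refine ⟨∑ k ∈ Finset.range M, ∑ j ∈ Finset.range M, |w k j|, by positivity, ?_⟩
  intro b ε h k hk
  have hε : 0 ≤ ε := (norm_nonneg _).trans (h k hk)
  rw [← hw S b k hk]
  refine (norm_sum_le_of_le (f := fun j => w k j • ∑ i ∈ Finset.range M, ((j : ℝ) ^ i) • b i)
    (n := fun j => |w k j| * ε) _ fun j hj => ?_).trans ?_
  · rw [norm_smul, Real.norm_eq_abs]
    exact mul_le_mul_of_nonneg_left (h j (Finset.mem_range.1 hj)) (abs_nonneg _)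
  · rw [← Finset.sum_mul]
    refine mul_le_mul_of_nonneg_right ?_ hε
    exact Finset.single_le_sum (f := fun k => ∑ j ∈ Finset.range M, |w k j|)
      (fun _ _ => by positivity) (Finset.mem_range.2 hk)

/-- The Taylor bound is applied to t ↦ f (x t, y), whose m-th derivative carries the factor x ^ m.
Compactness of the unit square makes the constant uniform. -/
theorem exists_norm_sub_taylor_le {f : ℝ × ℝ → S} (hf : ContDiff ℝ (⊤ : ℕ∞) f) (m : ℕ) :
    ∃ C : ℝ, 0 ≤ C ∧ ∀ x ∈ Set.Icc (0 : ℝ) 1, ∀ y ∈ Set.Icc (0 : ℝ) 1,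
      ‖f (x, y) - ∑ i ∈ Finset.range m,
        x ^ i • ((i.factorial : ℝ)⁻¹ • iteratedDeriv i (fun x => f (x, y)) 0)‖ ≤ C * x ^ m := by
  obtain ⟨C, hC⟩ := ((isCompact_Icc (a := (0 : ℝ)) (b := 1)).prod
    (isCompact_Icc (a := (0 : ℝ)) (b := 1))).exists_bound_of_continuousOn
    (contDiff_iterate_dirDeriv (1, 0) hf m).continuous.continuousOn
  have hC0 : 0 ≤ C := (norm_nonneg _).trans (hC (0, 0) (by simp))
  refine ⟨C, hC0, fun x hx y hy => ?_⟩
  have hs := contDiff_left hf y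
  have hd : ∀ i, iteratedDeriv i (fun t => f (x • t, y)) =
      fun t => x ^ i • iteratedDeriv i (fun t => f (t, y)) (x • t) := fun i =>
    iteratedDeriv_comp_const_smul (hs.of_le (by exact_mod_cast le_top)) x
  have hu : ContDiff ℝ (⊤ : ℕ∞) (fun t => f (x • t, y)) := hs.comp (contDiff_const_smul x)
  have h := norm_taylorRem_le m hu (C := C * x ^ m) fun t ht => by
    rw [hd, norm_smul, norm_pow, Real.norm_of_nonneg hx.1, mul_comm, iteratedDeriv_fst hf]
    refine mul_le_mul_of_nonneg_right (hC _ ⟨⟨?_, ?_⟩, hy⟩) (pow_nonneg hx.1 m)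
    · exact mul_nonneg hx.1 ht.1
    · exact mul_le_one₀ hx.2 ht.1 ht.2
  simp only [taylorRem, taylorSum, hd, smul_zero] at h
  simp only [smul_eq_mul, mul_one] at h
  simpa only [smul_smul, mul_comm] using h

/-- A smooth function that vanishes to order `M` at the origin has `x`-derivatives that vanish
to the corresponding orders. -/
theorem exists_norm_iteratedDeriv_fst_le {f : ℝ × ℝ → S} (hf : ContDiff ℝ (⊤ : ℕ∞) f) {M : ℕ}
    {C : ℝ} (hC : ∀ x ∈ Set.Icc (0 : ℝ) 1, ∀ y ∈ Set.Icc (0 : ℝ) 1,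
      ‖f (x, y)‖ ≤ C * (x + y) ^ M) {i : ℕ} (hi : i < M) :
    ∃ C' : ℝ, ∀ y ∈ Set.Ioc (0 : ℝ) 1,
      ‖iteratedDeriv i (fun x => f (x, y)) 0‖ ≤ C' * y ^ (M - i) := by
  obtain ⟨C₁, hC₁0, hC₁⟩ := exists_norm_sub_taylor_le hf M
  obtain ⟨C₂, hC₂0, hC₂⟩ := exists_norm_le_of_vandermonde (S := S) M
  have hM : (0 : ℝ) < M := by exact_mod_cast (by omega : 0 < M)
  refine ⟨C₂ * (|C| * 2 ^ M + C₁) * (M ^ i * i.factorial), fun y hy => ?_⟩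
  have hy0 := hy.1
  -- The points x = (j / M) y, j < M, all satisfy x ≤ y, so f and its Taylor error in x are O(y ^ M)
  -- there. Inverting the Vandermonde system bounds the coefficients times (y / M) ^ i, whence the
  -- exponent M - i.
  have h := hC₂ (fun i => (y / M) ^ i • ((i.factorial : ℝ)⁻¹ •
    iteratedDeriv i (fun x => f (x, y)) 0)) ((|C| * 2 ^ M + C₁) * y ^ M) (by
    intro j hj
    have hjM : (j : ℝ) / M ≤ 1 := (div_le_one hM).2 (by exact_mod_cast hj.le)
    have hj0 : (0 : ℝ) ≤ (j : ℝ) / M := by positivity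
    set x : ℝ := j / M * y with hx
    have hxy : x ≤ y := by rw [hx]; exact mul_le_of_le_one_left hy0.le hjM
    have hx0 : 0 ≤ x := by positivity
    have hxI : x ∈ Set.Icc (0 : ℝ) 1 := ⟨hx0, hxy.trans hy.2⟩
    have hyI : y ∈ Set.Icc (0 : ℝ) 1 := ⟨hy0.le, hy.2⟩
    have e : ∑ i ∈ Finset.range M, ((j : ℝ) ^ i) • ((y / M) ^ i • ((i.factorial : ℝ)⁻¹ •
        iteratedDeriv i (fun x => f (x, y)) 0)) = ∑ i ∈ Finset.range M, x ^ i •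
        ((i.factorial : ℝ)⁻¹ • iteratedDeriv i (fun x => f (x, y)) 0) := by
      refine Finset.sum_congr rfl fun i _ => ?_
      rw [smul_smul, ← mul_pow, hx]
      congr 2
      ring
    rw [e]
    have h1 := hC₁ x hxI y hyI
    have h2 := hC x hxI y hyI
    have h3 := norm_sub_le (f (x, y)) (f (x, y) - ∑ i ∈ Finset.range M, x ^ i •
        ((i.factorial : ℝ)⁻¹ • iteratedDeriv i (fun x => f (x, y)) 0))
    rw [sub_sub_cancel] at h3
    have h4 : C * (x + y) ^ M ≤ |C| * 2 ^ M * y ^ M := by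
      rw [mul_assoc, ← mul_pow]
      exact mul_le_mul (le_abs_self C) (pow_le_pow_left₀ (by positivity) (by linarith) M)
        (by positivity) (abs_nonneg C)
    have h5 : C₁ * x ^ M ≤ C₁ * y ^ M := by gcongr
    linarith) i hi
  simp only [norm_smul, norm_inv, norm_pow, Real.norm_natCast, norm_div,
    Real.norm_of_nonneg hy0.le] at h
  have hpow : y ^ M = y ^ (M - i) * y ^ i := by rw [← pow_add]; congr 1; omega
  rw [hpow, div_pow] at h
  have hyi : 0 < y ^ i := by positivity
  have hMi : (0 : ℝ) < M ^ i := by positivity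
  have hfac : (0 : ℝ) < i.factorial := by positivity
  have h' : y ^ i * (‖iteratedDeriv i (fun x => f (x, y)) 0‖ / (M ^ i * i.factorial)) ≤
      y ^ i * (C₂ * (|C| * 2 ^ M + C₁) * y ^ (M - i)) := by
    calc _ = y ^ i / M ^ i * ((i.factorial : ℝ)⁻¹ * ‖iteratedDeriv i (fun x => f (x, y)) 0‖) := by
          field_simp
      _ ≤ _ := h
      _ = _ := by ring
  have h'' := (div_le_iff₀ (by positivity)).1 (le_of_mul_le_mul_left h' hyi)
  linarith

/-- The preceding lemma is applied to a function that does not depend on y. Its i-th derivative is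
then at most C' y ^ (M - i) for all small y > 0, hence zero. -/
theorem iteratedDeriv_eq_zero_of_norm_le {φ : ℝ → S} (hφ : ContDiff ℝ (⊤ : ℕ∞) φ) {M : ℕ}
    {C : ℝ} (hC : ∀ x ∈ Set.Icc (0 : ℝ) 1, ‖φ x‖ ≤ C * x ^ M) {i : ℕ} (hi : i < M) :
    iteratedDeriv i φ 0 = 0 := by
  have hC0 : 0 ≤ C := (norm_nonneg _).trans (by simpa using hC 1 (by simp))
  obtain ⟨C', hC'⟩ := exists_norm_iteratedDeriv_fst_le (f := fun p => φ p.1)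
    (hφ.comp contDiff_fst) (M := M) (C := C) (fun x hx y hy => (hC x hx).trans (by
      have := hx.1
      have := hy.1
      gcongr
      linarith)) hi
  have ht : Filter.Tendsto (fun y : ℝ => C' * y ^ (M - i)) (nhdsWithin 0 (Set.Ioi 0)) (nhds 0) := by
    have : Filter.Tendsto (fun y : ℝ => C' * y ^ (M - i)) (nhds 0) (nhds (C' * 0 ^ (M - i))) :=
      (continuous_const.mul (continuous_pow _)).tendsto 0
    rw [zero_pow (by omega), mul_zero] at this
    exact this.mono_left nhdsWithin_le_nhds
  have h : ‖iteratedDeriv i φ 0‖ ≤ 0 := by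
    refine ge_of_tendsto ht ?_
    filter_upwards [Ioc_mem_nhdsGT zero_lt_one] with y hy
    exact hC' y hy
  exact norm_le_zero_iff.1 h

/-- Vanishing to order M kills the coefficients with i + k < M. The coefficients in the sum have i +
k ≤ n + r - 2, which explains the condition `n + r ≤ M + 1`. -/
theorem taylorSum₂_eq_zero_of_norm_le {f : ℝ × ℝ → S} (hf : ContDiff ℝ (⊤ : ℕ∞) f) {M : ℕ}
    {C : ℝ} (hC : ∀ x ∈ Set.Icc (0 : ℝ) 1, ∀ y ∈ Set.Icc (0 : ℝ) 1,
      ‖f (x, y)‖ ≤ C * (x + y) ^ M) {n r : ℕ} (hM : n + r ≤ M + 1) : taylorSum₂ n r f = 0 := by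
  have key : ∀ i < n, ∀ k < r,
      iteratedDeriv k (fun y => iteratedDeriv i (fun x => f (x, y)) 0) 0 = 0 := by
    intro i hi k hk
    have hs : ContDiff ℝ (⊤ : ℕ∞) (fun y => iteratedDeriv i (fun x => f (x, y)) 0) := by
      simp only [iteratedDeriv_fst hf]
      exact contDiff_right (contDiff_iterate_dirDeriv _ hf i) 0
    obtain ⟨C', hC'⟩ := exists_norm_iteratedDeriv_fst_le hf hC (i := i) (by omega)
    refine iteratedDeriv_eq_zero_of_norm_le hs (M := M - i) (C := C') (fun y hy => ?_) (by omega)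
    -- The bound is available for y > 0 only; at y = 0 it follows by continuity.
    rcases hy.1.eq_or_lt with rfl | h0
    · have h := le_of_tendsto_of_tendsto
        ((hs.continuous.norm.tendsto 0).mono_left (nhdsWithin_le_nhds (s := Set.Ioi 0)))
        (((continuous_const.mul (continuous_pow (M - i))).tendsto 0).mono_left
          (nhdsWithin_le_nhds (s := Set.Ioi 0)))
        (by filter_upwards [Ioc_mem_nhdsGT zero_lt_one] with y hy using hC' y hy)
      exact h
    · exact hC' y ⟨h0, hy.2⟩
  rw [taylorSum₂, taylorSum]
  refine Finset.sum_eq_zero fun k hk => ?_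
  simp only [taylorSum]
  rw [iteratedDeriv_fun_sum]
  · rw [Finset.sum_eq_zero, smul_zero]
    intro i hi
    rw [iteratedDeriv_fun_const_smul_field, key i (Finset.mem_range.1 hi) k (Finset.mem_range.1 hk),
      smul_zero]
  · intro i _
    simp only [iteratedDeriv_fst hf]
    exact contDiffAt_nat (contDiff_const.smul
      (contDiff_right (contDiff_iterate_dirDeriv _ hf i) 0)) k 0

theorem taylorSum_sum {ι : Type*} (s : Finset ι) (m : ℕ) {u : ι → ℝ → S}
    (hu : ∀ j ∈ s, ContDiff ℝ (⊤ : ℕ∞) (u j)) :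
    taylorSum m (fun x => ∑ j ∈ s, u j x) = ∑ j ∈ s, taylorSum m (u j) := by
  simp only [taylorSum]
  rw [Finset.sum_comm]
  refine Finset.sum_congr rfl fun i _ => ?_
  rw [iteratedDeriv_fun_sum fun j hj => contDiffAt_nat (hu j hj) i 0, Finset.smul_sum]

theorem taylorSum_pow_smul (m I : ℕ) (w : S) :
    taylorSum m (fun x => x ^ I • w) = if I < m then w else 0 := by
  have h : ∀ i, iteratedDeriv i (fun x : ℝ => x ^ I • w) 0 =
      if i = I then (I.factorial : ℝ) • w else 0 := by
    intro i
    rw [iteratedDeriv_smul_const (f := fun x : ℝ => x ^ I) ((contDiff_id.pow I).contDiffAt) w,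
      iteratedDeriv_fun_pow_zero]
    split_ifs with h <;> simp
  simp only [taylorSum, h, smul_ite, smul_zero]
  rw [Finset.sum_ite_eq' (Finset.range m) I]
  simp only [Finset.mem_range]
  split_ifs with hI
  · rw [smul_smul, inv_mul_cancel₀ (by positivity), one_smul]
  · rfl

theorem taylorSum₂_sub (n r : ℕ) {f h : ℝ × ℝ → S} (hf : ContDiff ℝ (⊤ : ℕ∞) f)
    (hh : ContDiff ℝ (⊤ : ℕ∞) h) :
    taylorSum₂ n r (fun p => f p - h p) = taylorSum₂ n r f - taylorSum₂ n r h := by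
  simp only [taylorSum₂]
  rw [← taylorSum_sub r (contDiff_taylorSum_left n hf) (contDiff_taylorSum_left n hh)]
  congr 1
  ext y
  exact taylorSum_sub n (contDiff_left hf y) (contDiff_left hh y)

theorem taylorSum₂_sum {ι : Type*} (s : Finset ι) (n r : ℕ) {f : ι → ℝ × ℝ → S}
    (hf : ∀ j ∈ s, ContDiff ℝ (⊤ : ℕ∞) (f j)) :
    taylorSum₂ n r (fun p => ∑ j ∈ s, f j p) = ∑ j ∈ s, taylorSum₂ n r (f j) := by
  simp only [taylorSum₂]
  rw [← taylorSum_sum s r fun j hj => contDiff_taylorSum_left n (hf j hj)]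
  congr 1
  ext y
  exact taylorSum_sum s n fun j hj => contDiff_left (hf j hj) y

theorem contDiff_monomial (I J : ℕ) (w : S) :
    ContDiff ℝ (⊤ : ℕ∞) (fun p : ℝ × ℝ => (p.1 ^ I * p.2 ^ J) • w) :=
  ((contDiff_fst.pow I).mul (contDiff_snd.pow J)).smul contDiff_const

theorem taylorSum₂_monomial (n r I J : ℕ) (w : S) :
    taylorSum₂ n r (fun p => (p.1 ^ I * p.2 ^ J) • w) = if I < n ∧ J < r then w else 0 := by
  have h : ∀ y : ℝ, taylorSum n (fun x => (x ^ I * y ^ J) • w) =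
      y ^ J • (if I < n then w else 0) := by
    intro y
    simp only [mul_smul]
    rw [taylorSum_pow_smul]
    split_ifs <;> simp
  simp only [taylorSum₂, h, taylorSum_pow_smul]
  split_ifs <;> simp_all

/-- The coefficients `c` without the constant term. -/
def dropConst (c : ℕ → ℕ → F) (i k : ℕ) : F := if i = 0 ∧ k = 0 then 0 else c i k

theorem polyEval_sub_const {n r : ℕ} (hn : 0 < n) (hr : 0 < r) (c : ℕ → ℕ → F) (p : ℝ × ℝ) :
    polyEval n r c p - c 0 0 = polyEval n r (dropConst c) p := by
  have h : ∀ d : ℕ → ℕ → F, polyEval n r d p = d 0 0 +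
      ∑ q ∈ (Finset.range n ×ˢ Finset.range r).erase (0, 0), (p.1 ^ q.1 * p.2 ^ q.2) • d q.1 q.2 := by
    intro d
    rw [polyEval, ← Finset.sum_product', ← Finset.add_sum_erase _ _
      (show (0, 0) ∈ Finset.range n ×ˢ Finset.range r by simp [hn, hr])]
    simp
  rw [h c, h (dropConst c), add_sub_cancel_left]
  simp only [dropConst, and_self, if_true, zero_add]
  refine Finset.sum_congr rfl fun q hq => ?_
  rw [if_neg]
  rintro ⟨h1, h2⟩
  exact (Finset.mem_erase.1 hq).1 (Prod.ext h1 h2)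

theorem map_polyEval {l : ℕ} (f : MultilinearMap ℝ (fun _ : Fin l => F) S) (n r : ℕ)
    (c : ℕ → ℕ → F) (p : ℝ × ℝ) :
    f (fun _ => polyEval n r c p) =
      ∑ α ∈ Fintype.piFinset fun _ : Fin l => Finset.range n,
        ∑ β ∈ Fintype.piFinset fun _ : Fin l => Finset.range r,
          (p.1 ^ (∑ m, α m) * p.2 ^ (∑ m, β m)) • f fun m => c (α m) (β m) := by
  simp only [polyEval]
  rw [MultilinearMap.map_sum_finset f
    (fun _ i => ∑ k ∈ Finset.range r, (p.1 ^ i * p.2 ^ k) • c i k) (fun _ => Finset.range n)]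
  refine Finset.sum_congr rfl fun α _ => ?_
  rw [MultilinearMap.map_sum_finset f
    (fun m k => (p.1 ^ α m * p.2 ^ k) • c (α m) k) (fun _ => Finset.range r)]
  refine Finset.sum_congr rfl fun β _ => ?_
  rw [MultilinearMap.map_smul_univ, Finset.prod_mul_distrib, Finset.prod_pow_eq_pow_sum,
    Finset.prod_pow_eq_pow_sum]

theorem exists_norm_polyEval_sub_const_le (n r : ℕ) (c : ℕ → ℕ → F) :
    ∃ C : ℝ, 0 ≤ C ∧ ∀ x ∈ Set.Icc (0 : ℝ) 1, ∀ y ∈ Set.Icc (0 : ℝ) 1,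
      ‖polyEval n r (dropConst c) (x, y)‖ ≤ C * (x + y) := by
  refine ⟨∑ i ∈ Finset.range n, ∑ k ∈ Finset.range r, ‖c i k‖, by positivity, ?_⟩
  intro x hx y hy
  rw [Finset.sum_mul]
  refine norm_sum_le_of_le _ fun i _ => ?_
  rw [Finset.sum_mul]
  refine norm_sum_le_of_le _ fun k _ => ?_
  have hx0 := hx.1
  have hy0 := hy.1
  simp only [dropConst]
  split_ifs with h
  · rw [smul_zero, norm_zero]; positivity
  · rw [norm_smul, mul_comm, norm_mul, norm_pow, norm_pow, Real.norm_of_nonneg hx0,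
      Real.norm_of_nonneg hy0]
    refine mul_le_mul_of_nonneg_left ?_ (norm_nonneg _)
    rcases Nat.eq_zero_or_pos i with rfl | hi
    · have hk : k ≠ 0 := by tauto
      have := pow_le_of_le_one hy0 hy.2 hk
      rw [pow_zero, one_mul]
      linarith
    · have h1 := pow_le_of_le_one hx0 hx.2 hi.ne'
      have h2 := pow_le_one₀ hy0 hy.2 (n := k)
      have h3 := mul_le_of_le_one_right (pow_nonneg hx0 i) h2
      linarith

/-- The Taylor coefficients of `g ∘ P` for a polynomial `P`. -/
theorem taylorSum₂_comp_polyEval_eq_sum [CompleteSpace S] {g : F → S}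
    (hg : ContDiff ℝ (⊤ : ℕ∞) g) {n r : ℕ} (hn : 0 < n) (hr : 0 < r) (c : ℕ → ℕ → F) :
    taylorSum₂ n r (fun p => g (polyEval n r c p)) =
      ∑ l ∈ Finset.range (n + r - 1), ((l.factorial : ℝ)⁻¹) •
        ∑ α ∈ Fintype.piFinset fun _ : Fin l => Finset.range n,
          ∑ β ∈ Fintype.piFinset fun _ : Fin l => Finset.range r,
            if ∑ m, α m < n ∧ ∑ m, β m < r then
              iteratedFDeriv ℝ l g (c 0 0) fun m => dropConst c (α m) (β m) else 0 := by
  -- The Taylor polynomial of g at P(0, 0), of degree at most n + r - 2, evaluated at P. It is a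
  -- polynomial in p, so its truncation can be read off from its monomials; the rest of the proof
  -- shows that g ∘ P and q have the same truncation.
  set q : ℝ × ℝ → S := fun p => ∑ l ∈ Finset.range (n + r - 1), ((l.factorial : ℝ)⁻¹) •
    iteratedFDeriv ℝ l g (c 0 0) fun _ => polyEval n r (dropConst c) p with hq
  have hq' : q = fun p => ∑ l ∈ Finset.range (n + r - 1),
      ∑ α ∈ Fintype.piFinset fun _ : Fin l => Finset.range n,
        ∑ β ∈ Fintype.piFinset fun _ : Fin l => Finset.range r,
          (p.1 ^ (∑ m, α m) * p.2 ^ (∑ m, β m)) • ((l.factorial : ℝ)⁻¹) •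
            iteratedFDeriv ℝ l g (c 0 0) fun m => dropConst c (α m) (β m) := by
    ext p
    refine Finset.sum_congr rfl fun l _ => ?_
    have h := map_polyEval (iteratedFDeriv ℝ l g (c 0 0)).toMultilinearMap n r (dropConst c) p
    simp only [ContinuousMultilinearMap.coe_coe] at h
    rw [h]
    simp only [Finset.smul_sum]
    refine Finset.sum_congr rfl fun α _ => Finset.sum_congr rfl fun β _ => smul_comm _ _ _
  have hqs : ContDiff ℝ (⊤ : ℕ∞) q := by
    rw [hq']
    exact ContDiff.sum fun l _ => ContDiff.sum fun α _ => ContDiff.sum fun β _ =>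
      contDiff_monomial _ _ _
  have hgs : ContDiff ℝ (⊤ : ℕ∞) (fun p => g (polyEval n r c p)) :=
    hg.comp (contDiff_polyEval n r c)
  have hTq : taylorSum₂ n r q = ∑ l ∈ Finset.range (n + r - 1), ((l.factorial : ℝ)⁻¹) •
        ∑ α ∈ Fintype.piFinset fun _ : Fin l => Finset.range n,
          ∑ β ∈ Fintype.piFinset fun _ : Fin l => Finset.range r,
            if ∑ m, α m < n ∧ ∑ m, β m < r then
              iteratedFDeriv ℝ l g (c 0 0) fun m => dropConst c (α m) (β m) else 0 := by
    rw [hq', taylorSum₂_sum _ _ _ fun l _ => ContDiff.sum fun α _ => ContDiff.sum fun β _ =>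
      contDiff_monomial _ _ _]
    refine Finset.sum_congr rfl fun l _ => ?_
    rw [taylorSum₂_sum _ _ _ fun α _ => ContDiff.sum fun β _ => contDiff_monomial _ _ _,
      Finset.smul_sum]
    refine Finset.sum_congr rfl fun α _ => ?_
    rw [taylorSum₂_sum _ _ _ fun β _ => contDiff_monomial _ _ _, Finset.smul_sum]
    refine Finset.sum_congr rfl fun β _ => ?_
    rw [taylorSum₂_monomial]
    split_ifs <;> simp
  rw [← hTq, ← sub_eq_zero, ← taylorSum₂_sub n r hgs hqs]
  obtain ⟨C₁, hC₁0, hC₁⟩ := exists_norm_polyEval_sub_const_le n r c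
  -- L = n + r - 2 is the degree of the expansion of g. The error is of order L + 1 = n + r - 1, the
  -- least order that suffices for `taylorSum₂_eq_zero_of_norm_le`.
  obtain ⟨L, hL⟩ : ∃ L, n + r - 1 = L + 1 := ⟨n + r - 2, by omega⟩
  -- Parametrises all segments from P(0, 0) to P(x, y). On their compact union the derivative of
  -- order L + 1, which enters the integral remainder, is bounded.
  set Φ : ℝ × ℝ × ℝ → F := fun t => c 0 0 + t.1 • polyEval n r (dropConst c) t.2 with hΦ
  have hΦc : Continuous Φ := continuous_const.add
    (continuous_fst.smul ((contDiff_polyEval n r (dropConst c)).continuous.comp continuous_snd))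
  obtain ⟨C₂, hC₂⟩ := ((isCompact_Icc (a := (0 : ℝ)) (b := 1)).prod
    ((isCompact_Icc (a := (0 : ℝ)) (b := 1)).prod
    (isCompact_Icc (a := (0 : ℝ)) (b := 1)))).exists_bound_of_continuousOn
    ((hg.continuous_iteratedFDeriv (m := L + 1) (by exact_mod_cast le_top)).comp hΦc).continuousOn
  have hC₂0 : 0 ≤ C₂ := (norm_nonneg _).trans (hC₂ (0, 0, 0) (by simp))
  refine taylorSum₂_eq_zero_of_norm_le (hgs.sub hqs) (M := L + 1) (C := C₂ * C₁ ^ (L + 1))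
    (fun x hx y hy => ?_) (by omega)
  have hP : polyEval n r c (x, y) = c 0 0 + polyEval n r (dropConst c) (x, y) := by
    rw [← polyEval_sub_const hn hr]; abel
  have hT := map_add_eq_sum_add_integral_iteratedFDeriv (f := g) (x := c 0 0)
    (y := polyEval n r (dropConst c) (x, y)) (n := L)
    fun t _ => (hg.of_le (by exact_mod_cast le_top)).contDiffAt
  rw [← hP] at hT
  rw [hq, hT, hL, add_sub_cancel_left, norm_smul, norm_inv, Real.norm_natCast]
  have hI : ‖∫ t in (0 : ℝ)..1, (1 - t) ^ L • iteratedFDeriv ℝ (L + 1) g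
      (c 0 0 + t • polyEval n r (dropConst c) (x, y))
      fun _ => polyEval n r (dropConst c) (x, y)‖ ≤
      C₂ * C₁ ^ (L + 1) * (x + y) ^ (L + 1) * |1 - 0| := by
    refine intervalIntegral.norm_integral_le_of_norm_le_const fun t ht => ?_
    rw [Set.uIoc_of_le zero_le_one] at ht
    have ht' : t ∈ Set.Icc (0 : ℝ) 1 := ⟨ht.1.le, ht.2⟩
    rw [norm_smul, norm_pow]
    have h1 : ‖1 - t‖ ^ L ≤ 1 := by
      refine pow_le_one₀ (norm_nonneg _) ?_
      rw [Real.norm_of_nonneg (by linarith [ht.2])]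
      linarith [ht.1]
    refine (mul_le_of_le_one_left (norm_nonneg _) h1).trans ?_
    refine (ContinuousMultilinearMap.le_opNorm _ _).trans ?_
    rw [Finset.prod_const, Finset.card_fin, mul_assoc, ← mul_pow]
    exact mul_le_mul (hC₂ (t, x, y) ⟨ht', hx, hy⟩)
      (pow_le_pow_left₀ (norm_nonneg _) (hC₁ x hx y hy) _) (by positivity) hC₂0
  rw [sub_zero, abs_one, mul_one] at hI
  refine (mul_le_of_le_one_left (norm_nonneg _) ?_).trans hI
  exact inv_le_one_of_one_le₀ (by exact_mod_cast Nat.one_le_iff_ne_zero.2 (Nat.factorial_ne_zero L))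

end TaylorCoefficients

/-! ### Levels and truncations of the tensor algebra -/

section Levels

set_option linter.unusedSectionVars false

variable {V : Type*} [NormedAddCommGroup V] [NormedSpace ℝ V]

theorem toDirectSum_toTensorAlgebra {k : ℕ} (x : ⨂[ℝ]^k V) :
    TensorAlgebra.toDirectSum (TensorPower.toTensorAlgebra x : TensorAlgebra ℝ V) =
      DirectSum.of (fun n => ⨂[ℝ]^n V) k x := by
  have h : TensorAlgebra.ofDirectSum (DirectSum.of (fun n => ⨂[ℝ]^n V) k x) =
      (TensorPower.toTensorAlgebra x : TensorAlgebra ℝ V) := by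
    exact DirectSum.toAddMonoid_of _ _ _
  rw [← h, TensorAlgebra.toDirectSum_ofDirectSum]

theorem coord_toTensorAlgebra_self {k : ℕ} (x : ⨂[ℝ]^k V) :
    coord V k (TensorPower.toTensorAlgebra x) = x := by
  rw [coord, LinearMap.comp_apply, AlgHom.toLinearMap_apply, toDirectSum_toTensorAlgebra]
  exact DirectSum.component.lof_self (R := ℝ) (M := fun n => ⨂[ℝ]^n V) k x

theorem coord_toTensorAlgebra_of_ne {k j : ℕ} (h : k ≠ j) (x : ⨂[ℝ]^k V) :
    coord V j (TensorPower.toTensorAlgebra x) = 0 := by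
  rw [coord, LinearMap.comp_apply, AlgHom.toLinearMap_apply, toDirectSum_toTensorAlgebra]
  exact (DirectSum.component.of (R := ℝ) (M := fun n => ⨂[ℝ]^n V) j k x).trans (dif_neg h)

theorem tensorAlgebra_induction {p : TensorAlgebra ℝ V → Prop}
    (hlevel : ∀ (k : ℕ) (x : ⨂[ℝ]^k V), p (TensorPower.toTensorAlgebra x))
    (hadd : ∀ x y, p x → p y → p (x + y)) (x : TensorAlgebra ℝ V) : p x := by
  rw [← TensorAlgebra.ofDirectSum_toDirectSum x]
  induction TensorAlgebra.toDirectSum x using DirectSum.induction_on with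
  | zero => rw [map_zero]; simpa using hlevel 0 0
  | of k x =>
    rw [← toDirectSum_toTensorAlgebra, TensorAlgebra.ofDirectSum_toDirectSum]
    exact hlevel k x
  | add x y hx hy => rw [map_add]; exact hadd _ _ hx hy

/-- `x` is homogeneous of level `k`. -/
def IsLevel (k : ℕ) (x : TensorAlgebra ℝ V) : Prop :=
  ∃ η : ⨂[ℝ]^k V, TensorPower.toTensorAlgebra η = x

theorem IsLevel.proj_self {k : ℕ} {x : TensorAlgebra ℝ V} (h : IsLevel k x) : proj V k x = x := by
  obtain ⟨η, rfl⟩ := h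
  simp [proj, coord_toTensorAlgebra_self]

theorem IsLevel.coord_eq_zero {k j : ℕ} {x : TensorAlgebra ℝ V} (h : IsLevel k x) (hkj : k ≠ j) :
    coord V j x = 0 := by
  obtain ⟨η, rfl⟩ := h
  exact coord_toTensorAlgebra_of_ne hkj η

theorem IsLevel.proj_eq_zero {k j : ℕ} {x : TensorAlgebra ℝ V} (h : IsLevel k x) (hkj : k ≠ j) :
    proj V j x = 0 := by
  rw [proj, LinearMap.comp_apply, h.coord_eq_zero hkj, map_zero]

theorem IsLevel.toTensorAlgebra_coord {k : ℕ} {x : TensorAlgebra ℝ V} (h : IsLevel k x) :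
    TensorPower.toTensorAlgebra (coord V k x) = x := h.proj_self

theorem IsLevel.zero (k : ℕ) : IsLevel k (0 : TensorAlgebra ℝ V) := ⟨0, map_zero _⟩

theorem IsLevel.add {k : ℕ} {x y : TensorAlgebra ℝ V} (hx : IsLevel k x) (hy : IsLevel k y) :
    IsLevel k (x + y) := by
  obtain ⟨η, rfl⟩ := hx
  obtain ⟨ξ, rfl⟩ := hy
  exact ⟨η + ξ, map_add _ _ _⟩

theorem IsLevel.sum {ι : Type*} {s : Finset ι} {k : ℕ} {x : ι → TensorAlgebra ℝ V}
    (h : ∀ i ∈ s, IsLevel k (x i)) : IsLevel k (∑ i ∈ s, x i) :=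
  Finset.sum_induction _ _ (fun _ _ => IsLevel.add) (IsLevel.zero k) h

theorem IsLevel.smul {k : ℕ} {x : TensorAlgebra ℝ V} (hx : IsLevel k x) (c : ℝ) :
    IsLevel k (c • x) := by
  obtain ⟨η, rfl⟩ := hx
  exact ⟨c • η, map_smul _ _ _⟩

theorem IsLevel.mul {k j : ℕ} {x y : TensorAlgebra ℝ V} (hx : IsLevel k x) (hy : IsLevel j y) :
    IsLevel (k + j) (x * y) := by
  obtain ⟨η, rfl⟩ := hx
  obtain ⟨ξ, rfl⟩ := hy
  exact ⟨_, TensorPower.toTensorAlgebra_gMul η ξ⟩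

theorem isLevel_one : IsLevel 0 (1 : TensorAlgebra ℝ V) := ⟨_, TensorPower.toTensorAlgebra_gOne⟩

theorem isLevel_ι (v : V) : IsLevel 1 (TensorAlgebra.ι ℝ v) :=
  ⟨PiTensorProduct.tprod ℝ fun _ => v, by simp [TensorAlgebra.tprod_apply]⟩

theorem isLevel_ι_pow (v : V) (k : ℕ) : IsLevel k (TensorAlgebra.ι ℝ v ^ k) := by
  induction k with
  | zero => rw [pow_zero]; exact isLevel_one
  | succ k ih => rw [pow_succ]; exact ih.mul (isLevel_ι v)

theorem proj_isLevel (k : ℕ) (x : TensorAlgebra ℝ V) : IsLevel k (proj V k x) := ⟨_, rfl⟩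

theorem proj_mul (k : ℕ) (x y : TensorAlgebra ℝ V) :
    proj V k (x * y) = ∑ q ∈ Finset.HasAntidiagonal.antidiagonal k, proj V q.1 x * proj V q.2 y := by
  induction x using tensorAlgebra_induction with
  | hadd x₁ x₂ h₁ h₂ => simp only [add_mul, map_add, h₁, h₂, Finset.sum_add_distrib]
  | hlevel i ξ =>
    induction y using tensorAlgebra_induction with
    | hadd y₁ y₂ h₁ h₂ => simp only [mul_add, map_add, h₁, h₂, Finset.sum_add_distrib]
    | hlevel j η =>
      have hx : IsLevel i (TensorPower.toTensorAlgebra ξ : TensorAlgebra ℝ V) := ⟨ξ, rfl⟩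
      have hy : IsLevel j (TensorPower.toTensorAlgebra η : TensorAlgebra ℝ V) := ⟨η, rfl⟩
      by_cases hk : i + j = k
      · subst hk
        rw [(hx.mul hy).proj_self, Finset.sum_eq_single (i, j)]
        · rw [hx.proj_self, hy.proj_self]
        · rintro ⟨i', j'⟩ hq hne
          by_cases hi : i = i'
          · have hj : j ≠ j' := by rintro rfl; exact hne (by rw [hi])
            rw [hy.proj_eq_zero hj, mul_zero]
          · rw [hx.proj_eq_zero hi, zero_mul]
        · intro h; exact absurd (by simp) h
      · rw [(hx.mul hy).proj_eq_zero hk, Finset.sum_eq_zero]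
        rintro ⟨i', j'⟩ hq
        have hq' := Finset.HasAntidiagonal.mem_antidiagonal.1 hq
        by_cases hi : i = i'
        · have hj : j ≠ j' := by rintro rfl; exact hk (by rw [hi]; exact hq')
          rw [hy.proj_eq_zero hj, mul_zero]
        · rw [hx.proj_eq_zero hi, zero_mul]

theorem IsLevel.truncate_self {n k : ℕ} {x : TensorAlgebra ℝ V} (h : IsLevel k x) (hk : k < n) :
    truncate V n x = x := by
  rw [truncate, LinearMap.sum_apply, Finset.sum_eq_single_of_mem k (Finset.mem_range.2 hk),
    h.proj_self]
  intro j _ hj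
  exact h.proj_eq_zero hj.symm

theorem proj_proj (j k : ℕ) (x : TensorAlgebra ℝ V) :
    proj V j (proj V k x) = if j = k then proj V k x else 0 := by
  split_ifs with h
  · subst h; exact (proj_isLevel j x).proj_self
  · exact (proj_isLevel k x).proj_eq_zero (Ne.symm h)

theorem proj_truncate (n k : ℕ) (x : TensorAlgebra ℝ V) :
    proj V k (truncate V n x) = if k < n then proj V k x else 0 := by
  simp only [truncate, LinearMap.sum_apply, map_sum, proj_proj]
  rw [Finset.sum_ite_eq (Finset.range n) k]
  simp

theorem truncate_eq_sum (n : ℕ) (x : TensorAlgebra ℝ V) :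
    truncate V n x = ∑ k ∈ Finset.range n, proj V k x := by
  simp [truncate]

theorem truncate_congr {n : ℕ} {x y : TensorAlgebra ℝ V}
    (h : ∀ k < n, proj V k x = proj V k y) : truncate V n x = truncate V n y := by
  rw [truncate_eq_sum, truncate_eq_sum]
  exact Finset.sum_congr rfl fun k hk => h k (Finset.mem_range.1 hk)

theorem truncate_truncate (n : ℕ) (x : TensorAlgebra ℝ V) :
    truncate V n (truncate V n x) = truncate V n x :=
  truncate_congr fun k hk => by rw [proj_truncate, if_pos hk]

theorem coe_toTrunc (n : ℕ) (x : TensorAlgebra ℝ V) :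
    (toTrunc V n x : TensorAlgebra ℝ V) = truncate V n x := rfl

theorem toTrunc_coe {n : ℕ} (x : Trunc V n) : toTrunc V n (x : TensorAlgebra ℝ V) = x := by
  obtain ⟨_, y, rfl⟩ := x
  exact Subtype.ext (truncate_truncate n y)

theorem toTrunc_congr {n : ℕ} {x y : TensorAlgebra ℝ V}
    (h : ∀ k < n, proj V k x = proj V k y) : toTrunc V n x = toTrunc V n y :=
  Subtype.ext (truncate_congr h)

/-- A level below n of a product involves only levels below n of the factors, so truncation is
compatible with multiplication. -/
theorem leftMul_toTrunc {n : ℕ} (x y : TensorAlgebra ℝ V) :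
    leftMul (toTrunc V n x) (toTrunc V n y) = toTrunc V n (x * y) := by
  refine toTrunc_congr fun k hk => ?_
  simp only [LinearMap.coe_comp, Function.comp_apply, Submodule.subtype_apply,
    LinearMap.mulLeft_apply, coe_toTrunc]
  rw [proj_mul, proj_mul]
  refine Finset.sum_congr rfl fun q hq => ?_
  have := Finset.HasAntidiagonal.mem_antidiagonal.1 hq
  rw [proj_truncate, proj_truncate, if_pos (by omega), if_pos (by omega)]

theorem IsLevel.incl_coord {n k : ℕ} {x : TensorAlgebra ℝ V} (h : IsLevel k x) :
    incl V n k (coord V k x) = toTrunc V n x := by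
  rw [incl, LinearMap.comp_apply, h.toTensorAlgebra_coord]

theorem coord_proj_self (k : ℕ) (x : TensorAlgebra ℝ V) : coord V k (proj V k x) = coord V k x :=
  coord_toTensorAlgebra_self _

theorem sum_incl_coord {n : ℕ} (x : Trunc V n) :
    ∑ k ∈ Finset.range n, incl V n k (coord V k (x : TensorAlgebra ℝ V)) = x := by
  conv_rhs => rw [← toTrunc_coe x, ← toTrunc_coe (toTrunc V n (x : TensorAlgebra ℝ V)),
    coe_toTrunc, truncate_eq_sum, map_sum]
  rfl

theorem truncNorm_toTrunc_isLevel {n k : ℕ} {x : TensorAlgebra ℝ V} (h : IsLevel k x) (hk : k < n) :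
    truncNorm (toTrunc V n x) = ‖coord V k x‖ := by
  rw [truncNorm, coe_toTrunc, h.truncate_self hk,
    Finset.sum_eq_single_of_mem k (Finset.mem_range.2 hk)]
  intro j _ hj
  rw [h.coord_eq_zero hj.symm, norm_zero]

theorem truncNorm_nonneg {n : ℕ} (x : Trunc V n) : 0 ≤ truncNorm x :=
  Finset.sum_nonneg fun _ _ => norm_nonneg _

theorem truncNorm_sum_le {ι : Type*} {n : ℕ} (s : Finset ι) (x : ι → Trunc V n) :
    truncNorm (∑ i ∈ s, x i) ≤ ∑ i ∈ s, truncNorm (x i) := by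
  simp only [truncNorm]
  rw [Finset.sum_comm]
  refine Finset.sum_le_sum fun k _ => ?_
  rw [Submodule.coe_sum, map_sum]
  exact norm_sum_le _ _

/-! ### Signatures of piecewise linear paths -/

/-- The series of the `v^k / k!`. -/
def expSeries (v : V) : PowerSeries (TensorAlgebra ℝ V) :=
  PowerSeries.mk fun k => ((k.factorial : ℝ)⁻¹) • TensorAlgebra.ι ℝ v ^ k

/-- The signature of the piecewise linear path with increments `l`, graded by the levels. -/
def sigSeries (l : List V) : PowerSeries (TensorAlgebra ℝ V) := (l.map expSeries).prod

/-- The `i`-th level of the signature of the piecewise linear path with increments `l`. -/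
def sigLevel (l : List V) (i : ℕ) : TensorAlgebra ℝ V := PowerSeries.coeff i (sigSeries l)

/-- The length of the piecewise linear path with increments `l`. -/
def pathLength (l : List V) : ℝ := (l.map fun v => ‖v‖).sum

/-- The piecewise linear path with increments scaled by `c`. -/
def scalePath (c : ℝ) (l : List V) : List V := l.map fun v => c • v

theorem pathLength_nonneg (l : List V) : 0 ≤ pathLength l :=
  List.sum_nonneg (by simp)

theorem pathLength_append (l l' : List V) : pathLength (l ++ l') = pathLength l + pathLength l' := by
  simp [pathLength]

theorem pathLength_scalePath (c : ℝ) (l : List V) :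
    pathLength (scalePath c l) = |c| * pathLength l := by
  induction l with
  | nil => simp [pathLength, scalePath]
  | cons v l ih =>
    simp only [pathLength, scalePath, List.map_cons, List.sum_cons] at ih ⊢
    rw [ih, norm_smul, Real.norm_eq_abs, mul_add]

theorem sigLevel_nil (i : ℕ) : sigLevel ([] : List V) i = if i = 0 then 1 else 0 := by
  simp [sigLevel, sigSeries, PowerSeries.coeff_one]

theorem sigLevel_append (l l' : List V) (i : ℕ) : sigLevel (l ++ l') i =
    ∑ q ∈ Finset.HasAntidiagonal.antidiagonal i, sigLevel l q.1 * sigLevel l' q.2 := by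
  simp [sigLevel, sigSeries, PowerSeries.coeff_mul]

theorem sigLevel_cons (v : V) (l : List V) (i : ℕ) : sigLevel (v :: l) i =
    ∑ q ∈ Finset.HasAntidiagonal.antidiagonal i,
      (((q.1.factorial : ℝ)⁻¹) • TensorAlgebra.ι ℝ v ^ q.1) * sigLevel l q.2 := by
  simp [sigLevel, sigSeries, PowerSeries.coeff_mul, expSeries]

theorem isLevel_sigLevel (l : List V) (i : ℕ) : IsLevel i (sigLevel l i) := by
  induction l generalizing i with
  | nil =>
    rw [sigLevel_nil]
    split_ifs with h
    · subst h; exact isLevel_one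
    · exact IsLevel.zero i
  | cons v l ih =>
    rw [sigLevel_cons]
    refine IsLevel.sum fun q hq => ?_
    rw [← Finset.HasAntidiagonal.mem_antidiagonal.1 hq]
    exact ((isLevel_ι_pow v q.1).smul _).mul (ih q.2)

@[simp]
theorem sigLevel_zero (l : List V) : sigLevel l 0 = 1 := by
  induction l with
  | nil => simp [sigLevel_nil]
  | cons v l ih => simp [sigLevel_cons, ih]

theorem sigLevel_scalePath (c : ℝ) (l : List V) (i : ℕ) :
    sigLevel (scalePath c l) i = c ^ i • sigLevel l i := by
  induction l generalizing i with
  | nil =>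
    rw [scalePath, List.map_nil, sigLevel_nil]
    split_ifs with h
    · simp [h]
    · simp
  | cons v l ih =>
    have e : scalePath c (v :: l) = (c • v) :: scalePath c l := rfl
    rw [e, sigLevel_cons, sigLevel_cons, Finset.smul_sum]
    refine Finset.sum_congr rfl fun q hq => ?_
    rw [ih, map_smul, smul_pow, ← Finset.HasAntidiagonal.mem_antidiagonal.1 hq]
    simp only [smul_mul_assoc, mul_smul_comm, smul_smul]
    congr 1
    ring

theorem prod_map_ι_eq (w : List V) : (w.map (TensorAlgebra.ι ℝ)).prod =
    TensorPower.toTensorAlgebra (PiTensorProduct.tprod ℝ w.get) := by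
  rw [TensorPower.toTensorAlgebra_tprod, TensorAlgebra.tprod_apply]
  congr 1
  conv_lhs => rw [← List.ofFn_get w, List.map_ofFn]
  rfl

theorem isLevel_prod_map_ι (w : List V) : IsLevel w.length (w.map (TensorAlgebra.ι ℝ)).prod :=
  ⟨_, (prod_map_ι_eq w).symm⟩

theorem norm_coord_prod_map_ι_le (w : List V) (k : ℕ) :
    ‖coord V k (w.map (TensorAlgebra.ι ℝ)).prod‖ ≤ (w.map fun v => ‖v‖).prod := by
  by_cases hk : w.length = k
  · subst hk
    rw [prod_map_ι_eq, coord_toTensorAlgebra_self]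
    refine (PiTensorProduct.projectiveSeminorm_tprod_le _).trans (le_of_eq ?_)
    conv_rhs => rw [← List.ofFn_get w, List.map_ofFn, List.prod_ofFn]
    rfl
  · rw [(isLevel_prod_map_ι w).coord_eq_zero hk, norm_zero]
    exact List.prod_nonneg (by simp)

/-- The word w makes the induction close: the powers of the next increment are moved from the
signature into w. Only the projective norm of pure tensors is then needed. The weights 1 / k! are
bounded by 1 and hence by binomial coefficients, so that the binomial theorem sums the terms. -/
theorem norm_coord_prod_mul_sigLevel_le (l w : List V) (i k : ℕ) :
    ‖coord V k ((w.map (TensorAlgebra.ι ℝ)).prod * sigLevel l i)‖ ≤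
      (w.map fun v => ‖v‖).prod * pathLength l ^ i := by
  induction l generalizing w i with
  | nil =>
    rw [sigLevel_nil]
    split_ifs with h
    · subst h
      simpa using norm_coord_prod_map_ι_le w k
    · simp [pathLength, h]
  | cons v l ih =>
    have hL := pathLength_nonneg l
    rw [sigLevel_cons, Finset.mul_sum, map_sum]
    have hw : 0 ≤ (w.map fun v => ‖v‖).prod := List.prod_nonneg (by simp)
    have e : pathLength (v :: l) = ‖v‖ + pathLength l := by simp [pathLength]
    have h1 : ∀ q ∈ Finset.HasAntidiagonal.antidiagonal i,
        ‖coord V k ((w.map (TensorAlgebra.ι ℝ)).prod *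
          ((((q.1.factorial : ℝ)⁻¹) • TensorAlgebra.ι ℝ v ^ q.1) * sigLevel l q.2))‖ ≤
        (w.map fun v => ‖v‖).prod * (i.choose q.1 * (‖v‖ ^ q.1 * pathLength l ^ q.2)) := by
      intro q hq
      have h2 := ih (w ++ List.replicate q.1 v) q.2
      simp only [List.map_append, List.map_replicate, List.prod_append, List.prod_replicate] at h2
      rw [smul_mul_assoc, mul_smul_comm, map_smul, norm_smul, ← mul_assoc]
      refine (mul_le_of_le_one_left (norm_nonneg _) ?_).trans (h2.trans ?_)
      · rw [norm_inv, Real.norm_natCast]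
        exact inv_le_one_of_one_le₀
          (by exact_mod_cast Nat.one_le_iff_ne_zero.2 (Nat.factorial_ne_zero _))
      · rw [mul_assoc]
        refine mul_le_mul_of_nonneg_left (le_mul_of_one_le_left (by positivity) ?_) hw
        have := Finset.HasAntidiagonal.mem_antidiagonal.1 hq
        exact_mod_cast Nat.choose_pos (by omega)
    refine (norm_sum_le_of_le _ h1).trans (le_of_eq ?_)
    rw [← Finset.mul_sum, e, (Commute.all ‖v‖ (pathLength l)).add_pow']
    simp only [nsmul_eq_mul]

theorem norm_coord_sigLevel_le (l : List V) (i k : ℕ) :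
    ‖coord V k (sigLevel l i)‖ ≤ pathLength l ^ i := by
  simpa using norm_coord_prod_mul_sigLevel_le l [] i k

/-- The levels of signatures span the tensor powers. -/
theorem mem_of_sigLevel_mem {j : ℕ} {p : Submodule ℝ (TensorAlgebra ℝ V)}
    (hp : ∀ l : List V, sigLevel l j ∈ p) {x : TensorAlgebra ℝ V} (hx : IsLevel j x) : x ∈ p := by
  have h : ∀ w : List V, ∀ (p : Submodule ℝ (TensorAlgebra ℝ V)),
      (∀ l : List V, sigLevel l w.length ∈ p) → (w.map (TensorAlgebra.ι ℝ)).prod ∈ p := by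
    intro w
    induction w with
    | nil => intro p hp; simpa using hp []
    | cons v w ih =>
      intro p hp
      rw [List.map_cons, List.prod_cons]
      -- The induction hypothesis is used for the preimage of p under left multiplication by v;
      -- hence the quantification over p.
      have h := ih (p.comap (LinearMap.mulLeft ℝ (TensorAlgebra.ι ℝ v))) fun l => by
        rw [Submodule.mem_comap, LinearMap.mulLeft_apply]
        set m := w.length
        -- Level m + 1 of the signature of (c v) :: l is a polynomial in c of degree at most m + 1,
        -- with coefficient v ⊗ `sigLevel l m` at c. The values at m + 2 integers c recover that
        -- coefficient as a combination of elements of p.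
        obtain ⟨a, ha⟩ := exists_vandermonde_weights (m + 2)
        have h2 := ha (TensorAlgebra ℝ V) (fun i => if i ≤ m + 1 then
          (((i.factorial : ℝ)⁻¹) • TensorAlgebra.ι ℝ v ^ i) * sigLevel l (m + 1 - i) else 0)
          1 (by omega)
        rw [if_pos (by omega)] at h2
        simp only [Nat.factorial_one, Nat.cast_one, inv_one, one_smul, pow_one,
          Nat.add_sub_cancel] at h2
        rw [← h2]
        refine p.sum_mem fun c _ => p.smul_mem _ ?_
        have h3 := hp (((c : ℝ) • v) :: l)
        rw [sigLevel_cons, List.length_cons,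
          Finset.Nat.sum_antidiagonal_eq_sum_range_succ_mk] at h3
        convert h3 using 1
        refine Finset.sum_congr rfl fun i hi => ?_
        have := Finset.mem_range.1 hi
        rw [if_pos (by omega), map_smul, smul_pow]
        simp only [smul_mul_assoc, smul_smul]
        rw [mul_comm]
      exact h
  obtain ⟨η, rfl⟩ := hx
  induction η using PiTensorProduct.induction_on with
  | smul_tprod r v =>
    rw [map_smul, TensorPower.toTensorAlgebra_tprod, TensorAlgebra.tprod_apply]
    refine p.smul_mem _ ?_
    have h2 := h (List.ofFn v) p (by simpa using hp)
    rw [List.map_ofFn] at h2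
    exact h2
  | add x y hx hy => rw [map_add]; exact p.add_mem hx hy

end Levels

/-! ### Signatures are group-like; reduced coproducts -/

section GroupLike

variable {V : Type*} [NormedAddCommGroup V] [NormedSpace ℝ V]

theorem commute_map_includeRight_map_includeLeft (φ ψ : PowerSeries (TensorAlgebra ℝ V)) :
    Commute
      (PowerSeries.map (Algebra.TensorProduct.includeRight (R := ℝ) (A := TensorAlgebra ℝ V)
        (B := TensorAlgebra ℝ V)).toRingHom φ)
      (PowerSeries.map (Algebra.TensorProduct.includeLeft (R := ℝ) (S := ℝ)
        (A := TensorAlgebra ℝ V) (B := TensorAlgebra ℝ V)).toRingHom ψ) := by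
  refine PowerSeries.ext fun i => ?_
  rw [PowerSeries.coeff_mul, PowerSeries.coeff_mul,
    ← Finset.Nat.sum_antidiagonal_swap]
  refine Finset.sum_congr rfl fun q _ => ?_
  simp

/-- The two summands v ⊗ 1 and 1 ⊗ v of the coproduct of v commute, so the binomial theorem splits
the exponential of the sum into a product of exponentials. -/
theorem map_coproduct_expSeries (v : V) :
    PowerSeries.map (coproduct V).toRingHom (expSeries v) =
      PowerSeries.map (Algebra.TensorProduct.includeLeft (R := ℝ) (S := ℝ)
        (A := TensorAlgebra ℝ V) (B := TensorAlgebra ℝ V)).toRingHom (expSeries v) *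
      PowerSeries.map (Algebra.TensorProduct.includeRight (R := ℝ) (A := TensorAlgebra ℝ V)
        (B := TensorAlgebra ℝ V)).toRingHom (expSeries v) := by
  refine PowerSeries.ext fun i => ?_
  rw [PowerSeries.coeff_mul]
  simp only [PowerSeries.coeff_map, expSeries, PowerSeries.coeff_mk, AlgHom.toRingHom_eq_coe,
    RingHom.coe_coe, map_smul, map_pow]
  have h1 : coproduct V (TensorAlgebra.ι ℝ v) =
      TensorAlgebra.ι ℝ v ⊗ₜ[ℝ] 1 + 1 ⊗ₜ[ℝ] TensorAlgebra.ι ℝ v := by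
    simp [coproduct]
  have hc : Commute (TensorAlgebra.ι ℝ v ⊗ₜ[ℝ] (1 : TensorAlgebra ℝ V))
      ((1 : TensorAlgebra ℝ V) ⊗ₜ[ℝ] TensorAlgebra.ι ℝ v) := by
    simp [Commute, SemiconjBy]
  rw [h1, hc.add_pow', Finset.smul_sum]
  refine Finset.sum_congr rfl fun q hq => ?_
  have hq' := Finset.HasAntidiagonal.mem_antidiagonal.1 hq
  rw [Algebra.TensorProduct.includeLeft_apply, Algebra.TensorProduct.includeRight_apply,
    smul_mul_smul_comm, ← Nat.cast_smul_eq_nsmul ℝ, smul_smul]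
  congr 1
  have h2 : (i.choose q.1 : ℝ) * (q.1.factorial * q.2.factorial) = i.factorial := by
    rw [← hq', ← mul_assoc, Nat.choose_symm_add]
    exact_mod_cast Nat.add_choose_mul_factorial_mul_factorial q.1 q.2
  have : (i.factorial : ℝ) ≠ 0 := by positivity
  rw [← h2]
  field_simp
  rw [div_self]
  exact_mod_cast (Nat.choose_pos (by omega)).ne'

theorem map_coproduct_sigSeries (l : List V) :
    PowerSeries.map (coproduct V).toRingHom (sigSeries l) =
      PowerSeries.map (Algebra.TensorProduct.includeLeft (R := ℝ) (S := ℝ)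
        (A := TensorAlgebra ℝ V) (B := TensorAlgebra ℝ V)).toRingHom (sigSeries l) *
      PowerSeries.map (Algebra.TensorProduct.includeRight (R := ℝ) (A := TensorAlgebra ℝ V)
        (B := TensorAlgebra ℝ V)).toRingHom (sigSeries l) := by
  induction l with
  | nil => simp [sigSeries]
  | cons v l ih =>
    have e : sigSeries (v :: l) = expSeries v * sigSeries l := by simp [sigSeries]
    rw [e, map_mul, map_mul, map_mul, ih, map_coproduct_expSeries]
    have h := commute_map_includeRight_map_includeLeft (expSeries v) (sigSeries l)
    simp only [mul_assoc]
    congr 1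
    rw [← mul_assoc, ← mul_assoc, h.eq]

theorem coproduct_sigLevel (l : List V) (i : ℕ) :
    coproduct V (sigLevel l i) = ∑ q ∈ Finset.HasAntidiagonal.antidiagonal i,
      sigLevel l q.1 ⊗ₜ[ℝ] sigLevel l q.2 := by
  have h := congrArg (PowerSeries.coeff i) (map_coproduct_sigSeries l)
  rw [PowerSeries.coeff_map, PowerSeries.coeff_mul] at h
  refine h.trans (Finset.sum_congr rfl fun q _ => ?_)
  simp [sigLevel, PowerSeries.coeff_map]

/-- With no output factor the iterated coproduct is the counit: it sends every vector to the empty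
sum, so it annihilates nonempty words. -/
theorem iterCoproduct_zero_of_isLevel {i : ℕ} (hi : 0 < i) {x : TensorAlgebra ℝ V}
    (hx : IsLevel i x) : iterCoproduct V 0 x = 0 := by
  obtain ⟨η, rfl⟩ := hx
  induction η using PiTensorProduct.induction_on with
  | smul_tprod r v =>
    rw [map_smul, map_smul, TensorPower.toTensorAlgebra_tprod, TensorAlgebra.tprod_apply,
      map_list_prod, List.prod_eq_zero, smul_zero]
    rw [List.mem_map]
    refine ⟨TensorAlgebra.ι ℝ (v ⟨0, hi⟩), ?_, by simp [iterCoproduct]⟩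
    exact (List.mem_ofFn' _ _).2 ⟨⟨0, hi⟩, rfl⟩
  | add x y hx hy => rw [map_add, map_add, hx, hy, add_zero]

theorem sum_piFinset_succ {M : Type*} [AddCommMonoid M] (m N : ℕ) (f : (Fin (m + 1) → ℕ) → M) :
    ∑ α ∈ Fintype.piFinset fun _ : Fin (m + 1) => Finset.range N, f α =
      ∑ α ∈ Fintype.piFinset fun _ : Fin m => Finset.range N, ∑ a ∈ Finset.range N,
        f (Fin.cons a α) := by
  rw [← Finset.sum_product']
  refine Finset.sum_bij' (fun α _ => (Fin.tail α, α 0)) (fun q _ => Fin.cons q.2 q.1) ?_ ?_ ?_ ?_ ?_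
  · intro α hα
    rw [Fintype.mem_piFinset] at hα
    exact Finset.mem_product.2 ⟨Fintype.mem_piFinset.2 fun i => hα i.succ, hα 0⟩
  · intro q hq
    obtain ⟨h1, h2⟩ := Finset.mem_product.1 hq
    rw [Fintype.mem_piFinset] at h1 ⊢
    intro i
    refine Fin.cases ?_ (fun i => ?_) i
    · simpa using h2
    · simpa using h1 i
  · intro α _; exact Fin.cons_self_tail α
  · intro q _; simp
  · intro α _; simp

/-- Signatures are group-like. -/
theorem iterCoproduct_sigLevel (l : List V) {N : ℕ} (m : ℕ) {i : ℕ} (hi : i < N) :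
    iterCoproduct V m (sigLevel l i) =
      ∑ α ∈ Fintype.piFinset fun _ : Fin m => Finset.range N,
        if ∑ k, α k = i then PiTensorProduct.tprod ℝ fun k => sigLevel l (α k) else 0 := by
  induction m generalizing i with
  | zero =>
    rcases Nat.eq_zero_or_pos i with rfl | hi0
    · rw [sigLevel_zero, map_one, PiTensorProduct.one_def]
      simp only [Finset.univ_eq_empty, Finset.sum_empty, if_true]
      rw [Fintype.piFinset_of_isEmpty, Finset.univ_unique, Finset.sum_singleton]
      congr 1
      ext k
      exact k.elim0
    · rw [iterCoproduct_zero_of_isLevel hi0 (isLevel_sigLevel l i), Finset.sum_eq_zero]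
      intro α _
      rw [if_neg]
      simpa using hi0.ne
  | succ m ih =>
    rw [← cons_coproduct, coproduct_sigLevel, map_sum, map_sum, sum_piFinset_succ]
    have h1 : ∀ q ∈ Finset.HasAntidiagonal.antidiagonal i,
        consTensor (TensorAlgebra ℝ V) m (TensorProduct.map LinearMap.id
          (iterCoproduct V m).toLinearMap (sigLevel l q.1 ⊗ₜ[ℝ] sigLevel l q.2)) =
        ∑ α ∈ Fintype.piFinset fun _ : Fin m => Finset.range N, if ∑ k, α k = q.2 then
          PiTensorProduct.tprod ℝ (fun k : Fin (m + 1) =>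
            sigLevel l ((Fin.cons q.1 α : Fin (m + 1) → ℕ) k)) else 0 := by
      intro q hq
      have hq' := Finset.HasAntidiagonal.mem_antidiagonal.1 hq
      rw [TensorProduct.map_tmul, LinearMap.id_apply, AlgHom.toLinearMap_apply,
        ih (show q.2 < N by omega), TensorProduct.tmul_sum, map_sum]
      refine Finset.sum_congr rfl fun α _ => ?_
      split_ifs
      · rw [consTensor_tmul_tprod]
        congr 1
        ext k
        refine Fin.cases ?_ (fun k => ?_) k <;> simp
      · rw [TensorProduct.tmul_zero, map_zero]
    rw [Finset.sum_congr rfl h1, Finset.sum_comm]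
    refine Finset.sum_congr rfl fun α _ => ?_
    simp only [Fin.sum_univ_succ, Fin.cons_zero, Fin.cons_succ]
    -- For a fixed tail α each side has at most one nonzero term, with first entry i - ∑ α; there is
    -- none when ∑ α exceeds i.
    by_cases hs : ∑ k, α k ≤ i
    · rw [Finset.sum_eq_single (i - ∑ k, α k, ∑ k, α k),
        Finset.sum_eq_single_of_mem (i - ∑ k, α k) (Finset.mem_range.2 (by omega)),
        if_pos rfl, if_pos (by omega)]
      · intro a _ ha
        rw [if_neg (by omega)]
      · rintro ⟨a, b⟩ hq hne
        have hq' := Finset.HasAntidiagonal.mem_antidiagonal.1 hq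
        rw [if_neg]
        rintro rfl
        refine hne (Prod.ext ?_ rfl)
        simp only at hq' ⊢
        omega
      · intro h
        exact absurd (Finset.HasAntidiagonal.mem_antidiagonal.2 (by simp only; omega)) h
    · rw [Finset.sum_eq_zero, Finset.sum_eq_zero]
      · intro a _
        rw [if_neg (by omega)]
      · rintro ⟨a, b⟩ hq
        have hq' := Finset.HasAntidiagonal.mem_antidiagonal.1 hq
        simp only at hq' ⊢
        rw [if_neg (by omega)]

/-- The image of the `i`-th level of a signature in `T^{<n}(V)`. -/
def sigTrunc (n : ℕ) (l : List V) (i : ℕ) : Trunc V n := toTrunc V n (sigLevel l i)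

theorem sigTrunc_zero (n : ℕ) (l : List V) : sigTrunc n l 0 = unit V n := by
  rw [sigTrunc, sigLevel_zero, unit]

theorem coe_sigTrunc {n i : ℕ} (hi : i < n) (l : List V) :
    (sigTrunc n l i : TensorAlgebra ℝ V) = sigLevel l i :=
  (isLevel_sigLevel l i).truncate_self hi

theorem tprod_eq_zero_of_apply {A : Type*} [AddCommGroup A] [Module ℝ A] {m : ℕ} {f : Fin m → A}
    (k : Fin m) (h : f k = 0) : PiTensorProduct.tprod ℝ f = 0 :=
  MultilinearMap.map_coord_zero _ k h

theorem reducedCoproduct_sigTrunc {n j : ℕ} (hj : j < n) (m : ℕ) (l : List V) :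
    reducedCoproduct n m (sigTrunc n l j) =
      ∑ α ∈ Fintype.piFinset fun _ : Fin m => Finset.range n, if ∑ k, α k = j then
        PiTensorProduct.tprod ℝ (fun k => if α k = 0 then 0 else sigTrunc n l (α k)) else 0 := by
  simp only [reducedCoproduct, LinearMap.comp_apply, Submodule.subtype_apply, coe_sigTrunc hj,
    AlgHom.toLinearMap_apply]
  rw [iterCoproduct_sigLevel l m hj, map_sum]
  refine Finset.sum_congr rfl fun α _ => ?_
  split_ifs
  · rw [PiTensorProduct.map_tprod]
    congr 1
    ext1 k
    simp only [LinearMap.comp_apply, positivePart, LinearMap.sub_apply, LinearMap.id_apply]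
    split_ifs with h
    · rw [h, (isLevel_sigLevel l 0).proj_self, sub_self, map_zero]
    · rw [(isLevel_sigLevel l _).proj_eq_zero h, sub_zero, sigTrunc]
  · rw [map_zero]

/-- A positive level j is not a sum of m levels that are all at least 1 if m = 0 or m > j. This is
checked on signatures and extended by `mem_of_sigLevel_mem`. It is why the sums in the one-sided
formulas may stop at n - 1 and r - 1. -/
theorem reducedCoproduct_incl_eq_zero {n j m : ℕ} (hj : 0 < j) (hjn : j < n)
    (hm : m = 0 ∨ j < m) (ξ : ⨂[ℝ]^j V) : reducedCoproduct n m (incl V n j ξ) = 0 := by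
  have hsig : ∀ l : List V, reducedCoproduct n m (sigTrunc n l j) = 0 := by
    intro l
    rw [reducedCoproduct_sigTrunc hjn]
    refine Finset.sum_eq_zero fun α _ => ?_
    split_ifs with hα
    · obtain ⟨k, hk⟩ : ∃ k, α k = 0 := by
        by_contra! hne
        have h1 : ∑ _k : Fin m, 1 ≤ ∑ k, α k :=
          Finset.sum_le_sum fun k _ => Nat.one_le_iff_ne_zero.2 (hne k)
        rcases hm with rfl | hm
        · simp at hα; omega
        · simp at h1; omega
      exact tprod_eq_zero_of_apply k (if_pos hk)
    · rfl
  have h := mem_of_sigLevel_mem (p := LinearMap.ker (reducedCoproduct n m ∘ₗ toTrunc V n))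
    (fun l => LinearMap.mem_ker.2 (hsig l)) (x := TensorPower.toTensorAlgebra ξ) ⟨ξ, rfl⟩
  exact LinearMap.mem_ker.1 h

theorem exists_incl_zero_eq_smul_unit (n : ℕ) (ξ : ⨂[ℝ]^0 V) :
    ∃ x : ℝ, incl V n 0 ξ = x • unit V n := by
  induction ξ using PiTensorProduct.induction_on with
  | smul_tprod r v =>
    refine ⟨r, ?_⟩
    rw [map_smul, incl, LinearMap.comp_apply, TensorPower.toTensorAlgebra_tprod,
      TensorAlgebra.tprod_apply, unit]
    simp
  | add x y hx hy =>
    obtain ⟨a, ha⟩ := hx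
    obtain ⟨b, hb⟩ := hy
    exact ⟨a + b, by rw [map_add, ha, hb, add_smul]⟩

end GroupLike

/-! ### The composition: existence, uniqueness, and its values on signatures -/

section Composition

variable {V W F S : Type*} [NormedAddCommGroup V] [NormedSpace ℝ V]
  [NormedAddCommGroup W] [NormedSpace ℝ W] [NormedAddCommGroup F] [NormedSpace ℝ F]
  [NormedAddCommGroup S] [NormedSpace ℝ S] {n r : ℕ}

theorem reducedCoproduct₂_sigTrunc {j k : ℕ} (hj : j < n) (hk : k < r) (L : ℕ) (l : List V)
    (l' : List W) :
    reducedCoproduct₂ n r L (sigTrunc n l j ⊗ₜ[ℝ] sigTrunc r l' k) =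
      ∑ α ∈ Fintype.piFinset fun _ : Fin L => Finset.range n,
        ∑ β ∈ Fintype.piFinset fun _ : Fin L => Finset.range r,
          if ∑ m, α m = j ∧ ∑ m, β m = k then
            PiTensorProduct.tprod ℝ (fun m => if α m = 0 ∧ β m = 0 then 0 else
              sigTrunc n l (α m) ⊗ₜ[ℝ] sigTrunc r l' (β m)) else 0 := by
  simp only [reducedCoproduct₂, iterCoproduct₂, LinearMap.comp_apply, TensorProduct.map_tmul,
    Submodule.subtype_apply, coe_sigTrunc hj, coe_sigTrunc hk, AlgHom.toLinearMap_apply]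
  rw [iterCoproduct_sigLevel l L hj, iterCoproduct_sigLevel l' L hk, TensorProduct.lift.tmul]
  simp only [map_sum, LinearMap.sum_apply]
  rw [Finset.sum_comm]
  refine Finset.sum_congr rfl fun α _ => ?_
  refine Finset.sum_congr rfl fun β _ => ?_
  by_cases hα : ∑ m, α m = j
  · by_cases hβ : ∑ m, β m = k
    · rw [if_pos hα, if_pos hβ, if_pos ⟨hα, hβ⟩, PiTensorProduct.map₂_tprod_tprod,
        PiTensorProduct.map_tprod]
      congr 1
      ext1 m
      simp only [LinearMap.comp_apply, LinearMap.sub_apply, LinearMap.id_apply,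
        TensorProduct.mk_apply, TensorProduct.map_tmul, map_sub]
      split_ifs with h
      · rw [h.1, h.2, (isLevel_sigLevel l 0).proj_self, (isLevel_sigLevel l' 0).proj_self, sub_self]
      · have h0 : proj V 0 (sigLevel l (α m)) ⊗ₜ[ℝ] proj W 0 (sigLevel l' (β m)) = 0 := by
          rcases not_and_or.1 h with h | h
          · rw [(isLevel_sigLevel l _).proj_eq_zero h, TensorProduct.zero_tmul]
          · rw [(isLevel_sigLevel l' _).proj_eq_zero h, TensorProduct.tmul_zero]
        have h1 : toTrunc V n (proj V 0 (sigLevel l (α m))) ⊗ₜ[ℝ]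
            toTrunc W r (proj W 0 (sigLevel l' (β m))) = 0 := by
          rw [← TensorProduct.map_tmul, h0, map_zero]
        rw [h1, sub_zero, sigTrunc, sigTrunc]
    · simp [hβ]
  · simp [hα]

/-- The composition of an element of `Hom(T^{<n}(V) ⊠ T^{<r}(W), F)` with `g`. -/
def compMap (g : F → S) (z : Trunc V n ⊗[ℝ] Trunc W r →ₗ[ℝ] F) :
    Trunc V n ⊗[ℝ] Trunc W r →ₗ[ℝ] S :=
  ∑ l ∈ Finset.range (n + r - 1), ((l.factorial : ℝ)⁻¹) •
    (derivTensor g l (trace z) z ∘ₗ reducedCoproduct₂ n r l)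

theorem compMap_apply (g : F → S) (z : Trunc V n ⊗[ℝ] Trunc W r →ₗ[ℝ] F)
    (x : Trunc V n ⊗[ℝ] Trunc W r) :
    compMap g z x = ∑ l ∈ Finset.range (n + r - 1), ((l.factorial : ℝ)⁻¹) •
      derivTensor g l (trace z) z (reducedCoproduct₂ n r l x) := by
  simp [compMap, LinearMap.sum_apply]

/-- The coefficients of the polynomial `z (S_x(l) ⊠ S_y(l'))` in the scaling parameters. -/
def sigCoeff (z : Trunc V n ⊗[ℝ] Trunc W r →ₗ[ℝ] F) (l : List V) (l' : List W) (i k : ℕ) : F :=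
  z (sigTrunc n l i ⊗ₜ[ℝ] sigTrunc r l' k)

/-- The signature, in `T^{<n}(V)`. -/
def sigSum (n : ℕ) (l : List V) : Trunc V n := ∑ i ∈ Finset.range n, sigTrunc n l i

theorem derivTensor_tprod {E : Type*} [AddCommMonoid E] [Module ℝ E] (g : F → S) (m : ℕ) (x : F)
    (A : E →ₗ[ℝ] F) (f : Fin m → E) :
    derivTensor g m x A (PiTensorProduct.tprod ℝ f) = iteratedFDeriv ℝ m g x fun k => A (f k) := by
  simp [derivTensor, PiTensorProduct.map_tprod]

theorem trace_eq_sigCoeff (z : Trunc V n ⊗[ℝ] Trunc W r →ₗ[ℝ] F) (l : List V) (l' : List W) :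
    trace z = sigCoeff z l l' 0 0 := by
  rw [trace, sigCoeff, sigTrunc_zero, sigTrunc_zero]

theorem compMap_sigTrunc (g : F → S) (z : Trunc V n ⊗[ℝ] Trunc W r →ₗ[ℝ] F) (l : List V)
    (l' : List W) {j k : ℕ} (hj : j < n) (hk : k < r) :
    compMap g z (sigTrunc n l j ⊗ₜ[ℝ] sigTrunc r l' k) =
      ∑ L ∈ Finset.range (n + r - 1), ((L.factorial : ℝ)⁻¹) •
        ∑ α ∈ Fintype.piFinset fun _ : Fin L => Finset.range n,
          ∑ β ∈ Fintype.piFinset fun _ : Fin L => Finset.range r,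
            if ∑ m, α m = j ∧ ∑ m, β m = k then
              iteratedFDeriv ℝ L g (sigCoeff z l l' 0 0) fun m =>
                dropConst (sigCoeff z l l') (α m) (β m) else 0 := by
  rw [compMap_apply]
  refine Finset.sum_congr rfl fun L _ => ?_
  rw [reducedCoproduct₂_sigTrunc hj hk, map_sum]
  congr 1
  refine Finset.sum_congr rfl fun α _ => ?_
  rw [map_sum]
  refine Finset.sum_congr rfl fun β _ => ?_
  split_ifs
  · rw [derivTensor_tprod, trace_eq_sigCoeff z l l']
    congr 1
    ext1 m
    simp only [dropConst]
    split_ifs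
    · rw [map_zero]
    · rfl
  · rw [map_zero]

/-- On signatures, the composition is the Taylor polynomial of `g ∘ P`. -/
theorem compMap_sigSum [CompleteSpace S] {g : F → S} (hg : ContDiff ℝ (⊤ : ℕ∞) g) (hn : 0 < n)
    (hr : 0 < r) (z : Trunc V n ⊗[ℝ] Trunc W r →ₗ[ℝ] F) (l : List V) (l' : List W) :
    compMap g z (sigSum n l ⊗ₜ[ℝ] sigSum r l') =
      taylorSum₂ n r fun p => g (polyEval n r (sigCoeff z l l') p) := by
  rw [taylorSum₂_comp_polyEval_eq_sum hg hn hr, sigSum, sigSum, TensorProduct.sum_tmul, map_sum]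
  have h : ∀ j ∈ Finset.range n,
      compMap g z (sigTrunc n l j ⊗ₜ[ℝ] ∑ k ∈ Finset.range r, sigTrunc r l' k) =
      ∑ L ∈ Finset.range (n + r - 1), ((L.factorial : ℝ)⁻¹) •
        ∑ α ∈ Fintype.piFinset fun _ : Fin L => Finset.range n,
          ∑ β ∈ Fintype.piFinset fun _ : Fin L => Finset.range r,
            ∑ k ∈ Finset.range r, if ∑ m, α m = j ∧ ∑ m, β m = k then
              iteratedFDeriv ℝ L g (sigCoeff z l l' 0 0) fun m =>
                dropConst (sigCoeff z l l') (α m) (β m) else 0 := by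
    intro j hj
    rw [TensorProduct.tmul_sum, map_sum, Finset.sum_congr rfl fun k hk =>
      compMap_sigTrunc g z l l' (Finset.mem_range.1 hj) (Finset.mem_range.1 hk), Finset.sum_comm]
    refine Finset.sum_congr rfl fun L _ => ?_
    rw [← Finset.smul_sum, Finset.sum_comm]
    congr 1
    exact Finset.sum_congr rfl fun α _ => Finset.sum_comm
  rw [Finset.sum_congr rfl h, Finset.sum_comm]
  refine Finset.sum_congr rfl fun L _ => ?_
  rw [← Finset.smul_sum, Finset.sum_comm]
  congr 1
  refine Finset.sum_congr rfl fun α _ => ?_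
  rw [Finset.sum_comm]
  refine Finset.sum_congr rfl fun β _ => ?_
  -- Summing over j < n and k < r turns the constraints ∑ α = j and ∑ β = k into ∑ α < n and ∑ β <
  -- r, which is the truncation in the Taylor formula.
  by_cases hα : ∑ m, α m < n
  · rw [Finset.sum_eq_single_of_mem _ (Finset.mem_range.2 hα)]
    · by_cases hβ : ∑ m, β m < r
      · rw [Finset.sum_eq_single_of_mem _ (Finset.mem_range.2 hβ), if_pos ⟨rfl, rfl⟩,
          if_pos ⟨hα, hβ⟩]
        intro k _ hk
        rw [if_neg fun h => hk h.2.symm]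
      · rw [if_neg fun h => hβ h.2, Finset.sum_eq_zero]
        intro k hk
        rw [if_neg]
        rintro ⟨-, h⟩
        exact hβ (h ▸ Finset.mem_range.1 hk)
    · intro j _ hj
      refine Finset.sum_eq_zero fun k _ => ?_
      rw [if_neg fun h => hj h.1.symm]
  · rw [if_neg fun h => hα h.1, Finset.sum_eq_zero]
    intro j hj
    refine Finset.sum_eq_zero fun k _ => ?_
    rw [if_neg]
    rintro ⟨h, -⟩
    exact hα (h ▸ Finset.mem_range.1 hj)

theorem toTrunc_one : toTrunc V n 1 = unit V n := rfl

theorem coe_unit (hn : 0 < n) : (unit V n : TensorAlgebra ℝ V) = 1 :=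
  isLevel_one.truncate_self hn

/-- The coproduct of the unit is 1 ⊗ ⋯ ⊗ 1. Every factor then has degree 0 in W, and discarding
bidegree (0, 0) amounts to discarding level 0 in V. -/
theorem reducedCoproduct₂_tmul_unit (hr : 0 < r) (L : ℕ) (x : Trunc V n) :
    reducedCoproduct₂ n r L (x ⊗ₜ[ℝ] unit W r) =
      PiTensorProduct.map (fun _ => (TensorProduct.mk ℝ (Trunc V n) (Trunc W r)).flip (unit W r))
        (reducedCoproduct n L x) := by
  simp only [reducedCoproduct₂, iterCoproduct₂, reducedCoproduct, LinearMap.comp_apply,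
    TensorProduct.map_tmul, Submodule.subtype_apply, coe_unit hr, AlgHom.toLinearMap_apply, map_one,
    TensorProduct.lift.tmul, PiTensorProduct.one_def]
  induction iterCoproduct V L (x : TensorAlgebra ℝ V) using PiTensorProduct.induction_on with
  | smul_tprod c f =>
    simp only [map_smul, LinearMap.smul_apply, PiTensorProduct.map₂_tprod_tprod,
      PiTensorProduct.map_tprod]
    congr 2
    ext1 m
    simp [positivePart, isLevel_one.proj_self, toTrunc_one]
  | add x y hx hy => simp only [map_add, LinearMap.add_apply, hx, hy]

theorem reducedCoproduct₂_unit_tmul (hn : 0 < n) (L : ℕ) (y : Trunc W r) :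
    reducedCoproduct₂ n r L (unit V n ⊗ₜ[ℝ] y) =
      PiTensorProduct.map (fun _ => TensorProduct.mk ℝ (Trunc V n) (Trunc W r) (unit V n))
        (reducedCoproduct r L y) := by
  simp only [reducedCoproduct₂, iterCoproduct₂, reducedCoproduct, LinearMap.comp_apply,
    TensorProduct.map_tmul, Submodule.subtype_apply, coe_unit hn, AlgHom.toLinearMap_apply, map_one,
    TensorProduct.lift.tmul, PiTensorProduct.one_def]
  induction iterCoproduct W L (y : TensorAlgebra ℝ W) using PiTensorProduct.induction_on with
  | smul_tprod c f =>
    simp only [map_smul, PiTensorProduct.map₂_tprod_tprod, PiTensorProduct.map_tprod]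
    congr 2
    ext1 m
    simp [positivePart, isLevel_one.proj_self, TensorProduct.tmul_sub, toTrunc_one]
  | add x y hx hy => simp only [map_add, hx, hy]

theorem derivTensor_map {E E' : Type*} [AddCommMonoid E] [Module ℝ E] [AddCommMonoid E']
    [Module ℝ E'] (g : F → S) (m : ℕ) (x : F) (A : E →ₗ[ℝ] F) (B : E' →ₗ[ℝ] E)
    (y : ⨂[ℝ] _ : Fin m, E') :
    derivTensor g m x A (PiTensorProduct.map (fun _ => B) y) = derivTensor g m x (A ∘ₗ B) y := by
  rw [derivTensor, derivTensor, PiTensorProduct.map_comp]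
  rfl

theorem reducedCoproduct_unit {L : ℕ} (hn : 0 < n) (hL : 0 < L) :
    reducedCoproduct n L (unit V n) = 0 := by
  rw [reducedCoproduct, LinearMap.comp_apply, LinearMap.comp_apply, Submodule.subtype_apply,
    coe_unit hn, AlgHom.toLinearMap_apply, map_one, PiTensorProduct.one_def,
    PiTensorProduct.map_tprod]
  exact tprod_eq_zero_of_apply ⟨0, hL⟩ (by simp [positivePart, isLevel_one.proj_self])

theorem reducedCoproduct_zero_unit (hn : 0 < n) :
    reducedCoproduct n 0 (unit V n) = PiTensorProduct.tprod ℝ (fun k : Fin 0 => k.elim0) := by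
  rw [reducedCoproduct, LinearMap.comp_apply, LinearMap.comp_apply, Submodule.subtype_apply,
    coe_unit hn, AlgHom.toLinearMap_apply, map_one, PiTensorProduct.one_def,
    PiTensorProduct.map_tprod]
  congr 1
  exact Subsingleton.elim _ _

theorem reducedCoproduct₂_zero_incl {j : ℕ} (hj : 0 < j) (hjn : j < n) (ξ : ⨂[ℝ]^j V)
    (y : Trunc W r) : reducedCoproduct₂ n r 0 (incl V n j ξ ⊗ₜ[ℝ] y) = 0 := by
  have hξ : IsLevel j (TensorPower.toTensorAlgebra ξ : TensorAlgebra ℝ V) := ⟨ξ, rfl⟩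
  have h : (incl V n j ξ : TensorAlgebra ℝ V) = TensorPower.toTensorAlgebra ξ :=
    hξ.truncate_self hjn
  simp only [reducedCoproduct₂, iterCoproduct₂, LinearMap.comp_apply, TensorProduct.map_tmul,
    Submodule.subtype_apply, h, AlgHom.toLinearMap_apply, iterCoproduct_zero_of_isLevel hj hξ,
    TensorProduct.zero_tmul, map_zero]

theorem sum_range_eq_sum_Icc {M : Type*} [AddCommMonoid M] {a b : ℕ} (hab : a ≤ b) {f : ℕ → M}
    (h0 : f 0 = 0) (hf : ∀ l, a ≤ l → l ≠ 0 → f l = 0) :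
    ∑ l ∈ Finset.range b, f l = ∑ l ∈ Finset.Icc 1 (a - 1), f l := by
  symm
  refine Finset.sum_subset (fun l hl => ?_) fun l hl hl' => ?_
  · have := Finset.mem_Icc.1 hl
    exact Finset.mem_range.2 (by omega)
  · rw [Finset.mem_Icc] at hl'
    rcases Nat.eq_zero_or_pos l with rfl | h
    · exact h0
    · exact hf l (by omega) h.ne'

variable {a b c d : ℝ}

/-- One formula serves all four cases. On 𝟏 ⊠ 𝟏 only l = 0 contributes. If exactly one level is 0,
the reduced coproduct becomes one-sided and the terms l = 0 and l ≥ n (or l ≥ r) vanish by counting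
levels. In the mixed case only l = 0 has to be dropped. -/
theorem isComposition_compMap (hn : 0 < n) (hr : 0 < r) (g : F → S)
    (Z : Set.Icc a b → Set.Icc c d → (Trunc V n ⊗[ℝ] Trunc W r →ₗ[ℝ] F)) :
    IsComposition g Z fun t v => compMap g (Z t v) where
  trace_eq t v x y := by
    rw [TensorProduct.smul_tmul_smul, map_smul, compMap_apply,
      Finset.sum_eq_single_of_mem 0 (Finset.mem_range.2 (by omega))]
    · rw [reducedCoproduct₂_tmul_unit hr, reducedCoproduct_zero_unit hn, derivTensor_map,
        derivTensor_tprod]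
      simp
    · intro l _ hl
      rw [reducedCoproduct₂_tmul_unit hr, reducedCoproduct_unit hn (Nat.pos_of_ne_zero hl),
        map_zero, map_zero, smul_zero]
  left_eq t v j hj hjn ξ y := by
    rw [TensorProduct.tmul_smul, map_smul, compMap_apply]
    simp only [reducedCoproduct₂_tmul_unit hr, derivTensor_map]
    rw [sum_range_eq_sum_Icc (a := n) (by omega)]
    · rw [reducedCoproduct_incl_eq_zero hj hjn (Or.inl rfl), map_zero, smul_zero]
    · intro l hl _
      rw [reducedCoproduct_incl_eq_zero hj hjn (Or.inr (by omega)), map_zero, smul_zero]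
  right_eq t v k hk hkr x η := by
    rw [← TensorProduct.smul_tmul', map_smul, compMap_apply]
    simp only [reducedCoproduct₂_unit_tmul hn, derivTensor_map]
    rw [sum_range_eq_sum_Icc (a := r) (by omega)]
    · rw [reducedCoproduct_incl_eq_zero hk hkr (Or.inl rfl), map_zero, smul_zero]
    · intro l hl _
      rw [reducedCoproduct_incl_eq_zero hk hkr (Or.inr (by omega)), map_zero, smul_zero]
  mixed_eq t v j hj hjn k hk hkr ξ η := by
    rw [compMap_apply]
    symm
    refine Finset.sum_subset (fun l hl => ?_) fun l hl hl' => ?_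
    · have := Finset.mem_Icc.1 hl
      exact Finset.mem_range.2 (by omega)
    · rw [Finset.mem_Icc] at hl'
      have := Finset.mem_range.1 hl
      obtain rfl : l = 0 := by omega
      rw [reducedCoproduct₂_zero_incl hj hjn, map_zero, smul_zero]

theorem linearMap_ext_incl {z z' : Trunc V n ⊗[ℝ] Trunc W r →ₗ[ℝ] S}
    (h : ∀ j < n, ∀ k < r, ∀ (ξ : ⨂[ℝ]^j V) (η : ⨂[ℝ]^k W),
      z (incl V n j ξ ⊗ₜ[ℝ] incl W r k η) = z' (incl V n j ξ ⊗ₜ[ℝ] incl W r k η)) : z = z' := by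
  refine TensorProduct.ext' fun x y => ?_
  rw [← sum_incl_coord x, ← sum_incl_coord y]
  simp only [TensorProduct.sum_tmul, TensorProduct.tmul_sum, map_sum]
  exact Finset.sum_congr rfl fun j hj => Finset.sum_congr rfl fun k hk =>
    h k (Finset.mem_range.1 hk) j (Finset.mem_range.1 hj) _ _

/-- The four formulas together prescribe the map on every bidegree, and the bidegrees span; level 0
is reached through multiples of the unit. -/
theorem isComposition_iff (hn : 0 < n) (hr : 0 < r) (g : F → S)
    (Z : Set.Icc a b → Set.Icc c d → (Trunc V n ⊗[ℝ] Trunc W r →ₗ[ℝ] F))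
    (G' : Set.Icc a b → Set.Icc c d → (Trunc V n ⊗[ℝ] Trunc W r →ₗ[ℝ] S)) :
    IsComposition g Z G' ↔ G' = fun t v => compMap g (Z t v) := by
  have hG := isComposition_compMap hn hr g Z
  refine ⟨fun h => ?_, fun h => h ▸ hG⟩
  funext t v
  refine linearMap_ext_incl fun j hj k hk ξ η => ?_
  rcases Nat.eq_zero_or_pos j with rfl | hj0
  · obtain ⟨x, hx⟩ := exists_incl_zero_eq_smul_unit n ξ
    rw [hx]
    rcases Nat.eq_zero_or_pos k with rfl | hk0
    · obtain ⟨y, hy⟩ := exists_incl_zero_eq_smul_unit r η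
      rw [hy, h.trace_eq, ← hG.trace_eq]
    · rw [h.right_eq t v k hk0 hk, ← hG.right_eq t v k hk0 hk]
  · rcases Nat.eq_zero_or_pos k with rfl | hk0
    · obtain ⟨y, hy⟩ := exists_incl_zero_eq_smul_unit r η
      rw [hy, h.left_eq t v j hj0 hj, ← hG.left_eq t v j hj0 hj]
    · rw [h.mixed_eq t v j hj0 hj k hk0 hk, ← hG.mixed_eq t v j hj0 hj k hk0 hk]

end Composition

/-! ### Uniform bounds from finite dimension -/

section FiniteDimensional

variable {V W E : Type*} [NormedAddCommGroup V] [NormedSpace ℝ V]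
  [NormedAddCommGroup W] [NormedSpace ℝ W] [SeminormedAddCommGroup E] [NormedSpace ℝ E] {n r : ℕ}

/-- Expansion in a basis. The target is only seminormed so that it may be a tensor power with its
projective seminorm, as in `exists_truncNorm_toTrunc_mul_le`. -/
theorem exists_norm_multilinear_le [FiniteDimensional ℝ V] {j : ℕ}
    (f : MultilinearMap ℝ (fun _ : Fin j => V) E) :
    ∃ C : ℝ, ∀ v, ‖f v‖ ≤ C * ∏ i, ‖v i‖ := by
  let b := Module.finBasis ℝ V
  let A : ℝ := ∑ i, ‖LinearMap.toContinuousLinearMap (b.coord i)‖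
  have hA : ∀ i v, |b.repr v i| ≤ A * ‖v‖ := fun i v =>
    ((LinearMap.toContinuousLinearMap (b.coord i)).le_opNorm v).trans
      (mul_le_mul_of_nonneg_right (Finset.single_le_sum
        (f := fun i => ‖LinearMap.toContinuousLinearMap (b.coord i)‖)
        (fun _ _ => norm_nonneg _) (Finset.mem_univ i)) (norm_nonneg _))
  refine ⟨∑ s : Fin j → Fin (Module.finrank ℝ V), A ^ j * ‖f fun i => b (s i)‖, fun v => ?_⟩
  have hv : f v = ∑ s : Fin j → Fin (Module.finrank ℝ V),
      (∏ i, b.repr (v i) (s i)) • f fun i => b (s i) := by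
    conv_lhs => rw [← funext fun i => b.sum_repr (v i)]
    rw [f.map_sum fun i s => b.repr (v i) s • b s]
    exact Finset.sum_congr rfl fun s _ => f.map_smul_univ _ _
  rw [hv, Finset.sum_mul]
  refine norm_sum_le_of_le _ fun s _ => ?_
  rw [norm_smul, Real.norm_eq_abs, Finset.abs_prod, mul_right_comm]
  refine mul_le_mul_of_nonneg_right ?_ (norm_nonneg _)
  refine (Finset.prod_le_prod (fun _ _ => abs_nonneg _) fun i _ => hA (s i) (v i)).trans ?_
  rw [Finset.prod_mul_distrib]
  simp

/-- Linear maps are bounded for the projective norm. -/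
theorem exists_norm_tensorPower_le [FiniteDimensional ℝ V] {j : ℕ} (f : (⨂[ℝ]^j V) →ₗ[ℝ] E) :
    ∃ C : ℝ, 0 ≤ C ∧ ∀ η, ‖f η‖ ≤ C * ‖η‖ := by
  obtain ⟨C, hC⟩ := exists_norm_multilinear_le (PiTensorProduct.lift.symm f)
  refine ⟨‖(PiTensorProduct.lift.symm f).mkContinuous C hC‖, norm_nonneg _, fun η => ?_⟩
  have h := PiTensorProduct.norm_eval_le_projectiveSeminorm
    ((PiTensorProduct.lift.symm f).mkContinuous C hC) η
  have e : ((PiTensorProduct.lift.symm f).mkContinuous C hC).toMultilinearMap =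
    PiTensorProduct.lift.symm f := rfl
  rwa [e, LinearEquiv.apply_symm_apply] at h

/-- A family of linear maps on `V^{⊗j}` which is bounded on each signature is uniformly bounded. -/
theorem exists_forall_norm_tensorPower_le [FiniteDimensional ℝ V] {ι : Type*} {j : ℕ}
    (f : ι → (⨂[ℝ]^j V) →ₗ[ℝ] E) {w : ι → ℝ} (hw : ∀ i, 0 ≤ w i)
    (hf : ∀ l : List V, ∃ C : ℝ, ∀ i, ‖f i (coord V j (sigLevel l j))‖ ≤ C * w i) :
    ∃ C : ℝ, 0 ≤ C ∧ ∀ i η, ‖f i η‖ ≤ C * w i * ‖η‖ := by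
  -- The vectors on which the family is bounded by a multiple of w form a subspace. It contains
  -- level j of every signature, hence all of level j.
  let p : Submodule ℝ (TensorAlgebra ℝ V) :=
    { carrier := {x | ∃ C : ℝ, ∀ i, ‖f i (coord V j x)‖ ≤ C * w i}
      zero_mem' := ⟨0, fun i => by simp⟩
      add_mem' := by
        rintro x y ⟨C, hC⟩ ⟨D, hD⟩
        refine ⟨C + D, fun i => ?_⟩
        rw [map_add, map_add, add_mul]
        exact (norm_add_le _ _).trans (add_le_add (hC i) (hD i))
      smul_mem' := by
        rintro c x ⟨C, hC⟩
        refine ⟨|c| * C, fun i => ?_⟩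
        rw [map_smul, map_smul, norm_smul, Real.norm_eq_abs, mul_assoc]
        exact mul_le_mul_of_nonneg_left (hC i) (abs_nonneg _) }
  have hp : ∀ η : ⨂[ℝ]^j V, ∃ C : ℝ, ∀ i, ‖f i η‖ ≤ C * w i := fun η => by
    have := mem_of_sigLevel_mem (p := p) hf (x := TensorPower.toTensorAlgebra η) ⟨η, rfl⟩
    obtain ⟨C, hC⟩ := this
    refine ⟨C, fun i => ?_⟩
    have := hC i
    rwa [coord_toTensorAlgebra_self] at this
  -- The constants may depend on the vector, but only the finitely many basis vectors are used; this
  -- gives uniformity.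
  let b := Module.finBasis ℝ (⨂[ℝ]^j V)
  choose D hD using fun s => hp (b s)
  choose A hA0 hA using fun s => exists_norm_tensorPower_le (b.coord s)
  refine ⟨∑ s, A s * |D s|, Finset.sum_nonneg fun s _ => mul_nonneg (hA0 s) (abs_nonneg _),
    fun i η => ?_⟩
  conv_lhs => rw [← b.sum_repr η, map_sum]
  rw [mul_assoc, Finset.sum_mul]
  refine norm_sum_le_of_le _ fun s _ => ?_
  rw [map_smul, norm_smul]
  calc ‖b.repr η s‖ * ‖f i (b s)‖ ≤ (A s * ‖η‖) * (|D s| * w i) := by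
        refine mul_le_mul (hA s η) ((hD s i).trans ?_) (norm_nonneg _)
          (mul_nonneg (hA0 s) (norm_nonneg _))
        exact mul_le_mul_of_nonneg_right (le_abs_self _) (hw i)
    _ = A s * |D s| * (w i * ‖η‖) := by ring

/-- A family of linear maps on `T^{<n}(V) ⊠ T^{<r}(W)` which is bounded on each signature is
uniformly bounded. -/
theorem exists_forall_norm_incl_tmul_incl_le [FiniteDimensional ℝ V] [FiniteDimensional ℝ W]
    {ι : Type*} {j k : ℕ} (f : ι → Trunc V n ⊗[ℝ] Trunc W r →ₗ[ℝ] E) {w : ι → ℝ}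
    (hw : ∀ i, 0 ≤ w i) (hf : ∀ (l : List V) (l' : List W), ∃ C : ℝ, ∀ i,
      ‖f i (sigTrunc n l j ⊗ₜ[ℝ] sigTrunc r l' k)‖ ≤ C * w i) :
    ∃ C : ℝ, 0 ≤ C ∧ ∀ i (η : ⨂[ℝ]^j V) (ξ : ⨂[ℝ]^k W),
      ‖f i (incl V n j η ⊗ₜ[ℝ] incl W r k ξ)‖ ≤ C * w i * ‖η‖ * ‖ξ‖ := by
  have h₁ : ∀ l' : List W, ∃ C : ℝ, 0 ≤ C ∧ ∀ i (η : ⨂[ℝ]^j V),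
      ‖f i (incl V n j η ⊗ₜ[ℝ] sigTrunc r l' k)‖ ≤ C * w i * ‖η‖ := fun l' => by
    refine exists_forall_norm_tensorPower_le (fun i => f i ∘ₗ
      (TensorProduct.mk ℝ (Trunc V n) (Trunc W r)).flip (sigTrunc r l' k) ∘ₗ incl V n j) hw
      fun l => ?_
    obtain ⟨C, hC⟩ := hf l l'
    refine ⟨C, fun i => ?_⟩
    have := hC i
    rwa [sigTrunc, ← (isLevel_sigLevel l j).incl_coord] at this
  -- The second factor is treated with the first tensor η as a part of the index and ‖η‖ as a part
  -- of the weight, so that the constant does not depend on η.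
  obtain ⟨C, hC0, hC⟩ := exists_forall_norm_tensorPower_le
    (fun q : ι × (⨂[ℝ]^j V) => f q.1 ∘ₗ
      TensorProduct.mk ℝ (Trunc V n) (Trunc W r) (incl V n j q.2) ∘ₗ incl W r k)
    (w := fun q => w q.1 * ‖q.2‖) (fun q => mul_nonneg (hw _) (norm_nonneg _)) fun l' => by
      obtain ⟨C, -, hC⟩ := h₁ l'
      refine ⟨C, fun q => ?_⟩
      have := hC q.1 q.2
      rwa [sigTrunc, ← (isLevel_sigLevel l' k).incl_coord, mul_assoc] at this
  refine ⟨C, hC0, fun i η ξ => ?_⟩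
  have := hC (i, η) ξ
  rwa [← mul_assoc] at this

instance finite_trunc [FiniteDimensional ℝ V] (n : ℕ) : Module.Finite ℝ (Trunc V n) := by
  refine Module.Finite.of_surjective
    (∑ j : Fin n, incl V n j ∘ₗ LinearMap.proj (φ := fun j : Fin n => ⨂[ℝ]^(j : ℕ) V) j)
    fun x => ⟨fun j => coord V j (x : TensorAlgebra ℝ V), ?_⟩
  conv_rhs => rw [← sum_incl_coord x, Finset.sum_range]
  simp

theorem exists_norm_trunc_le [FiniteDimensional ℝ V] (f : Trunc V n →ₗ[ℝ] E) :
    ∃ C : ℝ, 0 ≤ C ∧ ∀ x, ‖f x‖ ≤ C * truncNorm x := by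
  choose C hC0 hC using fun j => exists_norm_tensorPower_le (f ∘ₗ incl V n j)
  refine ⟨∑ j ∈ Finset.range n, C j, Finset.sum_nonneg fun j _ => hC0 j, fun x => ?_⟩
  conv_lhs => rw [← sum_incl_coord x, map_sum]
  refine norm_sum_le_of_le (n := fun j => C j * truncNorm x) _ (fun j hj => ?_) |>.trans
    (by rw [Finset.sum_mul])
  refine (hC j _).trans (mul_le_mul_of_nonneg_left ?_ (hC0 j))
  exact Finset.single_le_sum (f := fun k => ‖coord V k (x : TensorAlgebra ℝ V)‖)
    (fun _ _ => norm_nonneg _) hj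

theorem norm_tmul_le_of_incl {f : Trunc V n ⊗[ℝ] Trunc W r →ₗ[ℝ] E} {C : ℝ}
    (h : ∀ j < n, ∀ k < r, ∀ (η : ⨂[ℝ]^j V) (ξ : ⨂[ℝ]^k W),
      ‖f (incl V n j η ⊗ₜ[ℝ] incl W r k ξ)‖ ≤ C * ‖η‖ * ‖ξ‖) (x : Trunc V n) (y : Trunc W r) :
    ‖f (x ⊗ₜ[ℝ] y)‖ ≤ C * truncNorm x * truncNorm y := by
  rw [truncNorm, truncNorm, mul_assoc, Finset.sum_mul_sum, Finset.mul_sum]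
  conv_lhs => rw [← sum_incl_coord x, TensorProduct.sum_tmul, map_sum]
  refine norm_sum_le_of_le _ fun j hj => ?_
  rw [Finset.mul_sum]
  simp only [← mul_assoc]
  conv_lhs => rw [← sum_incl_coord y, TensorProduct.tmul_sum, map_sum]
  exact norm_sum_le_of_le _ fun k hk => h j (Finset.mem_range.1 hj) k (Finset.mem_range.1 hk) _ _

theorem norm_tmul_le_of_incl_left {f : Trunc V n ⊗[ℝ] Trunc W r →ₗ[ℝ] E} {y : Trunc W r}
    {x : Trunc V n} {C : ℕ → ℝ} (h : ∀ j < n, ∀ (η : ⨂[ℝ]^j V),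
      ‖f (incl V n j η ⊗ₜ[ℝ] y)‖ ≤ C j * ‖η‖) :
    ‖f (x ⊗ₜ[ℝ] y)‖ ≤ ∑ j ∈ Finset.range n, C j * ‖coord V j (x : TensorAlgebra ℝ V)‖ := by
  conv_lhs => rw [← sum_incl_coord x, TensorProduct.sum_tmul, map_sum]
  exact norm_sum_le_of_le _ fun j hj => h j (Finset.mem_range.1 hj) _

theorem norm_tmul_le_of_incl_right {f : Trunc V n ⊗[ℝ] Trunc W r →ₗ[ℝ] E} {y : Trunc W r}
    {x : Trunc V n} {C : ℕ → ℝ} (h : ∀ k < r, ∀ (ξ : ⨂[ℝ]^k W),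
      ‖f (x ⊗ₜ[ℝ] incl W r k ξ)‖ ≤ C k * ‖ξ‖) :
    ‖f (x ⊗ₜ[ℝ] y)‖ ≤ ∑ k ∈ Finset.range r, C k * ‖coord W k (y : TensorAlgebra ℝ W)‖ := by
  conv_lhs => rw [← sum_incl_coord y, TensorProduct.tmul_sum, map_sum]
  exact norm_sum_le_of_le _ fun k hk => h k (Finset.mem_range.1 hk) _

end FiniteDimensional

/-! ### Chen's identity, horizontal curves, and extraction of bidegrees -/

section Signature

variable {V W E : Type*} [NormedAddCommGroup V] [NormedSpace ℝ V]
  [NormedAddCommGroup W] [NormedSpace ℝ W] {n r : ℕ}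

theorem coe_sigSum (n : ℕ) (l : List V) :
    (sigSum n l : TensorAlgebra ℝ V) = ∑ i ∈ Finset.range n, sigLevel l i := by
  rw [sigSum, Submodule.coe_sum]
  exact Finset.sum_congr rfl fun i hi => coe_sigTrunc (Finset.mem_range.1 hi) l

theorem sigSum_eq_toTrunc (n : ℕ) (l : List V) :
    sigSum n l = toTrunc V n (∑ i ∈ Finset.range n, sigLevel l i) := by
  rw [← coe_sigSum, toTrunc_coe]

theorem proj_sum_sigLevel {k : ℕ} (hk : k < n) (l : List V) :
    proj V k (∑ i ∈ Finset.range n, sigLevel l i) = sigLevel l k := by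
  rw [map_sum, Finset.sum_eq_single_of_mem k (Finset.mem_range.2 hk),
    (isLevel_sigLevel l k).proj_self]
  exact fun i _ hi => (isLevel_sigLevel l i).proj_eq_zero hi

theorem coord_sigSum {k : ℕ} (hk : k < n) (l : List V) :
    coord V k (sigSum n l : TensorAlgebra ℝ V) = coord V k (sigLevel l k) := by
  rw [coe_sigSum, ← coord_proj_self, proj_sum_sigLevel hk]

theorem norm_coord_sigSum_le {k : ℕ} (hk : k < n) (l : List V) :
    ‖coord V k (sigSum n l : TensorAlgebra ℝ V)‖ ≤ pathLength l ^ k := by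
  rw [coord_sigSum hk]
  exact norm_coord_sigLevel_le l k k

theorem truncNorm_sigSum_le {D : ℝ} {l : List V} (h : pathLength l ≤ D) :
    truncNorm (sigSum n l) ≤ ∑ k ∈ Finset.range n, D ^ k :=
  Finset.sum_le_sum fun k hk => (norm_coord_sigSum_le (Finset.mem_range.1 hk) l).trans
    (pow_le_pow_left₀ (pathLength_nonneg l) h k)

theorem truncNorm_sigTrunc_le {k : ℕ} (hk : k < n) (l : List V) :
    truncNorm (sigTrunc n l k) ≤ pathLength l ^ k := by
  rw [sigTrunc, truncNorm_toTrunc_isLevel (isLevel_sigLevel l k) hk]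
  exact norm_coord_sigLevel_le l k k

/-- Chen's identity: signatures multiply under concatenation. Through it the action of a rough path
increment on signatures becomes an operation on paths. -/
theorem leftMul_sigSum {x : TensorAlgebra ℝ V} {l : List V}
    (hx : ∀ k < n, proj V k x = sigLevel l k) (l' : List V) :
    leftMul (toTrunc V n x) (sigSum n l') = sigSum n (l ++ l') := by
  rw [sigSum_eq_toTrunc, leftMul_toTrunc, sigSum_eq_toTrunc]
  refine toTrunc_congr fun k hk => ?_
  rw [proj_sum_sigLevel hk, proj_mul, sigLevel_append]
  refine Finset.sum_congr rfl fun q hq => ?_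
  have := Finset.HasAntidiagonal.mem_antidiagonal.1 hq
  rw [hx q.1 (by omega), proj_sum_sigLevel (by omega)]

theorem sigTrunc_scalePath (α : ℝ) (l : List V) (i : ℕ) :
    sigTrunc n (scalePath α l) i = α ^ i • sigTrunc n l i := by
  rw [sigTrunc, sigLevel_scalePath, map_smul, sigTrunc]

theorem proj_truncExp_ι {N k : ℕ} (hk : k ≤ N) (v : V) :
    proj V k (truncExp N (TensorAlgebra.ι ℝ v)) =
      ((k.factorial : ℝ)⁻¹) • TensorAlgebra.ι ℝ v ^ k := by
  rw [truncExp, proj_truncate, if_pos (by omega), map_sum,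
    Finset.sum_eq_single_of_mem k (Finset.mem_range.2 (by omega)), map_smul,
    (isLevel_ι_pow v k).proj_self]
  intro j _ hj
  rw [map_smul, (isLevel_ι_pow v j).proj_eq_zero hj, smul_zero]

theorem proj_prod_truncExp {N k : ℕ} (hk : k ≤ N) (l : List V) :
    proj V k (l.map fun v => truncExp N (TensorAlgebra.ι ℝ v)).prod = sigLevel l k := by
  induction l generalizing k with
  | nil =>
    rw [List.map_nil, List.prod_nil, sigLevel_nil]
    split_ifs with h
    · subst h; exact isLevel_one.proj_self
    · exact isLevel_one.proj_eq_zero (Ne.symm h)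
  | cons v l ih =>
    rw [List.map_cons, List.prod_cons, proj_mul, sigLevel_cons]
    refine Finset.sum_congr rfl fun q hq => ?_
    have := Finset.HasAntidiagonal.mem_antidiagonal.1 hq
    rw [proj_truncExp_ι (by omega), ih (by omega)]

theorem enorm_sum_eq (l : List V) : (l.map fun v => ‖v‖ₑ).sum = ENNReal.ofReal (pathLength l) := by
  induction l with
  | nil => simp [pathLength]
  | cons v l ih =>
    rw [List.map_cons, List.sum_cons, ih, ← ofReal_norm,
      ← ENNReal.ofReal_add (norm_nonneg _) (pathLength_nonneg l)]
    rfl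

/-- A horizontal curve from 1 to x is a piecewise linear path whose truncated signature is x. The
strict inequality is needed since the infimum may not be attained. -/
theorem exists_path_of_ccDist_lt {N : ℕ} {x : TensorAlgebra ℝ V} {D : ℝ}
    (h : ccDist N 1 x < ENNReal.ofReal D) :
    ∃ l : List V, pathLength l ≤ D ∧ ∀ k ≤ N, proj V k x = sigLevel l k := by
  obtain ⟨l, hl⟩ := iInf_lt_iff.1 h
  obtain ⟨hx, hl⟩ := iInf_lt_iff.1 hl
  rw [enorm_sum_eq, ENNReal.ofReal_lt_ofReal_iff_of_nonneg (pathLength_nonneg l)] at hl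
  refine ⟨l, hl.le, fun k hk => ?_⟩
  rw [← hx, proj_truncate, if_pos (by omega), one_mul, proj_prod_truncExp hk]

theorem IsGroupVariation.exists_path {a b : ℝ} {N : ℕ} {p : ℝ}
    {ω : Set.Icc a b → Set.Icc a b → ℝ} {X : Set.Icc a b → Set.Icc a b → TensorAlgebra ℝ V}
    (hX : IsGroupVariation N p ω X) (hω : IsControl ω) :
    ∃ C : ℝ, 0 ≤ C ∧ ∀ s t α, s ≤ t → 0 < α → ω s t ^ (1 / p) ≤ α → ∃ l : List V,
      pathLength l ≤ C * α ∧ ∀ k ≤ N, proj V k (X s t) = sigLevel l k := by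
  obtain ⟨C, hC⟩ := hX.bound
  -- The additional 1, together with α > 0, makes the inequality strict even where the control
  -- vanishes.
  refine ⟨|C| + 1, by positivity, fun s t α hst hα hωα => ?_⟩
  refine exists_path_of_ccDist_lt ((hC s t hst).trans_lt ?_)
  have h0 : 0 ≤ ω s t ^ (1 / p) := Real.rpow_nonneg (hω.nonneg s t hst) _
  rw [ENNReal.ofReal_lt_ofReal_iff (by positivity)]
  calc C * ω s t ^ (1 / p) ≤ |C| * α := mul_le_mul (le_abs_self C) hωα h0 (abs_nonneg C)
    _ < (|C| + 1) * α := by linarith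

/-- Passage to the limit α ↓ x. Estimates at a positive scale α, by which one may divide, thus reach
the modulus x itself, which may be 0. -/
theorem le_of_forall_pow {x A C y : ℝ} (hxA : x < A) (m : ℕ)
    (h : ∀ α, 0 < α → x ≤ α → α ≤ A → y ≤ C * α ^ m) (hx : 0 ≤ x) : y ≤ C * x ^ m := by
  have ht : Filter.Tendsto (fun α : ℝ => C * α ^ m) (nhdsWithin x (Set.Ioi x))
      (nhds (C * x ^ m)) :=
    (((continuous_const.mul (continuous_pow m)).tendsto x).mono_left nhdsWithin_le_nhds)
  refine ge_of_tendsto ht ?_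
  filter_upwards [Ioo_mem_nhdsGT hxA] with α hα
  exact h α (hx.trans_lt hα.1) hα.1.le hα.2.le

/-- With the modulus ω^{1/p} in place of the control, all exponents become natural numbers, which
fit degrees of polynomials. -/
theorem rpow_sub_div_eq {x p : ℝ} (hx : 0 ≤ x) {n j : ℕ} (hj : j ≤ n) :
    x ^ (((n : ℝ) - j) / p) = (x ^ (1 / p)) ^ (n - j) := by
  rw [← Real.rpow_natCast, ← Real.rpow_mul hx, Nat.cast_sub hj]
  congr 1
  ring

theorem IsControl.le {a b : ℝ} {ω : Set.Icc a b → Set.Icc a b → ℝ} (hω : IsControl ω)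
    {s t s' t' : Set.Icc a b} (hs : s' ≤ s) (hst : s ≤ t) (ht : t ≤ t') : ω s t ≤ ω s' t' := by
  have h₁ := hω.superadditive s' s t' hs (hst.trans ht)
  have h₂ := hω.superadditive s t t' hst ht
  have h₃ := hω.nonneg s' s hs
  have h₄ := hω.nonneg t t' ht
  linarith

/-- Extraction of the bihomogeneous parts from bounds on signatures. -/
theorem exists_norm_sigTrunc_tmul_sigTrunc_le [NormedAddCommGroup E] [NormedSpace ℝ E]
    (n r : ℕ) : ∃ C : ℝ, 0 ≤ C ∧ ∀ (f : Trunc V n ⊗[ℝ] Trunc W r →ₗ[ℝ] E) (α β ε : ℝ)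
      (l : List V) (l' : List W), 0 < α → 0 < β → (∀ i < n, ∀ k < r,
        ‖f (sigSum n (scalePath α (scalePath (i : ℝ) l)) ⊗ₜ[ℝ]
          sigSum r (scalePath β (scalePath (k : ℝ) l')))‖ ≤ ε) → ∀ j < n, ∀ k < r,
      α ^ j * β ^ k * ‖f (sigTrunc n l j ⊗ₜ[ℝ] sigTrunc r l' k)‖ ≤ C * ε := by
  obtain ⟨C₁, hC₁0, hC₁⟩ := exists_norm_le_of_vandermonde (S := E) n
  obtain ⟨C₂, hC₂0, hC₂⟩ := exists_norm_le_of_vandermonde (S := E) r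
  refine ⟨C₂ * C₁, by positivity, fun f α β ε l l' hα hβ h j hj k hk => ?_⟩
  -- As a function of the nodes i and i' the value is a polynomial whose coefficients are the
  -- bihomogeneous parts. The Vandermonde system is inverted in i for each fixed i', and then in i'.
  have hsum : ∀ i i' : ℕ, f (sigSum n (scalePath α (scalePath (i : ℝ) l)) ⊗ₜ[ℝ]
      sigSum r (scalePath β (scalePath (i' : ℝ) l'))) =
      ∑ j ∈ Finset.range n, ((i : ℝ) ^ j) • ∑ k ∈ Finset.range r, ((i' : ℝ) ^ k) •
        (α ^ j * β ^ k) • f (sigTrunc n l j ⊗ₜ[ℝ] sigTrunc r l' k) := by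
    intro i i'
    rw [sigSum, sigSum, TensorProduct.sum_tmul, map_sum]
    refine Finset.sum_congr rfl fun j _ => ?_
    rw [TensorProduct.tmul_sum, map_sum, Finset.smul_sum]
    refine Finset.sum_congr rfl fun k _ => ?_
    rw [sigTrunc_scalePath, sigTrunc_scalePath, sigTrunc_scalePath, sigTrunc_scalePath, smul_smul,
      smul_smul, TensorProduct.smul_tmul_smul, map_smul, smul_smul, smul_smul]
    congr 1
    ring
  have h₁ : ∀ i' < r, ‖∑ k ∈ Finset.range r, ((i' : ℝ) ^ k) •
      (α ^ j * β ^ k) • f (sigTrunc n l j ⊗ₜ[ℝ] sigTrunc r l' k)‖ ≤ C₁ * ε := fun i' hi' =>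
    hC₁ (fun j => ∑ k ∈ Finset.range r, ((i' : ℝ) ^ k) •
      (α ^ j * β ^ k) • f (sigTrunc n l j ⊗ₜ[ℝ] sigTrunc r l' k)) ε
      (fun i hi => by rw [← hsum]; exact h i hi i' hi') j hj
  have h₂ := hC₂ (fun k => (α ^ j * β ^ k) • f (sigTrunc n l j ⊗ₜ[ℝ] sigTrunc r l' k)) _ h₁ k hk
  rw [norm_smul, Real.norm_of_nonneg (by positivity), ← mul_assoc] at h₂
  exact h₂

end Signature

/-! ### Bounds on tensors and bounds on signatures -/

section PolynomialBounds

variable {V W E : Type*} [NormedAddCommGroup V] [NormedSpace ℝ V]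
  [NormedAddCommGroup W] [NormedSpace ℝ W] [NormedAddCommGroup E] [NormedSpace ℝ E] {n r : ℕ}

/-- Level j contributes x ^ (n - j) from the hypothesis and (D α) ^ j from the length of the path,
so every level is of the same order α ^ n. -/
theorem norm_sigSum_tmul_le {f : Trunc V n ⊗[ℝ] Trunc W r →ₗ[ℝ] E} {y : Trunc W r}
    {C x α D : ℝ} (hC : 0 ≤ C) (hx : 0 ≤ x) (hxα : x ≤ α) {l : List V}
    (hl : pathLength l ≤ D * α)
    (h : ∀ j < n, ∀ η : ⨂[ℝ]^j V, ‖f (incl V n j η ⊗ₜ[ℝ] y)‖ ≤ C * x ^ (n - j) * ‖η‖) :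
    ‖f (sigSum n l ⊗ₜ[ℝ] y)‖ ≤ C * (∑ j ∈ Finset.range n, D ^ j) * α ^ n := by
  refine (norm_tmul_le_of_incl_left h).trans ?_
  rw [Finset.mul_sum, Finset.sum_mul]
  refine Finset.sum_le_sum fun j hj => ?_
  have hjn := Finset.mem_range.1 hj
  calc C * x ^ (n - j) * ‖coord V j (sigSum n l : TensorAlgebra ℝ V)‖
      ≤ C * α ^ (n - j) * (D * α) ^ j := by
        have h1 := (norm_coord_sigSum_le hjn l).trans
          (pow_le_pow_left₀ (pathLength_nonneg l) hl j)
        have h2 := pow_le_pow_left₀ hx hxα (n - j)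
        have h3 : 0 ≤ α := hx.trans hxα
        gcongr
    _ = C * D ^ j * α ^ n := by
        rw [mul_pow, ← Nat.sub_add_cancel hjn.le, pow_add, Nat.sub_add_cancel hjn.le]
        ring

theorem norm_tmul_sigSum_le {f : Trunc V n ⊗[ℝ] Trunc W r →ₗ[ℝ] E} {x : Trunc V n}
    {C y β D : ℝ} (hC : 0 ≤ C) (hy : 0 ≤ y) (hyβ : y ≤ β) {l : List W}
    (hl : pathLength l ≤ D * β)
    (h : ∀ k < r, ∀ ξ : ⨂[ℝ]^k W, ‖f (x ⊗ₜ[ℝ] incl W r k ξ)‖ ≤ C * y ^ (r - k) * ‖ξ‖) :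
    ‖f (x ⊗ₜ[ℝ] sigSum r l)‖ ≤ C * (∑ k ∈ Finset.range r, D ^ k) * β ^ r :=
  norm_sigSum_tmul_le (f := f ∘ₗ (TensorProduct.comm ℝ (Trunc W r) (Trunc V n)).toLinearMap)
    hC hy hyβ hl h

theorem norm_sigSum_tmul_sigSum_le {f : Trunc V n ⊗[ℝ] Trunc W r →ₗ[ℝ] E}
    {C x α y β D : ℝ} (hC : 0 ≤ C) (hD : 0 ≤ D) (hx : 0 ≤ x) (hxα : x ≤ α) (hy : 0 ≤ y)
    (hyβ : y ≤ β) {l : List V} {l' : List W} (hl : pathLength l ≤ D * α)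
    (hl' : pathLength l' ≤ D * β)
    (h : ∀ j < n, ∀ k < r, ∀ (η : ⨂[ℝ]^j V) (ξ : ⨂[ℝ]^k W),
      ‖f (incl V n j η ⊗ₜ[ℝ] incl W r k ξ)‖ ≤ C * x ^ (n - j) * y ^ (r - k) * ‖η‖ * ‖ξ‖) :
    ‖f (sigSum n l ⊗ₜ[ℝ] sigSum r l')‖ ≤
      C * (∑ j ∈ Finset.range n, D ^ j) * (∑ k ∈ Finset.range r, D ^ k) * (α ^ n * β ^ r) := by
  have h0 : 0 ≤ β := hy.trans hyβ
  refine (norm_sigSum_tmul_le (C := C * (∑ k ∈ Finset.range r, D ^ k) * β ^ r) (by positivity)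
    hx hxα hl fun j hj η => ?_).trans (le_of_eq (by ring))
  refine (norm_tmul_sigSum_le (C := C * x ^ (n - j) * ‖η‖) (by positivity) hy hyβ hl'
    fun k hk ξ => (h j hj k hk η ξ).trans (le_of_eq (by ring))).trans (le_of_eq (by ring))

theorem scalePath_one (l : List V) : scalePath 1 l = l := by
  simp [scalePath]

/-- Uniform bounds on all bidegrees, from bounds on signatures. -/
theorem exists_forall_norm_incl_tmul_incl_le_of_sigSum [FiniteDimensional ℝ V]
    [FiniteDimensional ℝ W] {ι : Type*} (f : ι → Trunc V n ⊗[ℝ] Trunc W r →ₗ[ℝ] E)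
    {α β w : ι → ℝ} (hα : ∀ i, 0 < α i) (hβ : ∀ i, 0 < β i) (hw : ∀ i, 0 ≤ w i)
    (h : ∀ (l : List V) (l' : List W), ∃ C : ℝ, ∀ i,
      ‖f i (sigSum n (scalePath (α i) l) ⊗ₜ[ℝ] sigSum r (scalePath (β i) l'))‖ ≤ C * w i) :
    ∃ C : ℝ, 0 ≤ C ∧ ∀ j < n, ∀ k < r, ∀ i (η : ⨂[ℝ]^j V) (ξ : ⨂[ℝ]^k W),
      α i ^ j * β i ^ k * ‖f i (incl V n j η ⊗ₜ[ℝ] incl W r k ξ)‖ ≤ C * w i * ‖η‖ * ‖ξ‖ := by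
  obtain ⟨C₀, hC₀0, hC₀⟩ := exists_norm_sigTrunc_tmul_sigTrunc_le (V := V) (W := W) (E := E) n r
  choose C₁ hC₁ using h
  have key : ∀ j k, ∃ C : ℝ, 0 ≤ C ∧ (j < n → k < r → ∀ i (η : ⨂[ℝ]^j V) (ξ : ⨂[ℝ]^k W),
      α i ^ j * β i ^ k * ‖f i (incl V n j η ⊗ₜ[ℝ] incl W r k ξ)‖ ≤ C * w i * ‖η‖ * ‖ξ‖) := by
    intro j k
    by_cases hjk : j < n ∧ k < r
    · obtain ⟨C, hC0, hC⟩ := exists_forall_norm_incl_tmul_incl_le (j := j) (k := k)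
        (fun i => (α i ^ j * β i ^ k) • f i) hw (fun l l' => by
          refine ⟨C₀ * ∑ i ∈ Finset.range n, ∑ k ∈ Finset.range r,
            |C₁ (scalePath (i : ℝ) l) (scalePath (k : ℝ) l')|, fun i => ?_⟩
          have h := hC₀ (f i) (α i) (β i) ((∑ i ∈ Finset.range n, ∑ k ∈ Finset.range r,
            |C₁ (scalePath (i : ℝ) l) (scalePath (k : ℝ) l')|) * w i) l l' (hα i) (hβ i) ?_
            j hjk.1 k hjk.2
          · rw [LinearMap.smul_apply, norm_smul, Real.norm_of_nonneg (by
              have := (hα i).le; have := (hβ i).le; positivity), mul_assoc C₀]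
            exact h
          · intro i' hi' k' hk'
            refine (hC₁ _ _ i).trans (mul_le_mul_of_nonneg_right ?_ (hw i))
            refine (le_abs_self _).trans ?_
            refine (Finset.single_le_sum (f := fun k : ℕ =>
              |C₁ (scalePath (i' : ℝ) l) (scalePath (k : ℝ) l')|) (fun _ _ => abs_nonneg _)
              (Finset.mem_range.2 hk')).trans ?_
            exact Finset.single_le_sum (f := fun i : ℕ => ∑ k ∈ Finset.range r,
              |C₁ (scalePath (i : ℝ) l) (scalePath (k : ℝ) l')|)
              (fun _ _ => Finset.sum_nonneg fun _ _ => abs_nonneg _) (Finset.mem_range.2 hi'))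
      refine ⟨C, hC0, fun _ _ i η ξ => ?_⟩
      have h := hC i η ξ
      rwa [LinearMap.smul_apply, norm_smul, Real.norm_of_nonneg (by
        have := (hα i).le; have := (hβ i).le; positivity)] at h
    · exact ⟨0, le_rfl, fun h₁ h₂ => absurd ⟨h₁, h₂⟩ hjk⟩
  choose C hC0 hC using key
  refine ⟨∑ j ∈ Finset.range n, ∑ k ∈ Finset.range r, C j k,
    Finset.sum_nonneg fun j _ => Finset.sum_nonneg fun k _ => hC0 j k, fun j hj k hk i η ξ => ?_⟩
  refine (hC j k hj hk i η ξ).trans ?_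
  have h1 : C j k ≤ ∑ j ∈ Finset.range n, ∑ k ∈ Finset.range r, C j k :=
    (Finset.single_le_sum (f := fun k : ℕ => C j k) (fun k _ => hC0 j k)
      (Finset.mem_range.2 hk)).trans
      (Finset.single_le_sum (f := fun j : ℕ => ∑ k ∈ Finset.range r, C j k)
        (fun j _ => Finset.sum_nonneg fun k _ => hC0 j k) (Finset.mem_range.2 hj))
  have := hw i
  gcongr

theorem exists_truncNorm_toTrunc_mul_le [FiniteDimensional ℝ V] (x : Trunc V n) (i : ℕ) :
    ∃ C : ℝ, 0 ≤ C ∧ ∀ y : TensorAlgebra ℝ V, IsLevel i y →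
      truncNorm (toTrunc V n (y * x)) ≤ C * ‖coord V i y‖ := by
  choose C hC0 hC using fun k => exists_norm_tensorPower_le
    ((coord V k ∘ₗ (Trunc V n).subtype ∘ₗ toTrunc V n ∘ₗ
      LinearMap.mulRight ℝ (x : TensorAlgebra ℝ V) ∘ₗ TensorPower.toTensorAlgebra) :
        (⨂[ℝ]^i V) →ₗ[ℝ] (⨂[ℝ]^k V))
  refine ⟨∑ k ∈ Finset.range n, C k, Finset.sum_nonneg fun k _ => hC0 k, ?_⟩
  rintro _ ⟨η, rfl⟩
  rw [coord_toTensorAlgebra_self, truncNorm, Finset.sum_mul]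
  exact Finset.sum_le_sum fun k _ => hC k η

/-- The level 0 of X is 1, so only levels i + 1 ≥ 1 survive in the difference. Each is O(α ^ (i +
1)), and all but one factor α are absorbed by A. -/
theorem exists_truncNorm_leftMul_sub_le [FiniteDimensional ℝ V] (hn : 0 < n) (x : Trunc V n)
    {A D : ℝ} (hA : 0 ≤ A) (hD : 0 ≤ D) :
    ∃ C : ℝ, 0 ≤ C ∧ ∀ (X : TensorAlgebra ℝ V) (l : List V) (α : ℝ),
      (∀ k < n, proj V k X = sigLevel l k) → 0 ≤ α → α ≤ A → pathLength l ≤ D * α →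
      truncNorm (leftMul (toTrunc V n X) x - x) ≤ C * α := by
  obtain ⟨m, rfl⟩ : ∃ m, n = m + 1 := ⟨n - 1, by omega⟩
  choose K hK0 hK using exists_truncNorm_toTrunc_mul_le x
  refine ⟨∑ i ∈ Finset.range m, K (i + 1) * (D ^ (i + 1) * A ^ i),
    Finset.sum_nonneg fun i _ => mul_nonneg (hK0 _) (by positivity), ?_⟩
  intro X l α hX hα hαA hl
  have h1 : toTrunc V (m + 1) X = sigSum (m + 1) l := by
    rw [sigSum_eq_toTrunc]
    exact toTrunc_congr fun k hk => by rw [proj_sum_sigLevel hk, hX k hk]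
  have h2 : leftMul (toTrunc V (m + 1) X) x - x =
      ∑ i ∈ Finset.range m, toTrunc V (m + 1) (sigLevel l (i + 1) * x) := by
    have : leftMul (toTrunc V (m + 1) X) x =
        toTrunc V (m + 1) ((toTrunc V (m + 1) X : TensorAlgebra ℝ V) * x) := rfl
    rw [this, h1, coe_sigSum, Finset.sum_range_succ', add_mul, Finset.sum_mul, map_add, map_sum,
      sigLevel_zero, one_mul, toTrunc_coe, add_sub_cancel_right]
  rw [h2, Finset.sum_mul]
  refine (truncNorm_sum_le _ _).trans (Finset.sum_le_sum fun i _ => ?_)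
  refine (hK _ _ (isLevel_sigLevel l _)).trans ?_
  rw [mul_assoc]
  refine mul_le_mul_of_nonneg_left ?_ (hK0 _)
  calc ‖coord V (i + 1) (sigLevel l (i + 1))‖ ≤ (D * α) ^ (i + 1) :=
        (norm_coord_sigLevel_le l _ _).trans (pow_le_pow_left₀ (pathLength_nonneg l) hl _)
    _ = D ^ (i + 1) * α ^ i * α := by ring
    _ ≤ D ^ (i + 1) * A ^ i * α := by gcongr

end PolynomialBounds

/-! ### Boundedness and continuity of controlled paths -/

section Controlled

variable {V W F : Type*} [NormedAddCommGroup V] [NormedSpace ℝ V]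
  [NormedAddCommGroup W] [NormedSpace ℝ W] [NormedAddCommGroup F] [NormedSpace ℝ F]
  {a b c d : ℝ} {n r : ℕ}

/-- `ρ` is a modulus on `s ≤ t`, bounded by `A`, and each `X s t` is, up to level `n - 1`, the
signature of a piecewise linear path of length at most `C * α`, for all `α ≥ ρ s t`. -/
structure HasPaths (n : ℕ) (A C : ℝ) (ρ : Set.Icc a b → Set.Icc a b → ℝ)
    (X : Set.Icc a b → Set.Icc a b → TensorAlgebra ℝ V) : Prop where
  nonneg : ∀ s t, s ≤ t → 0 ≤ ρ s t
  lt : ∀ s t, s ≤ t → ρ s t < A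
  diag : ∀ s, ρ s s = 0
  continuous : Continuous fun q : Set.Icc a b × Set.Icc a b => ρ (min q.1 q.2) (max q.1 q.2)
  const_nonneg : 0 ≤ C
  path : ∀ s t α, s ≤ t → 0 < α → ρ s t ≤ α →
    ∃ l : List V, pathLength l ≤ C * α ∧ ∀ k < n, proj V k (X s t) = sigLevel l k

/-- The bounds on the remainders, in terms of moduli. -/
structure RemainderBounds (C : ℝ) (ρX : Set.Icc a b → Set.Icc a b → ℝ)
    (ρY : Set.Icc c d → Set.Icc c d → ℝ) (X : Set.Icc a b → Set.Icc a b → TensorAlgebra ℝ V)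
    (Y : Set.Icc c d → Set.Icc c d → TensorAlgebra ℝ W)
    (Z : Set.Icc a b → Set.Icc c d → (Trunc V n ⊗[ℝ] Trunc W r →ₗ[ℝ] F)) : Prop where
  nonneg : 0 ≤ C
  bound₁ : ∀ s t u, s ≤ t → ∀ j < n, ∀ (η : ⨂[ℝ]^j V) (ξ : Trunc W r),
    ‖remainder₁ X Z s t u (incl V n j η ⊗ₜ[ℝ] ξ)‖ ≤ C * ρX s t ^ (n - j) * ‖η‖ * truncNorm ξ
  bound₂ : ∀ u v s, u ≤ v → ∀ k < r, ∀ (η : Trunc V n) (ξ : ⨂[ℝ]^k W),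
    ‖remainder₂ Y Z u v s (η ⊗ₜ[ℝ] incl W r k ξ)‖ ≤ C * ρY u v ^ (r - k) * truncNorm η * ‖ξ‖

theorem remainder₁_apply (X : Set.Icc a b → Set.Icc a b → TensorAlgebra ℝ V)
    (Z : Set.Icc a b → Set.Icc c d → (Trunc V n ⊗[ℝ] Trunc W r →ₗ[ℝ] F)) (s t : Set.Icc a b)
    (u : Set.Icc c d) (x : Trunc V n) (y : Trunc W r) :
    remainder₁ X Z s t u (x ⊗ₜ[ℝ] y) =
      Z t u (x ⊗ₜ[ℝ] y) - Z s u (leftMul (toTrunc V n (X s t)) x ⊗ₜ[ℝ] y) := by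
  simp [remainder₁]

theorem remainder₂_apply (Y : Set.Icc c d → Set.Icc c d → TensorAlgebra ℝ W)
    (Z : Set.Icc a b → Set.Icc c d → (Trunc V n ⊗[ℝ] Trunc W r →ₗ[ℝ] F)) (u v : Set.Icc c d)
    (s : Set.Icc a b) (x : Trunc V n) (y : Trunc W r) :
    remainder₂ Y Z u v s (x ⊗ₜ[ℝ] y) =
      Z s v (x ⊗ₜ[ℝ] y) - Z s u (x ⊗ₜ[ℝ] leftMul (toTrunc W r (Y u v)) y) := by
  simp [remainder₂]

theorem jointRemainder_apply (X : Set.Icc a b → Set.Icc a b → TensorAlgebra ℝ V)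
    (Y : Set.Icc c d → Set.Icc c d → TensorAlgebra ℝ W)
    (Z : Set.Icc a b → Set.Icc c d → (Trunc V n ⊗[ℝ] Trunc W r →ₗ[ℝ] F)) (s t : Set.Icc a b)
    (u v : Set.Icc c d) (x : Trunc V n) (y : Trunc W r) :
    jointRemainder X Y Z s t u v (x ⊗ₜ[ℝ] y) =
      Z t v (x ⊗ₜ[ℝ] y) - Z s v (leftMul (toTrunc V n (X s t)) x ⊗ₜ[ℝ] y) -
        (Z t u (x ⊗ₜ[ℝ] leftMul (toTrunc W r (Y u v)) y) -
          Z s u (leftMul (toTrunc V n (X s t)) x ⊗ₜ[ℝ] leftMul (toTrunc W r (Y u v)) y)) := by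
  simp [jointRemainder, remainder₁]

variable {A CX CY C : ℝ} {ρX : Set.Icc a b → Set.Icc a b → ℝ}
  {ρY : Set.Icc c d → Set.Icc c d → ℝ} {X : Set.Icc a b → Set.Icc a b → TensorAlgebra ℝ V}
  {Y : Set.Icc c d → Set.Icc c d → TensorAlgebra ℝ W}
  {Z : Set.Icc a b → Set.Icc c d → (Trunc V n ⊗[ℝ] Trunc W r →ₗ[ℝ] F)}

theorem RemainderBounds.norm_remainder₁_sigSum_le (hZ : RemainderBounds C ρX ρY X Y Z)
    (hX : HasPaths n A CX ρX X) {s t : Set.Icc a b} (hst : s ≤ t) (u : Set.Icc c d) {α D : ℝ}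
    (hα : ρX s t ≤ α) {l : List V} (hl : pathLength l ≤ D * α) (y : Trunc W r) :
    ‖remainder₁ X Z s t u (sigSum n l ⊗ₜ[ℝ] y)‖ ≤
      C * (∑ j ∈ Finset.range n, D ^ j) * α ^ n * truncNorm y := by
  refine (norm_sigSum_tmul_le (C := C * truncNorm y)
    (mul_nonneg hZ.nonneg (truncNorm_nonneg y)) (hX.nonneg s t hst) hα hl
    fun j hj η => (hZ.bound₁ s t u hst j hj η y).trans (le_of_eq (by ring))).trans
    (le_of_eq (by ring))

theorem RemainderBounds.norm_remainder₂_sigSum_le (hZ : RemainderBounds C ρX ρY X Y Z)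
    (hY : HasPaths r A CY ρY Y) {u v : Set.Icc c d} (huv : u ≤ v) (s : Set.Icc a b) {β D : ℝ}
    (hβ : ρY u v ≤ β) {l : List W} (hl : pathLength l ≤ D * β) (x : Trunc V n) :
    ‖remainder₂ Y Z u v s (x ⊗ₜ[ℝ] sigSum r l)‖ ≤
      C * (∑ k ∈ Finset.range r, D ^ k) * β ^ r * truncNorm x := by
  refine (norm_tmul_sigSum_le (C := C * truncNorm x)
    (mul_nonneg hZ.nonneg (truncNorm_nonneg x)) (hY.nonneg u v huv) hβ hl
    fun k hk ξ => (hZ.bound₂ u v s huv k hk x ξ).trans (le_of_eq (by ring))).trans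
    (le_of_eq (by ring))

theorem exists_norm_apply_tmul_le [FiniteDimensional ℝ V] [FiniteDimensional ℝ W]
    (z : Trunc V n ⊗[ℝ] Trunc W r →ₗ[ℝ] F) :
    ∃ M : ℝ, 0 ≤ M ∧ ∀ x y, ‖z (x ⊗ₜ[ℝ] y)‖ ≤ M * truncNorm x * truncNorm y := by
  obtain ⟨M, hM0, hM⟩ := exists_forall_norm_incl_tmul_incl_le_of_sigSum (fun _ : Unit => z)
    (α := fun _ => 1) (β := fun _ => 1) (w := fun _ => 1) (by simp) (by simp) (by simp)
    fun l l' => ⟨‖z (sigSum n l ⊗ₜ[ℝ] sigSum r l')‖, by simp [scalePath_one]⟩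
  exact ⟨M, hM0, norm_tmul_le_of_incl fun j hj k hk η ξ => by
    simpa using hM j hj k hk () η ξ⟩

/-- Z at (s, u) is compared with Z at the corner (a, c): one remainder moves the second parameter,
another the first. On signatures the remainders and the concatenated paths are bounded uniformly,
the scale being A itself. -/
theorem RemainderBounds.exists_norm_apply_tmul_le [FiniteDimensional ℝ V] [FiniteDimensional ℝ W]
    (hZ : RemainderBounds C ρX ρY X Y Z) (hX : HasPaths n A CX ρX X) (hY : HasPaths r A CY ρY Y)
    (hab : a ≤ b) (hcd : c ≤ d) (hA : 1 ≤ A) :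
    ∃ M : ℝ, 0 ≤ M ∧ ∀ s u x y, ‖Z s u (x ⊗ₜ[ℝ] y)‖ ≤ M * truncNorm x * truncNorm y := by
  let s₀ : Set.Icc a b := ⟨a, Set.left_mem_Icc.2 hab⟩
  let u₀ : Set.Icc c d := ⟨c, Set.left_mem_Icc.2 hcd⟩
  have hs₀ : ∀ s, s₀ ≤ s := fun s => s.2.1
  have hu₀ : ∀ u, u₀ ≤ u := fun u => u.2.1
  have hA0 : 0 < A := by linarith
  have hCX := hX.const_nonneg
  have hCY := hY.const_nonneg
  have hC := hZ.nonneg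
  obtain ⟨M₀, hM₀0, hM₀⟩ := TwoParam.exists_norm_apply_tmul_le (Z s₀ u₀)
  obtain ⟨M, hM0, hM⟩ := exists_forall_norm_incl_tmul_incl_le_of_sigSum
    (fun q : Set.Icc a b × Set.Icc c d => Z q.1 q.2)
    (α := fun _ => 1) (β := fun _ => 1) (w := fun _ => 1) (by simp) (by simp) (by simp)
    (fun l l' => by
      simp only [scalePath_one, mul_one]
      have hl0 := pathLength_nonneg l
      have hl0' := pathLength_nonneg l'
      set D := pathLength l with hD
      set D' := pathLength l' with hD'
      set T := ∑ j ∈ Finset.range n, (CX * A + D) ^ j with hT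
      set T' := ∑ k ∈ Finset.range r, (CY * A + D') ^ k with hT'
      have hT0 : 0 ≤ T := by positivity
      have hT0' : 0 ≤ T' := by positivity
      refine ⟨C * (∑ k ∈ Finset.range r, D' ^ k) * A ^ r * (∑ j ∈ Finset.range n, D ^ j) +
        (C * (∑ j ∈ Finset.range n, D ^ j) * A ^ n * T' + M₀ * T * T'), ?_⟩
      rintro ⟨s, u⟩
      obtain ⟨m, hm, hm'⟩ := hX.path s₀ s A (hs₀ s) hA0 (hX.lt s₀ s (hs₀ s)).le
      obtain ⟨k, hk, hk'⟩ := hY.path u₀ u A (hu₀ u) hA0 (hY.lt u₀ u (hu₀ u)).le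
      have e₂ := remainder₂_apply Y Z u₀ u s (sigSum n l) (sigSum r l')
      have e₁ := remainder₁_apply X Z s₀ s u₀ (sigSum n l) (sigSum r (k ++ l'))
      rw [leftMul_sigSum hk'] at e₂
      rw [leftMul_sigSum hm'] at e₁
      have hl : pathLength l ≤ D * A := by nlinarith
      have hl' : pathLength l' ≤ D' * A := by nlinarith
      have hml : pathLength (m ++ l) ≤ CX * A + D := by rw [pathLength_append]; linarith
      have hkl : pathLength (k ++ l') ≤ CY * A + D' := by rw [pathLength_append]; linarith
      have h₂ := hZ.norm_remainder₂_sigSum_le hY (hu₀ u) s (hY.lt u₀ u (hu₀ u)).le hl'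
        (sigSum n l)
      have h₁ := hZ.norm_remainder₁_sigSum_le hX (hs₀ s) u₀ (hX.lt s₀ s (hs₀ s)).le hl
        (sigSum r (k ++ l'))
      have h₀ := hM₀ (sigSum n (m ++ l)) (sigSum r (k ++ l'))
      have t₁ : truncNorm (sigSum n (m ++ l)) ≤ T := truncNorm_sigSum_le hml
      have t₂ : truncNorm (sigSum r (k ++ l')) ≤ T' := truncNorm_sigSum_le hkl
      have t₃ : truncNorm (sigSum n l) ≤ ∑ j ∈ Finset.range n, D ^ j := truncNorm_sigSum_le le_rfl
      have e : Z s u (sigSum n l ⊗ₜ[ℝ] sigSum r l') =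
          remainder₂ Y Z u₀ u s (sigSum n l ⊗ₜ[ℝ] sigSum r l') +
          (remainder₁ X Z s₀ s u₀ (sigSum n l ⊗ₜ[ℝ] sigSum r (k ++ l')) +
            Z s₀ u₀ (sigSum n (m ++ l) ⊗ₜ[ℝ] sigSum r (k ++ l'))) := by
        rw [e₁, e₂]; abel
      rw [e]
      refine norm_add_le_of_le (h₂.trans ?_) (norm_add_le_of_le (h₁.trans ?_) (h₀.trans ?_))
      · gcongr
      · gcongr
      · have := truncNorm_nonneg (sigSum r (k ++ l'))
        gcongr)
  exact ⟨M, hM0, fun s u => norm_tmul_le_of_incl fun j hj k hk η ξ => by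
    simpa using hM j hj k hk (s, u) η ξ⟩

/-- Since j < n at least one factor α is left; the others are absorbed into A. -/
theorem pow_sub_le_mul_pow {x α A : ℝ} (hx : 0 ≤ x) (hxα : x ≤ α) (hαA : α ≤ A) (hA : 1 ≤ A)
    {j : ℕ} (hj : j < n) : x ^ (n - j) ≤ A ^ n * α := by
  obtain ⟨m, hm⟩ : ∃ m, n - j = m + 1 := ⟨n - j - 1, by omega⟩
  have hα : 0 ≤ α := hx.trans hxα
  calc x ^ (n - j) ≤ α ^ (n - j) := pow_le_pow_left₀ hx hxα _
    _ = α ^ m * α := by rw [hm, pow_succ]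
    _ ≤ A ^ m * α := by gcongr
    _ ≤ A ^ n * α := by
        gcongr
        omega

/-- The increment is the remainder plus Z applied to (X - 1) ⊗ x, and each is of first order. Only
continuity is wanted from this, so higher orders are given away. -/
theorem RemainderBounds.exists_norm_sub_le_left [FiniteDimensional ℝ V]
    (hZ : RemainderBounds C ρX ρY X Y Z) (hX : HasPaths n A CX ρX X) (hn : 0 < n) (hA : 1 ≤ A)
    {M : ℝ} (hM0 : 0 ≤ M)
    (hM : ∀ s u x y, ‖Z s u (x ⊗ₜ[ℝ] y)‖ ≤ M * truncNorm x * truncNorm y)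
    (x : Trunc V n) (y : Trunc W r) :
    ∃ K : ℝ, ∀ s t u, s ≤ t → ‖Z t u (x ⊗ₜ[ℝ] y) - Z s u (x ⊗ₜ[ℝ] y)‖ ≤ K * ρX s t := by
  obtain ⟨K, hK0, hK⟩ := exists_truncNorm_leftMul_sub_le hn x (A := A) (by linarith)
    hX.const_nonneg
  refine ⟨C * truncNorm y * A ^ n * truncNorm x + M * K * truncNorm y, fun s t u hst => ?_⟩
  have hC := hZ.nonneg
  have hy := truncNorm_nonneg y
  have hρ := hX.nonneg s t hst
  rw [← pow_one (ρX s t)]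
  refine le_of_forall_pow (hX.lt s t hst) 1 (fun α hα hρα hαA => ?_) hρ
  obtain ⟨l, hl, hl'⟩ := hX.path s t α hst hα hρα
  have e : Z t u (x ⊗ₜ[ℝ] y) - Z s u (x ⊗ₜ[ℝ] y) = remainder₁ X Z s t u (x ⊗ₜ[ℝ] y) +
      Z s u ((leftMul (toTrunc V n (X s t)) x - x) ⊗ₜ[ℝ] y) := by
    rw [remainder₁_apply, TensorProduct.sub_tmul, map_sub]; abel
  rw [e, pow_one, add_mul]
  refine norm_add_le_of_le ?_ ?_
  · refine (norm_tmul_le_of_incl_left (C := fun j => C * truncNorm y * (A ^ n * α))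
      fun j hj η => (hZ.bound₁ s t u hst j hj η y).trans ?_).trans (le_of_eq ?_)
    · have := pow_sub_le_mul_pow hρ hρα hαA hA hj
      calc C * ρX s t ^ (n - j) * ‖η‖ * truncNorm y ≤ C * (A ^ n * α) * ‖η‖ * truncNorm y := by
            gcongr
        _ = _ := by ring
    · rw [← Finset.mul_sum, truncNorm.eq_def x]; ring
  · refine (hM s u _ _).trans ?_
    calc M * truncNorm (leftMul (toTrunc V n (X s t)) x - x) * truncNorm y
        ≤ M * (K * α) * truncNorm y := by gcongr; exact hK _ l α hl' hα.le hαA hl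
      _ = _ := by ring

theorem RemainderBounds.exists_norm_sub_le_right [FiniteDimensional ℝ W]
    (hZ : RemainderBounds C ρX ρY X Y Z) (hY : HasPaths r A CY ρY Y) (hr : 0 < r) (hA : 1 ≤ A)
    {M : ℝ} (hM0 : 0 ≤ M)
    (hM : ∀ s u x y, ‖Z s u (x ⊗ₜ[ℝ] y)‖ ≤ M * truncNorm x * truncNorm y)
    (x : Trunc V n) (y : Trunc W r) :
    ∃ K : ℝ, ∀ s u v, u ≤ v → ‖Z s v (x ⊗ₜ[ℝ] y) - Z s u (x ⊗ₜ[ℝ] y)‖ ≤ K * ρY u v := by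
  obtain ⟨K, hK0, hK⟩ := exists_truncNorm_leftMul_sub_le hr y (A := A) (by linarith)
    hY.const_nonneg
  refine ⟨C * truncNorm x * A ^ r * truncNorm y + M * K * truncNorm x, fun s u v huv => ?_⟩
  have hC := hZ.nonneg
  have hx := truncNorm_nonneg x
  have hρ := hY.nonneg u v huv
  rw [← pow_one (ρY u v)]
  refine le_of_forall_pow (hY.lt u v huv) 1 (fun β hβ hρβ hβA => ?_) hρ
  obtain ⟨l, hl, hl'⟩ := hY.path u v β huv hβ hρβ
  have e : Z s v (x ⊗ₜ[ℝ] y) - Z s u (x ⊗ₜ[ℝ] y) = remainder₂ Y Z u v s (x ⊗ₜ[ℝ] y) +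
      Z s u (x ⊗ₜ[ℝ] (leftMul (toTrunc W r (Y u v)) y - y)) := by
    rw [remainder₂_apply, TensorProduct.tmul_sub, map_sub]; abel
  rw [e, pow_one, add_mul]
  refine norm_add_le_of_le ?_ ?_
  · refine (norm_tmul_le_of_incl_right (C := fun k => C * truncNorm x * (A ^ r * β))
      fun k hk ξ => (hZ.bound₂ u v s huv k hk x ξ).trans ?_).trans (le_of_eq ?_)
    · have := pow_sub_le_mul_pow hρ hρβ hβA hA hk
      calc C * ρY u v ^ (r - k) * truncNorm x * ‖ξ‖ ≤ C * (A ^ r * β) * truncNorm x * ‖ξ‖ := by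
            gcongr
        _ = _ := by ring
    · rw [← Finset.mul_sum, truncNorm.eq_def y]; ring
  · refine (hM s u _ _).trans ?_
    calc M * truncNorm x * truncNorm (leftMul (toTrunc W r (Y u v)) y - y)
        ≤ M * truncNorm x * (K * β) := by gcongr; exact hK _ l β hl' hβ.le hβA hl
      _ = _ := by ring

-- The increments are controlled for ordered times only; `min` and `max` make the modulus symmetric,
-- and a joint increment is split into one in each parameter.
omit [NormedSpace ℝ F] in
theorem continuous_of_norm_sub_le_modulus {f : Set.Icc a b × Set.Icc c d → F} {K K' : ℝ}
    (hX : Continuous fun q : Set.Icc a b × Set.Icc a b => ρX (min q.1 q.2) (max q.1 q.2))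
    (hX0 : ∀ s, ρX s s = 0)
    (hY : Continuous fun q : Set.Icc c d × Set.Icc c d => ρY (min q.1 q.2) (max q.1 q.2))
    (hY0 : ∀ u, ρY u u = 0)
    (h₁ : ∀ s t u, s ≤ t → ‖f (t, u) - f (s, u)‖ ≤ K * ρX s t)
    (h₂ : ∀ s u v, u ≤ v → ‖f (s, v) - f (s, u)‖ ≤ K' * ρY u v) : Continuous f := by
  have h₁' : ∀ s t u, ‖f (t, u) - f (s, u)‖ ≤ K * ρX (min s t) (max s t) := by
    intro s t u
    rcases le_total s t with h | h
    · rw [min_eq_left h, max_eq_right h]; exact h₁ s t u h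
    · rw [min_eq_right h, max_eq_left h, norm_sub_rev]; exact h₁ t s u h
  have h₂' : ∀ s u v, ‖f (s, v) - f (s, u)‖ ≤ K' * ρY (min u v) (max u v) := by
    intro s u v
    rcases le_total u v with h | h
    · rw [min_eq_left h, max_eq_right h]; exact h₂ s u v h
    · rw [min_eq_right h, max_eq_left h, norm_sub_rev]; exact h₂ s v u h
  rw [continuous_iff_continuousAt]
  rintro ⟨s, u⟩
  rw [ContinuousAt, tendsto_iff_norm_sub_tendsto_zero]
  have hX' : Continuous fun q : Set.Icc a b × Set.Icc c d => ρX (min s q.1) (max s q.1) :=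
    hX.comp (continuous_const.prodMk continuous_fst)
  have hY' : Continuous fun q : Set.Icc a b × Set.Icc c d => ρY (min u q.2) (max u q.2) :=
    hY.comp (continuous_const.prodMk continuous_snd)
  have hlim : Filter.Tendsto (fun q : Set.Icc a b × Set.Icc c d =>
      K * ρX (min s q.1) (max s q.1) + K' * ρY (min u q.2) (max u q.2)) (nhds (s, u)) (nhds 0) := by
    have h : Continuous fun q : Set.Icc a b × Set.Icc c d =>
        K * ρX (min s q.1) (max s q.1) + K' * ρY (min u q.2) (max u q.2) :=
      (continuous_const.mul hX').add (continuous_const.mul hY')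
    simpa [hX0, hY0] using h.tendsto (s, u)
  refine squeeze_zero (fun _ => norm_nonneg _) (fun q => ?_) hlim
  calc ‖f q - f (s, u)‖ = ‖(f (q.1, q.2) - f (s, q.2)) + (f (s, q.2) - f (s, u))‖ := by
        congr 1; abel
    _ ≤ _ := norm_add_le_of_le (h₁' _ _ _) (h₂' _ _ _)

end Controlled

/-! ### The polynomials attached to a controlled path -/

section SignatureCoefficients

variable {V W F S : Type*} [NormedAddCommGroup V] [NormedSpace ℝ V]
  [NormedAddCommGroup W] [NormedSpace ℝ W] [NormedAddCommGroup F] [NormedSpace ℝ F]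
  [NormedAddCommGroup S] [NormedSpace ℝ S] {n r : ℕ}

theorem colSum_sigCoeff (z : Trunc V n ⊗[ℝ] Trunc W r →ₗ[ℝ] F) (l : List V) (l' : List W) (k : ℕ) :
    colSum n (sigCoeff z l l') k = z (sigSum n l ⊗ₜ[ℝ] sigTrunc r l' k) := by
  simp [colSum, sigCoeff, sigSum, TensorProduct.sum_tmul]

theorem rowSum_sigCoeff (z : Trunc V n ⊗[ℝ] Trunc W r →ₗ[ℝ] F) (l : List V) (l' : List W) (i : ℕ) :
    rowSum r (sigCoeff z l l') i = z (sigTrunc n l i ⊗ₜ[ℝ] sigSum r l') := by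
  simp [rowSum, sigCoeff, sigSum, TensorProduct.tmul_sum]

theorem polyEval_sigCoeff (z : Trunc V n ⊗[ℝ] Trunc W r →ₗ[ℝ] F) (l : List V) (l' : List W)
    (x y : ℝ) : polyEval n r (sigCoeff z l l') (x, y) =
      z (sigSum n (scalePath x l) ⊗ₜ[ℝ] sigSum r (scalePath y l')) := by
  simp only [polyEval, sigCoeff, sigSum, TensorProduct.sum_tmul, TensorProduct.tmul_sum, map_sum,
    sigTrunc_scalePath, TensorProduct.smul_tmul_smul, map_smul]
  exact Finset.sum_comm

theorem polyEval_sigCoeff_one (z : Trunc V n ⊗[ℝ] Trunc W r →ₗ[ℝ] F) (l : List V) (l' : List W) :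
    polyEval n r (sigCoeff z l l') (1, 1) = z (sigSum n l ⊗ₜ[ℝ] sigSum r l') := by
  rw [polyEval_sigCoeff, scalePath_one, scalePath_one]

theorem DecayingCoeffs.mono {K : Set F} {B B' a b : ℝ} {c : ℕ → ℕ → F}
    (h : DecayingCoeffs n r K B a b c) (hB : B ≤ B') (ha : 0 ≤ a) (hb : 0 ≤ b) :
    DecayingCoeffs n r K B' a b c :=
  ⟨fun i hi k hk => (h.bound i hi k hk).trans (mul_le_mul_of_nonneg_right hB (by positivity)),
    h.mem⟩

theorem truncNorm_sigSum_scalePath_le {l : List V} {x D : ℝ} (hx : x ∈ Set.Icc (0 : ℝ) 1)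
    (hl : pathLength l ≤ D) : truncNorm (sigSum n (scalePath x l)) ≤ ∑ j ∈ Finset.range n, D ^ j := by
  refine truncNorm_sigSum_le ?_
  rw [pathLength_scalePath, abs_of_nonneg hx.1]
  exact (mul_le_of_le_one_left (pathLength_nonneg l) hx.2).trans hl

/-- Level i of the signature of a path of length D α is at most D ^ i α ^ i, and D ≥ 1 allows the
uniform factor D ^ n. The polynomial at (x, y) is z on the scaled paths, whose signatures stay in
the ball of radius T. -/
theorem decayingCoeffs_sigCoeff {z : Trunc V n ⊗[ℝ] Trunc W r →ₗ[ℝ] F} {K : Set F}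
    {M D α β A T : ℝ} (hM0 : 0 ≤ M) (hD : 1 ≤ D) (hα : 0 < α) (hαA : α ≤ A) (hβ : 0 < β)
    (hβA : β ≤ A) (hM : ∀ x y, ‖z (x ⊗ₜ[ℝ] y)‖ ≤ M * truncNorm x * truncNorm y)
    (hT : ∑ j ∈ Finset.range n, (D * A) ^ j ≤ T) (hT' : ∑ k ∈ Finset.range r, (D * A) ^ k ≤ T)
    (hK : ∀ x y, truncNorm x ≤ T → truncNorm y ≤ T → z (x ⊗ₜ[ℝ] y) ∈ K)
    {l : List V} {l' : List W} (hl : pathLength l ≤ D * α) (hl' : pathLength l' ≤ D * β) :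
    DecayingCoeffs n r K (M * (D ^ n * D ^ r)) α β (sigCoeff z l l') where
  bound i hi k hk := by
    refine (hM _ _).trans ?_
    have h₁ : truncNorm (sigTrunc n l i) ≤ D ^ n * α ^ i :=
      calc truncNorm (sigTrunc n l i) ≤ (D * α) ^ i := (truncNorm_sigTrunc_le hi l).trans
            (pow_le_pow_left₀ (pathLength_nonneg l) hl i)
        _ = D ^ i * α ^ i := mul_pow _ _ _
        _ ≤ D ^ n * α ^ i := by gcongr
    have h₂ : truncNorm (sigTrunc r l' k) ≤ D ^ r * β ^ k :=
      calc truncNorm (sigTrunc r l' k) ≤ (D * β) ^ k := (truncNorm_sigTrunc_le hk l').trans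
            (pow_le_pow_left₀ (pathLength_nonneg l') hl' k)
        _ = D ^ k * β ^ k := mul_pow _ _ _
        _ ≤ D ^ r * β ^ k := by gcongr
    have h₃ := truncNorm_nonneg (sigTrunc r l' k)
    calc M * truncNorm (sigTrunc n l i) * truncNorm (sigTrunc r l' k)
        ≤ M * (D ^ n * α ^ i) * (D ^ r * β ^ k) := by gcongr
      _ = _ := by ring
  mem x hx y hy := by
    rw [polyEval_sigCoeff]
    exact hK _ _
      ((truncNorm_sigSum_scalePath_le hx (hl.trans (by gcongr))).trans hT)
      ((truncNorm_sigSum_scalePath_le hy (hl'.trans (by gcongr))).trans hT')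

/-- In infinite dimension continuous derivatives need not be bounded on bounded sets, so compactness
is used. The values in question lie in the continuous image Q of a compact set of times and
coordinates. In a Banach space the convex hull of Q is totally bounded, so its closure is compact.
-/
theorem exists_convex_boundedDerivsOn [FiniteDimensional ℝ V] [FiniteDimensional ℝ W]
    [CompleteSpace F] {a b c d : ℝ} {g : F → S} (hg : ContDiff ℝ (⊤ : ℕ∞) g)
    {Z : Set.Icc a b → Set.Icc c d → (Trunc V n ⊗[ℝ] Trunc W r →ₗ[ℝ] F)}
    (hZ : ∀ x y, Continuous fun q : Set.Icc a b × Set.Icc c d => Z q.1 q.2 (x ⊗ₜ[ℝ] y)) (T : ℝ) :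
    ∃ K : Set F, Convex ℝ K ∧ BoundedDerivsOn g K ∧
      ∀ s u x y, truncNorm x ≤ T → truncNorm y ≤ T → Z s u (x ⊗ₜ[ℝ] y) ∈ K := by
  let e := Module.finBasis ℝ (Trunc V n)
  let e' := Module.finBasis ℝ (Trunc W r)
  choose D hD0 hD using fun i => exists_norm_trunc_le (e.coord i)
  choose D' hD0' hD' using fun i => exists_norm_trunc_le (e'.coord i)
  let Φ : (Set.Icc a b × Set.Icc c d) × (Fin (Module.finrank ℝ (Trunc V n)) → ℝ) ×
      (Fin (Module.finrank ℝ (Trunc W r)) → ℝ) → F := fun q =>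
    ∑ i, ∑ k, (q.2.1 i * q.2.2 k) • Z q.1.1 q.1.2 (e i ⊗ₜ[ℝ] e' k)
  have hΦ : Continuous Φ := by
    refine continuous_finsetSum _ fun i _ => continuous_finsetSum _ fun k _ => ?_
    refine Continuous.smul (by fun_prop) ((hZ (e i) (e' k)).comp continuous_fst)
  let Q := Φ '' (Set.univ ×ˢ (Set.univ.pi fun i => Set.Icc (-(D i * T)) (D i * T)) ×ˢ
    (Set.univ.pi fun k => Set.Icc (-(D' k * T)) (D' k * T)))
  have hQ : IsCompact Q := (isCompact_univ.prod ((isCompact_univ_pi fun _ => isCompact_Icc).prod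
    (isCompact_univ_pi fun _ => isCompact_Icc))).image hΦ
  have hK : IsCompact (closure (convexHull ℝ Q)) :=
    (totallyBounded_convexHull.2 hQ.totallyBounded).closure.isCompact_of_isComplete
      isClosed_closure.isComplete
  refine ⟨convexHull ℝ Q, convex_convexHull ℝ Q, fun m => ?_, fun s u x y hx hy => ?_⟩
  · obtain ⟨M, hM⟩ := hK.exists_bound_of_continuousOn
      (hg.continuous_iteratedFDeriv (m := m) (by exact_mod_cast le_top)).continuousOn
    exact ⟨M, fun x hx => hM x (subset_closure hx)⟩
  · refine subset_convexHull ℝ Q ⟨((s, u), (e.repr x, e'.repr y)), ⟨Set.mem_univ _, ?_, ?_⟩, ?_⟩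
    · intro i _
      exact abs_le.1 ((hD i x).trans (mul_le_mul_of_nonneg_left hx (hD0 i)))
    · intro i _
      exact abs_le.1 ((hD' i y).trans (mul_le_mul_of_nonneg_left hy (hD0' i)))
    · conv_rhs => rw [← e.sum_repr x, ← e'.sum_repr y]
      simp only [Φ, TensorProduct.sum_tmul, TensorProduct.tmul_sum, map_sum,
        TensorProduct.smul_tmul_smul, map_smul]
      exact Finset.sum_comm

end SignatureCoefficients

/-! ### Remainders of the composition -/

section Composition

variable {V W F S : Type*} [NormedAddCommGroup V] [NormedSpace ℝ V] [FiniteDimensional ℝ V]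
  [NormedAddCommGroup W] [NormedSpace ℝ W] [FiniteDimensional ℝ W] [NormedAddCommGroup F]
  [NormedSpace ℝ F] [CompleteSpace F] [NormedAddCommGroup S] [NormedSpace ℝ S]
  {a b c d : ℝ} {n r : ℕ} {A CX CY C : ℝ} {ρX : Set.Icc a b → Set.Icc a b → ℝ}
  {ρY : Set.Icc c d → Set.Icc c d → ℝ} {X : Set.Icc a b → Set.Icc a b → TensorAlgebra ℝ V}
  {Y : Set.Icc c d → Set.Icc c d → TensorAlgebra ℝ W}
  {Z : Set.Icc a b → Set.Icc c d → (Trunc V n ⊗[ℝ] Trunc W r →ₗ[ℝ] F)}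

/-- Collects the analytic input on Z. The set K and the constant B depend on D, but not on the
times, the scales or the paths. -/
theorem RemainderBounds.exists_decayingCoeffs (hZ : RemainderBounds C ρX ρY X Y Z)
    (hX : HasPaths n A CX ρX X) (hY : HasPaths r A CY ρY Y) (hab : a ≤ b) (hcd : c ≤ d)
    (hA : 1 ≤ A) (hn : 0 < n) (hr : 0 < r) {g : F → S} (hg : ContDiff ℝ (⊤ : ℕ∞) g) {D : ℝ}
    (hD : 1 ≤ D) : ∃ (K : Set F) (B : ℝ), Convex ℝ K ∧ BoundedDerivsOn g K ∧ 0 ≤ B ∧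
      ∀ s u α β (l : List V) (l' : List W), 0 < α → α ≤ A → 0 < β → β ≤ A →
        pathLength l ≤ D * α → pathLength l' ≤ D * β →
        DecayingCoeffs n r K B α β (sigCoeff (Z s u) l l') := by
  obtain ⟨M, hM0, hM⟩ := hZ.exists_norm_apply_tmul_le hX hY hab hcd hA
  have hZc : ∀ x y, Continuous fun q : Set.Icc a b × Set.Icc c d => Z q.1 q.2 (x ⊗ₜ[ℝ] y) := by
    intro x y
    obtain ⟨K, hK⟩ := hZ.exists_norm_sub_le_left hX hn hA hM0 hM x y
    obtain ⟨K', hK'⟩ := hZ.exists_norm_sub_le_right hY hr hA hM0 hM x y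
    exact continuous_of_norm_sub_le_modulus hX.continuous hX.diag hY.continuous hY.diag hK hK'
  obtain ⟨K, hKc, hK, hmem⟩ := exists_convex_boundedDerivsOn hg hZc
    (∑ j ∈ Finset.range n, (D * A) ^ j + ∑ k ∈ Finset.range r, (D * A) ^ k)
  refine ⟨K, M * (D ^ n * D ^ r), hKc, hK, by positivity, ?_⟩
  intro s u α β l l' hα hαA hβ hβA hl hl'
  have h₁ : 0 ≤ ∑ j ∈ Finset.range n, (D * A) ^ j := by positivity
  have h₂ : 0 ≤ ∑ k ∈ Finset.range r, (D * A) ^ k := by positivity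
  exact decayingCoeffs_sigCoeff hM0 hD hα hαA hβ hβA (hM s u) (by linarith) (by linarith)
    (hmem s u) hl hl'

-- By Chen's identity this difference is the first-level remainder of Z on a signature times a level
-- k. It is the hypothesis of `exists_norm_taylorSum₂_sub_le_left`.
omit [FiniteDimensional ℝ V] [FiniteDimensional ℝ W] [CompleteSpace F] in
theorem RemainderBounds.norm_colSum_sub_le (hZ : RemainderBounds C ρX ρY X Y Z)
    (hX : HasPaths n A CX ρX X) {s t : Set.Icc a b} (hst : s ≤ t) (u : Set.Icc c d) {α β D : ℝ}
    (hD : 1 ≤ D) (hα : 0 < α) (hβ : 0 < β) (hρ : ρX s t ≤ α) {m l : List V} {l' : List W}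
    (hm : ∀ k < n, proj V k (X s t) = sigLevel m k) (hl : pathLength l ≤ D * α)
    (hl' : pathLength l' ≤ D * β) {k : ℕ} (hk : k < r) :
    ‖colSum n (sigCoeff (Z t u) l l') k - colSum n (sigCoeff (Z s u) (m ++ l) l') k‖ ≤
      C * (∑ j ∈ Finset.range n, D ^ j) * D ^ r * (α ^ n * β ^ k) := by
  have e := remainder₁_apply X Z s t u (sigSum n l) (sigTrunc r l' k)
  rw [leftMul_sigSum hm] at e
  rw [colSum_sigCoeff, colSum_sigCoeff, ← e]
  refine (hZ.norm_remainder₁_sigSum_le hX hst u hρ hl _).trans ?_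
  have hC := hZ.nonneg
  have h : truncNorm (sigTrunc r l' k) ≤ D ^ r * β ^ k :=
    calc truncNorm (sigTrunc r l' k) ≤ (D * β) ^ k := (truncNorm_sigTrunc_le hk l').trans
          (pow_le_pow_left₀ (pathLength_nonneg l') hl' k)
      _ = D ^ k * β ^ k := mul_pow _ _ _
      _ ≤ D ^ r * β ^ k := by gcongr
  calc C * (∑ j ∈ Finset.range n, D ^ j) * α ^ n * truncNorm (sigTrunc r l' k)
      ≤ C * (∑ j ∈ Finset.range n, D ^ j) * α ^ n * (D ^ r * β ^ k) := by gcongr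
    _ = _ := by ring

omit [FiniteDimensional ℝ V] [FiniteDimensional ℝ W] [CompleteSpace F] in
theorem RemainderBounds.norm_rowSum_sub_le (hZ : RemainderBounds C ρX ρY X Y Z)
    (hY : HasPaths r A CY ρY Y) {u v : Set.Icc c d} (huv : u ≤ v) (s : Set.Icc a b) {α β D : ℝ}
    (hD : 1 ≤ D) (hα : 0 < α) (hβ : 0 < β) (hρ : ρY u v ≤ β) {l : List V} {m' l' : List W}
    (hm' : ∀ k < r, proj W k (Y u v) = sigLevel m' k) (hl : pathLength l ≤ D * α)
    (hl' : pathLength l' ≤ D * β) {i : ℕ} (hi : i < n) :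
    ‖rowSum r (sigCoeff (Z s v) l l') i - rowSum r (sigCoeff (Z s u) l (m' ++ l')) i‖ ≤
      C * (∑ k ∈ Finset.range r, D ^ k) * D ^ n * (α ^ i * β ^ r) := by
  have e := remainder₂_apply Y Z u v s (sigTrunc n l i) (sigSum r l')
  rw [leftMul_sigSum hm'] at e
  rw [rowSum_sigCoeff, rowSum_sigCoeff, ← e]
  refine (hZ.norm_remainder₂_sigSum_le hY huv s hρ hl' _).trans ?_
  have hC := hZ.nonneg
  have h : truncNorm (sigTrunc n l i) ≤ D ^ n * α ^ i :=
    calc truncNorm (sigTrunc n l i) ≤ (D * α) ^ i := (truncNorm_sigTrunc_le hi l).trans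
          (pow_le_pow_left₀ (pathLength_nonneg l) hl i)
      _ = D ^ i * α ^ i := mul_pow _ _ _
      _ ≤ D ^ n * α ^ i := by gcongr
  calc C * (∑ k ∈ Finset.range r, D ^ k) * β ^ r * truncNorm (sigTrunc n l i)
      ≤ C * (∑ k ∈ Finset.range r, D ^ k) * β ^ r * (D ^ n * α ^ i) := by gcongr
    _ = _ := by ring

omit [FiniteDimensional ℝ V] in
theorem pathLength_scalePath_le {α D : ℝ} (hα : 0 < α) {l : List V} (hl : pathLength l ≤ D) :
    pathLength (scalePath α l) ≤ D * α := by
  rw [pathLength_scalePath, abs_of_pos hα, mul_comm]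
  gcongr

omit [FiniteDimensional ℝ V] in
theorem pathLength_append_scalePath_le {α D D' : ℝ} (hα : 0 < α) {m l : List V}
    (hm : pathLength m ≤ D' * α) (hl : pathLength l + D' ≤ D) :
    pathLength (m ++ scalePath α l) ≤ D * α := by
  rw [pathLength_append, pathLength_scalePath, abs_of_pos hα]
  nlinarith

variable [CompleteSpace S] {g : F → S}

/-- Both parts of the remainder are truncated Taylor polynomials, of Z t u along the scaled path and
of Z s u along its concatenation with the path of X s t. No smallness is asked for in the second
direction, so its scale is set to 1. -/
theorem RemainderBounds.exists_norm_remainder₁_compMap_le (hZ : RemainderBounds C ρX ρY X Y Z)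
    (hX : HasPaths n A CX ρX X) (hY : HasPaths r A CY ρY Y) (hab : a ≤ b) (hcd : c ≤ d)
    (hA : 1 ≤ A) (hn : 0 < n) (hr : 0 < r) (hg : ContDiff ℝ (⊤ : ℕ∞) g) (l : List V)
    (l' : List W) : ∃ C' : ℝ, ∀ s t u α, s ≤ t → 0 < α → ρX s t ≤ α → α ≤ A →
      ‖remainder₁ X (fun t v => compMap g (Z t v)) s t u
        (sigSum n (scalePath α l) ⊗ₜ[ℝ] sigSum r l')‖ ≤ C' * α ^ n := by
  have hCX := hX.const_nonneg
  have hl0 := pathLength_nonneg l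
  have hl0' := pathLength_nonneg l'
  -- Bounds the lengths of the scaled path and of the concatenation in units of α, and that of l' in
  -- units of 1.
  set D := 1 + CX + pathLength l + pathLength l' with hD
  have hD1 : 1 ≤ D := by linarith
  obtain ⟨K, B, hKc, hK, hB0, hB⟩ := hZ.exists_decayingCoeffs hX hY hab hcd hA hn hr hg hD1
  have hC := hZ.nonneg
  set B₁ := C * (∑ j ∈ Finset.range n, D ^ j) * D ^ r with hB₁
  have hB₁0 : 0 ≤ B₁ := by positivity
  obtain ⟨C', -, hC'⟩ := exists_norm_taylorSum₂_sub_le_left hg hK hKc n r A (B + B₁)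
  refine ⟨C', fun s t u α hst hα hρ hαA => ?_⟩
  obtain ⟨m, hm, hm'⟩ := hX.path s t α hst hα hρ
  have hαl : pathLength (scalePath α l) ≤ D * α := pathLength_scalePath_le hα (by linarith)
  have hml : pathLength (m ++ scalePath α l) ≤ D * α :=
    pathLength_append_scalePath_le hα hm (by linarith)
  have hl' : pathLength l' ≤ D * 1 := by linarith
  rw [remainder₁_apply, leftMul_sigSum hm', compMap_sigSum hg hn hr, compMap_sigSum hg hn hr]
  refine hC' α 1 hα hαA one_pos hA _ _
    ((hB t u α 1 _ _ hα hαA one_pos hA hαl hl').mono (by linarith) hα.le zero_le_one)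
    ((hB s u α 1 _ _ hα hαA one_pos hA hml hl').mono (by linarith) hα.le zero_le_one)
    fun k hk => ?_
  refine (hZ.norm_colSum_sub_le hX hst u hD1 hα one_pos hρ hm' hαl hl' hk).trans ?_
  gcongr
  linarith

theorem RemainderBounds.exists_norm_remainder₂_compMap_le (hZ : RemainderBounds C ρX ρY X Y Z)
    (hX : HasPaths n A CX ρX X) (hY : HasPaths r A CY ρY Y) (hab : a ≤ b) (hcd : c ≤ d)
    (hA : 1 ≤ A) (hn : 0 < n) (hr : 0 < r) (hg : ContDiff ℝ (⊤ : ℕ∞) g) (l : List V)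
    (l' : List W) : ∃ C' : ℝ, ∀ u v s β, u ≤ v → 0 < β → ρY u v ≤ β → β ≤ A →
      ‖remainder₂ Y (fun t v => compMap g (Z t v)) u v s
        (sigSum n l ⊗ₜ[ℝ] sigSum r (scalePath β l'))‖ ≤ C' * β ^ r := by
  have hCY := hY.const_nonneg
  have hl0 := pathLength_nonneg l
  have hl0' := pathLength_nonneg l'
  set D := 1 + CY + pathLength l + pathLength l' with hD
  have hD1 : 1 ≤ D := by linarith
  obtain ⟨K, B, hKc, hK, hB0, hB⟩ := hZ.exists_decayingCoeffs hX hY hab hcd hA hn hr hg hD1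
  have hC := hZ.nonneg
  set B₁ := C * (∑ k ∈ Finset.range r, D ^ k) * D ^ n with hB₁
  have hB₁0 : 0 ≤ B₁ := by positivity
  obtain ⟨C', -, hC'⟩ := exists_norm_taylorSum₂_sub_le_right hg hK hKc n r A (B + B₁)
  refine ⟨C', fun u v s β huv hβ hρ hβA => ?_⟩
  obtain ⟨m, hm, hm'⟩ := hY.path u v β huv hβ hρ
  have hβl : pathLength (scalePath β l') ≤ D * β := pathLength_scalePath_le hβ (by linarith)
  have hml : pathLength (m ++ scalePath β l') ≤ D * β :=
    pathLength_append_scalePath_le hβ hm (by linarith)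
  have hl : pathLength l ≤ D * 1 := by linarith
  rw [remainder₂_apply, leftMul_sigSum hm', compMap_sigSum hg hn hr, compMap_sigSum hg hn hr]
  refine hC' 1 β one_pos hA hβ hβA _ _
    ((hB s v 1 β _ _ one_pos hA hβ hβA hl hβl).mono (by linarith) zero_le_one hβ.le)
    ((hB s u 1 β _ _ one_pos hA hβ hβA hl hml).mono (by linarith) zero_le_one hβ.le)
    fun i hi => ?_
  refine (hZ.norm_rowSum_sub_le hY huv s hD1 one_pos hβ hρ hm' hl hβl hi).trans ?_
  gcongr
  linarith

/-- The bound on the second-level remainder, in terms of moduli. -/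
def JointBound (C : ℝ) (ρX : Set.Icc a b → Set.Icc a b → ℝ) (ρY : Set.Icc c d → Set.Icc c d → ℝ)
    (X : Set.Icc a b → Set.Icc a b → TensorAlgebra ℝ V)
    (Y : Set.Icc c d → Set.Icc c d → TensorAlgebra ℝ W)
    (Z : Set.Icc a b → Set.Icc c d → (Trunc V n ⊗[ℝ] Trunc W r →ₗ[ℝ] F)) : Prop :=
  ∀ s t u v, s ≤ t → u ≤ v → ∀ j < n, ∀ k < r, ∀ (η : ⨂[ℝ]^j V) (ξ : ⨂[ℝ]^k W),
    ‖jointRemainder X Y Z s t u v (incl V n j η ⊗ₜ[ℝ] incl W r k ξ)‖ ≤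
      C * ρX s t ^ (n - j) * ρY u v ^ (r - k) * ‖η‖ * ‖ξ‖

/-- The four terms are Taylor polynomials at the corners of [s,t] × [u,v], with the path of X s t
prepended at s and that of Y u v at u. Horizontal and vertical first differences are controlled by
the two first-level remainders of Z, the second difference of the values by its second-level
remainder. -/
theorem RemainderBounds.exists_norm_jointRemainder_compMap_le
    (hZ : RemainderBounds C ρX ρY X Y Z) {C₂ : ℝ} (hC₂ : 0 ≤ C₂)
    (hJ : JointBound C₂ ρX ρY X Y Z) (hX : HasPaths n A CX ρX X) (hY : HasPaths r A CY ρY Y)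
    (hab : a ≤ b) (hcd : c ≤ d) (hA : 1 ≤ A) (hn : 0 < n) (hr : 0 < r)
    (hg : ContDiff ℝ (⊤ : ℕ∞) g) (l : List V) (l' : List W) :
    ∃ C' : ℝ, ∀ s t u v α β, s ≤ t → u ≤ v → 0 < α → ρX s t ≤ α → α ≤ A →
      0 < β → ρY u v ≤ β → β ≤ A →
      ‖jointRemainder X Y (fun t v => compMap g (Z t v)) s t u v
        (sigSum n (scalePath α l) ⊗ₜ[ℝ] sigSum r (scalePath β l'))‖ ≤ C' * (α ^ n * β ^ r) := by
  have hCX := hX.const_nonneg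
  have hCY := hY.const_nonneg
  have hl0 := pathLength_nonneg l
  have hl0' := pathLength_nonneg l'
  set D := 1 + CX + CY + pathLength l + pathLength l' with hD
  have hD1 : 1 ≤ D := by linarith
  obtain ⟨K, B, hKc, hK, hB0, hB⟩ := hZ.exists_decayingCoeffs hX hY hab hcd hA hn hr hg hD1
  have hC := hZ.nonneg
  set B₁ := C * (∑ j ∈ Finset.range n, D ^ j) * D ^ r with hB₁
  set B₂ := C * (∑ k ∈ Finset.range r, D ^ k) * D ^ n with hB₂
  set B₃ := C₂ * (∑ j ∈ Finset.range n, D ^ j) * (∑ k ∈ Finset.range r, D ^ k) with hB₃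
  have hB₁0 : 0 ≤ B₁ := by positivity
  have hB₂0 : 0 ≤ B₂ := by positivity
  have hB₃0 : 0 ≤ B₃ := by positivity
  obtain ⟨C', -, hC'⟩ := exists_norm_taylorSum₂_second_difference_le hg hK hKc n r A
    (B + B₁ + B₂ + B₃)
  refine ⟨C', fun s t u v α β hst huv hα hρα hαA hβ hρβ hβA => ?_⟩
  obtain ⟨m, hm, hm'⟩ := hX.path s t α hst hα hρα
  obtain ⟨k, hk, hk'⟩ := hY.path u v β huv hβ hρβ
  have hαl : pathLength (scalePath α l) ≤ D * α := pathLength_scalePath_le hα (by linarith)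
  have hml : pathLength (m ++ scalePath α l) ≤ D * α :=
    pathLength_append_scalePath_le hα hm (by linarith)
  have hβl : pathLength (scalePath β l') ≤ D * β := pathLength_scalePath_le hβ (by linarith)
  have hkl : pathLength (k ++ scalePath β l') ≤ D * β :=
    pathLength_append_scalePath_le hβ hk (by linarith)
  have hα0 := hα.le
  have hβ0 := hβ.le
  have hdec : ∀ s u (l : List V) (l' : List W), pathLength l ≤ D * α → pathLength l' ≤ D * β →
      DecayingCoeffs n r K (B + B₁ + B₂ + B₃) α β (sigCoeff (Z s u) l l') := fun s u l l' h h' =>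
    (hB s u α β l l' hα hαA hβ hβA h h').mono (by linarith) hα0 hβ0
  rw [jointRemainder_apply, leftMul_sigSum hm', leftMul_sigSum hk']
  simp only [compMap_sigSum hg hn hr]
  rw [← sub_add]
  refine hC' α β hα hαA hβ hβA _ _ _ _ (hdec _ _ _ _ hαl hβl) (hdec _ _ _ _ hml hβl)
    (hdec _ _ _ _ hαl hkl) (hdec _ _ _ _ hml hkl) (fun k hk => ?_) (fun k hk => ?_)
    (fun i hi => ?_) (fun i hi => ?_) ?_
  · refine (hZ.norm_colSum_sub_le hX hst v hD1 hα hβ hρα hm' hαl hβl hk).trans ?_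
    exact mul_le_mul_of_nonneg_right (by linarith) (by positivity)
  · refine (hZ.norm_colSum_sub_le hX hst u hD1 hα hβ hρα hm' hαl hkl hk).trans ?_
    exact mul_le_mul_of_nonneg_right (by linarith) (by positivity)
  · refine (hZ.norm_rowSum_sub_le hY huv t hD1 hα hβ hρβ hk' hαl hβl hi).trans ?_
    exact mul_le_mul_of_nonneg_right (by linarith) (by positivity)
  · refine (hZ.norm_rowSum_sub_le hY huv s hD1 hα hβ hρβ hk' hml hβl hi).trans ?_
    exact mul_le_mul_of_nonneg_right (by linarith) (by positivity)
  · have e := jointRemainder_apply X Y Z s t u v (sigSum n (scalePath α l))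
      (sigSum r (scalePath β l'))
    rw [leftMul_sigSum hm', leftMul_sigSum hk', ← sub_add] at e
    simp only [polyEval_sigCoeff_one]
    rw [← e]
    refine (norm_sigSum_tmul_sigSum_le hC₂ (by linarith) (hX.nonneg s t hst) hρα
      (hY.nonneg u v huv) hρβ hαl hβl (hJ s t u v hst huv)).trans ?_
    exact mul_le_mul_of_nonneg_right (by linarith) (by positivity)

/-- The families are indexed by the times together with an admissible scale, so that the passage
from signatures to tensors yields constants independent of the scale, which can then tend to the
modulus. -/
theorem RemainderBounds.exists_remainderBounds_compMap (hZ : RemainderBounds C ρX ρY X Y Z)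
    (hX : HasPaths n A CX ρX X) (hY : HasPaths r A CY ρY Y) (hab : a ≤ b) (hcd : c ≤ d)
    (hA : 1 ≤ A) (hn : 0 < n) (hr : 0 < r) (hg : ContDiff ℝ (⊤ : ℕ∞) g) :
    ∃ C' : ℝ, RemainderBounds C' ρX ρY X Y fun t v => compMap g (Z t v) := by
  have hA0 : 0 < A := by linarith
  obtain ⟨C₁, hC₁0, hC₁⟩ := exists_forall_norm_incl_tmul_incl_le_of_sigSum
    (fun q : {q : Set.Icc a b × Set.Icc a b × Set.Icc c d × ℝ //
        q.1 ≤ q.2.1 ∧ 0 < q.2.2.2 ∧ ρX q.1 q.2.1 ≤ q.2.2.2 ∧ q.2.2.2 ≤ A} =>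
      remainder₁ X (fun t v => compMap g (Z t v)) q.1.1 q.1.2.1 q.1.2.2.1)
    (α := fun q => q.1.2.2.2) (β := fun _ => 1) (w := fun q => q.1.2.2.2 ^ n)
    (fun q => q.2.2.1) (fun _ => one_pos) (fun q => pow_nonneg q.2.2.1.le n) (fun l l' => by
      obtain ⟨C', hC'⟩ := hZ.exists_norm_remainder₁_compMap_le hX hY hab hcd hA hn hr hg l l'
      refine ⟨C', ?_⟩
      rintro ⟨⟨s, t, u, α⟩, hst, hα, hρ, hαA⟩
      simpa [scalePath_one] using hC' s t u α hst hα hρ hαA)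
  obtain ⟨C₂, hC₂0, hC₂⟩ := exists_forall_norm_incl_tmul_incl_le_of_sigSum
    (fun q : {q : Set.Icc c d × Set.Icc c d × Set.Icc a b × ℝ //
        q.1 ≤ q.2.1 ∧ 0 < q.2.2.2 ∧ ρY q.1 q.2.1 ≤ q.2.2.2 ∧ q.2.2.2 ≤ A} =>
      remainder₂ Y (fun t v => compMap g (Z t v)) q.1.1 q.1.2.1 q.1.2.2.1)
    (α := fun _ => 1) (β := fun q => q.1.2.2.2) (w := fun q => q.1.2.2.2 ^ r)
    (fun _ => one_pos) (fun q => q.2.2.1) (fun q => pow_nonneg q.2.2.1.le r) (fun l l' => by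
      obtain ⟨C', hC'⟩ := hZ.exists_norm_remainder₂_compMap_le hX hY hab hcd hA hn hr hg l l'
      refine ⟨C', ?_⟩
      rintro ⟨⟨u, v, s, β⟩, huv, hβ, hρ, hβA⟩
      simpa [scalePath_one] using hC' u v s β huv hβ hρ hβA)
  refine ⟨C₁ + C₂, by positivity, fun s t u hst j hj η ξ => ?_, fun u v s huv k hk η ξ => ?_⟩
  · have hρ := hX.nonneg s t hst
    rw [mul_assoc _ ‖η‖, mul_assoc, mul_comm (ρX s t ^ (n - j)), ← mul_assoc]
    -- At a scale α the bound carries α ^ j on the left and α ^ n on the right; cancelling leaves α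
    -- ^ (n - j), and then α decreases to the modulus.
    refine le_of_forall_pow (hX.lt s t hst) (n - j) (fun α hα hρα hαA => ?_) hρ
    have h := norm_tmul_le_of_incl_right (x := incl V n j η) (y := ξ)
      (f := remainder₁ X (fun t v => compMap g (Z t v)) s t u)
      (C := fun _ => C₁ * α ^ (n - j) * ‖η‖) fun k hk ξ => by
        have h := hC₁ j hj k hk ⟨(s, t, u, α), hst, hα, hρα, hαA⟩ η ξ
        simp only [one_pow, mul_one] at h
        refine le_of_mul_le_mul_left (h.trans (le_of_eq ?_)) (pow_pos hα j)
        rw [← Nat.sub_add_cancel hj.le, pow_add, Nat.sub_add_cancel hj.le]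
        ring
    rw [← Finset.mul_sum, ← truncNorm] at h
    refine h.trans ?_
    have := truncNorm_nonneg ξ
    calc C₁ * α ^ (n - j) * ‖η‖ * truncNorm ξ ≤ (C₁ + C₂) * α ^ (n - j) * ‖η‖ * truncNorm ξ := by
          gcongr
          linarith
      _ = _ := by ring
  · have hρ := hY.nonneg u v huv
    rw [mul_assoc _ (truncNorm η), mul_assoc, mul_comm (ρY u v ^ (r - k)), ← mul_assoc]
    refine le_of_forall_pow (hY.lt u v huv) (r - k) (fun β hβ hρβ hβA => ?_) hρ
    have h := norm_tmul_le_of_incl_left (x := η) (y := incl W r k ξ)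
      (f := remainder₂ Y (fun t v => compMap g (Z t v)) u v s)
      (C := fun _ => C₂ * β ^ (r - k) * ‖ξ‖) fun j hj η => by
        have h := hC₂ j hj k hk ⟨(u, v, s, β), huv, hβ, hρβ, hβA⟩ η ξ
        simp only [one_pow, one_mul] at h
        refine le_of_mul_le_mul_left (h.trans (le_of_eq ?_)) (pow_pos hβ k)
        rw [← Nat.sub_add_cancel hk.le, pow_add, Nat.sub_add_cancel hk.le]
        ring
    rw [← Finset.mul_sum, ← truncNorm] at h
    refine h.trans ?_
    have := truncNorm_nonneg η
    calc C₂ * β ^ (r - k) * ‖ξ‖ * truncNorm η ≤ (C₁ + C₂) * β ^ (r - k) * ‖ξ‖ * truncNorm η := by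
          gcongr
          linarith
      _ = _ := by ring

theorem RemainderBounds.exists_jointBound_compMap (hZ : RemainderBounds C ρX ρY X Y Z)
    {C₂ : ℝ} (hC₂ : 0 ≤ C₂) (hJ : JointBound C₂ ρX ρY X Y Z)
    (hX : HasPaths n A CX ρX X) (hY : HasPaths r A CY ρY Y) (hab : a ≤ b) (hcd : c ≤ d)
    (hA : 1 ≤ A) (hn : 0 < n) (hr : 0 < r) (hg : ContDiff ℝ (⊤ : ℕ∞) g) :
    ∃ C' : ℝ, JointBound C' ρX ρY X Y fun t v => compMap g (Z t v) := by
  obtain ⟨C', hC'0, hC'⟩ := exists_forall_norm_incl_tmul_incl_le_of_sigSum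
    (fun q : {q : Set.Icc a b × Set.Icc a b × Set.Icc c d × Set.Icc c d × ℝ × ℝ //
        (q.1 ≤ q.2.1 ∧ q.2.2.1 ≤ q.2.2.2.1) ∧
        (0 < q.2.2.2.2.1 ∧ ρX q.1 q.2.1 ≤ q.2.2.2.2.1 ∧ q.2.2.2.2.1 ≤ A) ∧
        (0 < q.2.2.2.2.2 ∧ ρY q.2.2.1 q.2.2.2.1 ≤ q.2.2.2.2.2 ∧ q.2.2.2.2.2 ≤ A)} =>
      jointRemainder X Y (fun t v => compMap g (Z t v)) q.1.1 q.1.2.1 q.1.2.2.1 q.1.2.2.2.1)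
    (α := fun q => q.1.2.2.2.2.1) (β := fun q => q.1.2.2.2.2.2)
    (w := fun q => q.1.2.2.2.2.1 ^ n * q.1.2.2.2.2.2 ^ r)
    (fun q => q.2.2.1.1) (fun q => q.2.2.2.1)
    (fun q => mul_nonneg (pow_nonneg q.2.2.1.1.le n) (pow_nonneg q.2.2.2.1.le r)) (fun l l' => by
      obtain ⟨C', hC'⟩ :=
        hZ.exists_norm_jointRemainder_compMap_le hC₂ hJ hX hY hab hcd hA hn hr hg l l'
      refine ⟨C', ?_⟩
      rintro ⟨⟨s, t, u, v, α, β⟩, ⟨hst, huv⟩, ⟨hα, hρα, hαA⟩, ⟨hβ, hρβ, hβA⟩⟩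
      exact hC' s t u v α β hst huv hα hρα hαA hβ hρβ hβA)
  refine ⟨C', fun s t u v hst huv j hj k hk η ξ => ?_⟩
  have hρX := hX.nonneg s t hst
  have hρY := hY.nonneg u v huv
  rw [show C' * ρX s t ^ (n - j) * ρY u v ^ (r - k) * ‖η‖ * ‖ξ‖ =
    (C' * ρY u v ^ (r - k) * ‖η‖ * ‖ξ‖) * ρX s t ^ (n - j) by ring]
  refine le_of_forall_pow (hX.lt s t hst) (n - j) (fun α hα hρα hαA => ?_) hρX
  rw [show C' * ρY u v ^ (r - k) * ‖η‖ * ‖ξ‖ * α ^ (n - j) =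
    (C' * α ^ (n - j) * ‖η‖ * ‖ξ‖) * ρY u v ^ (r - k) by ring]
  refine le_of_forall_pow (hY.lt u v huv) (r - k) (fun β hβ hρβ hβA => ?_) hρY
  have h := hC' j hj k hk
    ⟨(s, t, u, v, α, β), ⟨hst, huv⟩, ⟨hα, hρα, hαA⟩, ⟨hβ, hρβ, hβA⟩⟩ η ξ
  refine le_of_mul_le_mul_left (h.trans (le_of_eq ?_)) (mul_pos (pow_pos hα j) (pow_pos hβ k))
  rw [← Nat.sub_add_cancel hj.le, ← Nat.sub_add_cancel hk.le, pow_add, pow_add,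
    Nat.sub_add_cancel hj.le, Nat.sub_add_cancel hk.le]
  ring

end Composition

/-! ### Translation between controls and moduli -/

section RealExponents

variable {V W F : Type*} [NormedAddCommGroup V] [NormedSpace ℝ V]
  [NormedAddCommGroup W] [NormedSpace ℝ W] [NormedAddCommGroup F] [NormedSpace ℝ F]
  {a b c d : ℝ} {p q : ℝ} {ωX : Set.Icc a b → Set.Icc a b → ℝ} {ωY : Set.Icc c d → Set.Icc c d → ℝ}
  {X : Set.Icc a b → Set.Icc a b → TensorAlgebra ℝ V}
  {Y : Set.Icc c d → Set.Icc c d → TensorAlgebra ℝ W}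
  {Z : Set.Icc a b → Set.Icc c d → (Trunc V ⌊p⌋₊ ⊗[ℝ] Trunc W ⌊q⌋₊ →ₗ[ℝ] F)}

theorem IsGeometricRoughPath.exists_hasPaths (hX : IsGeometricRoughPath p ωX X)
    (hω : IsControl ωX) (hp : 1 ≤ p) {A : ℝ}
    (hA : ∀ s t, s ≤ t → ωX s t ^ (1 / p) < A) :
    ∃ C : ℝ, HasPaths ⌊p⌋₊ A C (fun s t => ωX s t ^ (1 / p)) X := by
  obtain ⟨C, hC0, hC⟩ := hX.variation.exists_path hω
  have hp0 : 0 < 1 / p := by positivity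
  refine ⟨C, fun s t hst => Real.rpow_nonneg (hω.nonneg s t hst) _, hA, fun s => ?_, ?_, hC0,
    fun s t α hst hα hρ => ?_⟩
  · rw [hω.diag, Real.zero_rpow hp0.ne']
  · have h := hω.continuousOn.comp_continuous
      (f := fun q : Set.Icc a b × Set.Icc a b => (min q.1 q.2, max q.1 q.2))
      ((continuous_fst.min continuous_snd).prodMk (continuous_fst.max continuous_snd))
      (fun q => show min q.1 q.2 ≤ max q.1 q.2 from min_le_max)
    exact h.rpow_const fun _ => Or.inr hp0.le
  · obtain ⟨l, hl, hl'⟩ := hC s t α hst hα hρ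
    exact ⟨l, hl, fun k hk => hl' k hk.le⟩

theorem IsControl.exists_rpow_lt (hω : IsControl ωX) (hab : a ≤ b) (hp : 1 ≤ p) :
    ∃ A : ℝ, 1 ≤ A ∧ ∀ s t, s ≤ t → ωX s t ^ (1 / p) < A := by
  have hp0 : 0 ≤ 1 / p := by positivity
  let s₀ : Set.Icc a b := ⟨a, Set.left_mem_Icc.2 hab⟩
  let t₀ : Set.Icc a b := ⟨b, Set.right_mem_Icc.2 hab⟩
  -- Controls are monotone in the interval, so the whole interval gives the maximum; adding 1 gives
  -- the strict inequality and A ≥ 1.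
  refine ⟨ωX s₀ t₀ ^ (1 / p) + 1, ?_, fun s t hst => ?_⟩
  · have := Real.rpow_nonneg (hω.nonneg s₀ t₀ hab) (1 / p)
    linarith
  · have := Real.rpow_le_rpow (hω.nonneg s t hst)
      (hω.le (s' := s₀) (t' := t₀) s.2.1 hst t.2.2) hp0
    linarith

theorem isControlledPath_iff (hωX : IsControl ωX) (hωY : IsControl ωY) :
    IsControlledPath p q ωX ωY X Y Z ↔ ∃ C : ℝ, RemainderBounds C (fun s t => ωX s t ^ (1 / p))
      (fun u v => ωY u v ^ (1 / q)) X Y Z := by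
  constructor
  · rintro ⟨⟨C₁, h₁⟩, ⟨C₂, h₂⟩⟩
    refine ⟨|C₁| + |C₂|, by positivity, fun s t u hst j hj η ξ => (h₁ s t u hst j hj η ξ).trans ?_,
      fun u v s huv k hk η ξ => (h₂ u v s huv k hk η ξ).trans ?_⟩
    · rw [rpow_sub_div_eq (hωX.nonneg s t hst) hj.le]
      have := Real.rpow_nonneg (hωX.nonneg s t hst) (1 / p)
      have := truncNorm_nonneg ξ
      gcongr
      have := abs_nonneg C₂
      have := le_abs_self C₁
      linarith
    · rw [rpow_sub_div_eq (hωY.nonneg u v huv) hk.le]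
      have := Real.rpow_nonneg (hωY.nonneg u v huv) (1 / q)
      have := truncNorm_nonneg η
      gcongr
      have := abs_nonneg C₁
      have := le_abs_self C₂
      linarith
  · rintro ⟨C, hC⟩
    refine ⟨⟨C, fun s t u hst j hj η ξ => ?_⟩, ⟨C, fun u v s huv k hk η ξ => ?_⟩⟩
    · rw [rpow_sub_div_eq (hωX.nonneg s t hst) hj.le]
      exact hC.bound₁ s t u hst j hj η ξ
    · rw [rpow_sub_div_eq (hωY.nonneg u v huv) hk.le]
      exact hC.bound₂ u v s huv k hk η ξ

theorem hasJointVariation_iff (hωX : IsControl ωX) (hωY : IsControl ωY) :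
    HasJointVariation p q ωX ωY X Y Z ↔ ∃ C : ℝ, JointBound C (fun s t => ωX s t ^ (1 / p))
      (fun u v => ωY u v ^ (1 / q)) X Y Z := by
  refine exists_congr fun C => ?_
  refine forall₄_congr fun s t u v => forall_congr' fun hst => forall_congr' fun huv =>
    forall₂_congr fun j hj => forall₂_congr fun k hk => ?_
  rw [rpow_sub_div_eq (hωX.nonneg s t hst) hj.le, rpow_sub_div_eq (hωY.nonneg u v huv) hk.le]

theorem JointBound.abs {C : ℝ} {n r : ℕ} {ρX : Set.Icc a b → Set.Icc a b → ℝ}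
    {ρY : Set.Icc c d → Set.Icc c d → ℝ}
    {Z : Set.Icc a b → Set.Icc c d → (Trunc V n ⊗[ℝ] Trunc W r →ₗ[ℝ] F)}
    (h : JointBound C ρX ρY X Y Z) (hρX : ∀ s t, s ≤ t → 0 ≤ ρX s t)
    (hρY : ∀ u v, u ≤ v → 0 ≤ ρY u v) : JointBound |C| ρX ρY X Y Z := by
  intro s t u v hst huv j hj k hk η ξ
  refine (h s t u v hst huv j hj k hk η ξ).trans ?_
  have := hρX s t hst
  have := hρY u v huv
  gcongr
  exact le_abs_self C

end RealExponents
end TwoParam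
end

/-! ### Assembly -/

theorem mainTheorem4
    {V W F S : Type*}
    [NormedAddCommGroup V] [NormedSpace ℝ V] [FiniteDimensional ℝ V]
    [NormedAddCommGroup W] [NormedSpace ℝ W] [FiniteDimensional ℝ W]
    [NormedAddCommGroup F] [NormedSpace ℝ F] [CompleteSpace F]
    [NormedAddCommGroup S] [NormedSpace ℝ S] [FiniteDimensional ℝ S]
    {a b c d : ℝ} (hab : a ≤ b) (hcd : c ≤ d) {p q : ℝ} (hp : 1 ≤ p) (hq : 1 ≤ q)
    (ωX : Set.Icc a b → Set.Icc a b → ℝ) (hωX : TwoParam.IsControl ωX)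
    (ωY : Set.Icc c d → Set.Icc c d → ℝ) (hωY : TwoParam.IsControl ωY)
    (X : Set.Icc a b → Set.Icc a b → TensorAlgebra ℝ V)
    (hX : TwoParam.IsGeometricRoughPath p ωX X)
    (Y : Set.Icc c d → Set.Icc c d → TensorAlgebra ℝ W)
    (hY : TwoParam.IsGeometricRoughPath q ωY Y)
    (g : F → S) (hg : ContDiff ℝ (⊤ : ℕ∞) g)
    (Z : Set.Icc a b → Set.Icc c d →
      (TwoParam.Trunc V ⌊p⌋₊ ⊗[ℝ] TwoParam.Trunc W ⌊q⌋₊ →ₗ[ℝ] F))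
    (hZ : TwoParam.IsControlledPath p q ωX ωY X Y Z) :
    ∃ G : Set.Icc a b → Set.Icc c d →
      (TwoParam.Trunc V ⌊p⌋₊ ⊗[ℝ] TwoParam.Trunc W ⌊q⌋₊ →ₗ[ℝ] S),
      (∀ G', TwoParam.IsComposition g Z G' ↔ G' = G) ∧
      TwoParam.IsControlledPath p q ωX ωY X Y G ∧
      (TwoParam.HasJointVariation p q ωX ωY X Y Z →
        TwoParam.HasJointVariation p q ωX ωY X Y G) := by
  -- Completeness is needed for the integral form of the Taylor remainder of g.
  have : CompleteSpace S := FiniteDimensional.complete ℝ S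
  have hn : 0 < ⌊p⌋₊ := Nat.floor_pos.2 hp
  have hr : 0 < ⌊q⌋₊ := Nat.floor_pos.2 hq
  obtain ⟨AX, hAX1, hAX⟩ := hωX.exists_rpow_lt hab hp
  obtain ⟨AY, hAY1, hAY⟩ := hωY.exists_rpow_lt hcd hq
  -- The estimates use the same upper bound for both scales, hence the maximum.
  obtain ⟨CX, hX'⟩ := hX.exists_hasPaths hωX hp (A := max AX AY)
    fun s t hst => (hAX s t hst).trans_le (le_max_left _ _)
  obtain ⟨CY, hY'⟩ := hY.exists_hasPaths hωY hq (A := max AX AY)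
    fun u v huv => (hAY u v huv).trans_le (le_max_right _ _)
  have hA : 1 ≤ max AX AY := hAX1.trans (le_max_left _ _)
  obtain ⟨C, hC⟩ := (TwoParam.isControlledPath_iff hωX hωY).1 hZ
  refine ⟨fun t v => TwoParam.compMap g (Z t v), TwoParam.isComposition_iff hn hr g Z,
    (TwoParam.isControlledPath_iff hωX hωY).2
      (hC.exists_remainderBounds_compMap hX' hY' hab hcd hA hn hr hg), fun hJ => ?_⟩
  obtain ⟨C₂, hC₂⟩ := (TwoParam.hasJointVariation_iff hωX hωY).1 hJ
  exact (TwoParam.hasJointVariation_iff hωX hωY).2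
    (hC.exists_jointBound_compMap (abs_nonneg C₂) (hC₂.abs hX'.nonneg hY'.nonneg) hX' hY' hab hcd
      hA hn hr hg)
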